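/- **Proposition.** Let $A$ be a $0$-sectorial operator on a complex Banach space $X$: $A$ is closed with dense range, $\sigma(A)\subset[0,\infty)$, and for every $\theta\in(0,\pi)$ the operators $\lambda(\lambda-A)^{-1}$ are uniformly bounded for $\lambda\notin\overline{\Sigma_\theta}$, where $\Sigma_\theta=\{z\ne0:|\arg z|<\theta\}$. For $f\in\bigcap_{0<\omega<\pi}H^\infty(\Sigma_\omega)$ let $f(A)=\rho(A)^{-1}(\rho f)(A)$ be given by the extended holomorphic calculus, with $\rho(\lambda)=\lambda(1+\lambda)^{-2}$ and with $\rho(A),(\rho f)(A)$ defined by Cauchy integrals along the boundary of a sector; in particular this defines the imaginary powers $A^{it}$, $t\in\mathbb R$. For $\beta>\frac12$ let $\mathcal W^\beta_2=\{f:(0,\infty)\to\mathbb C:\ f\circ\exp\in W^\beta_2(\mathbb R)\}$, normed by $\|f\|_{\mathcal W^\beta_2}=\|f\circ\exp\|_{W^\beta_2(\mathbb R)}$. Assume that for some (possibly large) $\beta>\frac12$ the operator $A$ has a bounded $\mathcal W^\beta_2$ calculus, i.e. there is $C$ such that $f(A)$ is bounded with $\|f(A)\|\le C\|f\|_{\mathcal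 W^\beta_2}$ for all $f\in\mathcal W^\beta_2\cap\bigcap_{0<\omega<\pi}H^\infty(\Sigma_\omega)$; extend $f\mapsto f(A)$ continuously to $\mathcal W^\beta_2$. Let $\varphi\in C^\infty_c(0,\infty)$ satisfy $\operatorname{supp}\varphi\subset[\frac12,2]$ and $\sum_{n\in\mathbb Z}\varphi(2^{-n}s)=1$ for $s>0$; put $\varphi_n=\varphi(2^{-n}\cdot)$ and $$D_A=\{x\in X:\ \exists N\ \ \varphi_n(A)x=0\text{ for all }|n|\ge N\}.$$ For $f$ with $f\circ\exp\in W^\beta_{2,\mathrm{loc}}(\mathbb R)$ let $f(A)$ be the closure of $D_A\to X$, $x\mapsto\sum_{n\in\mathbb Z}(f\varphi_n)(A)x$ (a finite sum for each $x\in D_A$). Let $m\in\mathbb N_0$, $\alpha-\frac12\in(m,m+1)$, $$w_\alpha(s)=|s|^{-\alpha}\Big(e^{is}-\sum_{j=0}^{m}\frac{(is)^j}{j!}\Big),$$ and for $s>0$ let $(sA)^{1/2}w_\alpha(sA)$ be the operator $f_s(A)$ with $f_s(\lambda)=(s\lambda)^{1/2}w_\alpha(s\lambda)$. Let $x\in D_A$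 and $x'\in X'$, and assume that $$t\mapsto(1+t^2)^{-\alpha/2}\langle A^{it}x,x'\rangle\in L^2(\mathbb R,dt)\quad\text{or}\quad s\mapsto\langle(sA)^{1/2}w_\alpha(sA)x,x'\rangle\in L^2\big((0,\infty),\tfrac{ds}{s}\big).$$ Then $x$ lies in the domain of $(sA)^{1/2}w_\alpha(sA)$ for every $s>0$ and in the domain of $A^{it}$ for every $t\in\mathbb R$; the function $s\mapsto\langle(sA)^{1/2}w_\alpha(sA)x,x'\rangle$ is in $L^2((0,\infty),\frac{ds}{s})$, the right-hand side below is in $L^2(\mathbb R,dt)$, and $$M\big[\langle(sA)^{1/2}w_\alpha(sA)x,x'\rangle\big](t)=i^{-\alpha+\frac12+it}\,\Gamma\big(-\alpha+\tfrac12+it\big)\,\langle A^{-it}x,x'\rangle\quad\text{in }L^2(\mathbb R,dt),$$ where $i^z=e^{i\pi z/2}$ and $Mf(t)=\int_0^\infty f(s)s^{it}\frac{ds}{s}$ is the Mellin transform $L^2((0,\infty),\frac{ds}{s})\to L^2(\mathbb R,dt)$ (the limit in $L^2(\mathbb R,dt)$ of $\int_{1/R}^{R}f(s)s^{it}\frac{ds}{s}$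 as $R\to\infty$). -/

import Mathlib

open MeasureTheory Set Filter Topology
open scoped ENNReal

namespace WaveMellin

noncomputable section

variable {X : Type*} [NormedAddCommGroup X] [NormedSpace ℂ X]

/-! ### Sectorial operators -/

/-- The open sector `{z ≠ 0 : |arg z| < ω}`. -/
def sector (ω : ℝ) : Set ℂ := {z | z ≠ 0 ∧ |z.arg| < ω}

/-- `R` is the bounded two-sided inverse of `l - A : D(A) → X`. -/
def IsResolventOp (A : X →ₗ.[ℂ] X) (l : ℂ) (R : X →L[ℂ] X) : Prop :=
  (∀ x : A.domain, R (l • (x : X) - A x) = x) ∧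
    ∀ y : X, ∃ h : R y ∈ A.domain, l • R y - A ⟨R y, h⟩ = y

def resolventSet (A : X →ₗ.[ℂ] X) : Set ℂ := {l | ∃ R, IsResolventOp A l R}

open Classical in
/-- `(l - A)⁻¹` for `l` in the resolvent set (and `0` elsewhere). -/
def resolvent (A : X →ₗ.[ℂ] X) (l : ℂ) : X →L[ℂ] X :=
  if h : ∃ R, IsResolventOp A l R then h.choose else 0

/-- `A` is `ω`-sectorial: closed, with spectrum in the closed sector of half-angle `ω`, with dense
range, and with `‖l (l - A)⁻¹‖` bounded outside every larger closed sector. -/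
structure IsSectorial (A : X →ₗ.[ℂ] X) (ω : ℝ) : Prop where
  closed : A.IsClosed
  spectrum_subset : (resolventSet A)ᶜ ⊆ closure (sector ω)
  denseRange : Dense (Set.range fun x : A.domain => A x)
  bound : ∀ θ, ω < θ → ∃ C : ℝ, ∀ l ∈ (closure (sector θ))ᶜ, ‖l • resolvent A l‖ ≤ C

def IsZeroSectorial (A : X →ₗ.[ℂ] X) : Prop :=
  ∀ ω ∈ Ioo 0 Real.pi, IsSectorial A ω

/-! ### Holomorphic functional calculus -/

/-- `(1 / 2πi) ∫_Γ f(l) (l - A)⁻¹ dl`, where `Γ` is the boundary of `sector σ`, oriented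
counterclockwise: outwards along `arg l = -σ` and inwards along `arg l = σ`. -/
def cauchyIntegral (A : X →ₗ.[ℂ] X) (σ : ℝ) (f : ℂ → ℂ) : X →L[ℂ] X :=
  (2 * Real.pi * Complex.I : ℂ)⁻¹ •
    ((∫ r in Ioi (0 : ℝ), (f (r * Complex.exp (-(σ * Complex.I))) *
        Complex.exp (-(σ * Complex.I))) • resolvent A (r * Complex.exp (-(σ * Complex.I)))) -
      ∫ r in Ioi (0 : ℝ), (f (r * Complex.exp (σ * Complex.I)) *
        Complex.exp (σ * Complex.I)) • resolvent A (r * Complex.exp (σ * Complex.I)))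

/-- The regularizing function `l (1 + l)⁻²`. -/
def rho (l : ℂ) : ℂ := l / (1 + l) ^ 2

/-- `f ∈ ⋂_{0 < ω < π} H^∞(sector ω)`. The union of these sectors is the slit plane. -/
def InHInf (f : ℂ → ℂ) : Prop :=
  DifferentiableOn ℂ f Complex.slitPlane ∧
    ∀ ω ∈ Ioo 0 Real.pi, ∃ C : ℝ, ∀ z ∈ sector ω, ‖f z‖ ≤ C

/-- The extended holomorphic calculus on `⋂_ω H^∞(sector ω)`: `f(A) = ρ(A)⁻¹ (ρ f)(A)`, that is,
`f(A) x = y` iff `ρ(A) y = (ρ f)(A) x`, where `ρ(A)` and `(ρ f)(A)` are Cauchy integrals. For such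
`f` and `0`-sectorial `A` the angle of the contour in `(0, π)` is immaterial; it is `π / 2` here. -/
def holCalc (A : X →ₗ.[ℂ] X) (f : ℂ → ℂ) : X →ₗ.[ℂ] X :=
  (LinearMap.ker
    ((cauchyIntegral A (Real.pi / 2) rho).toLinearMap ∘ₗ LinearMap.snd ℂ X X -
      (cauchyIntegral A (Real.pi / 2) fun z => rho z * f z).toLinearMap ∘ₗ
        LinearMap.fst ℂ X X)).toLinearPMap

/-- The bounded operator `T` equals `f(A)` (in particular `f(A)` is everywhere defined). -/
def HolCalcEq (A : X →ₗ.[ℂ] X) (f : ℂ → ℂ) (T : X →L[ℂ] X) : Prop :=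
  holCalc A f = T.toLinearMap.toPMap ⊤

/-- The imaginary power `A^{it}`. -/
def imagPow (A : X →ₗ.[ℂ] X) (t : ℝ) : X →ₗ.[ℂ] X :=
  holCalc A fun z => z ^ (Complex.I * t)

/-! ### Sobolev functional calculus -/

open Classical in
/-- The norm `‖(1 + |t|)^β ĝ‖_{L²}` of the Sobolev space `W^β_2(ℝ)`, equal to `∞` off the space.
The normalization of the Fourier transform changes it only to an equivalent norm. -/
def sobolevNorm (β : ℝ) (g : ℝ → ℂ) : ℝ≥0∞ :=
  if h : MemLp g 2 volume then
    eLpNorm (fun t : ℝ => (((1 + |t|) ^ β : ℝ) : ℂ) *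
      (FourierTransform.fourier (h.toLp g) : Lp ℂ 2 (volume : Measure ℝ)) t) 2 volume
  else ⊤

/-- The norm of `f : (0, ∞) → ℂ` in the space `{f : f ∘ exp ∈ W^β_2(ℝ)}`. -/
def expSobolevNorm (β : ℝ) (f : ℝ → ℂ) : ℝ≥0∞ := sobolevNorm β fun u => f (Real.exp u)

/-- `A` has a bounded calculus for the space `{f : f ∘ exp ∈ W^β_2(ℝ)}`. -/
def HasSobolevCalculus (A : X →ₗ.[ℂ] X) (β : ℝ) : Prop :=
  ∃ C : ℝ, ∀ f : ℂ → ℂ, InHInf f → expSobolevNorm β (fun s => f s) < ⊤ →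
    ∃ T : X →L[ℂ] X, HolCalcEq A f T ∧ ‖T‖ ≤ C * (expSobolevNorm β fun s => f s).toReal

/-- `T` is the value at `f` of the continuous extension of `g ↦ g(A)` from the holomorphic functions
in the Sobolev space to the whole space. -/
def IsSobolevCalcValue (A : X →ₗ.[ℂ] X) (β : ℝ) (f : ℝ → ℂ) (T : X →L[ℂ] X) : Prop :=
  ∃ (g : ℕ → ℂ → ℂ) (S : ℕ → X →L[ℂ] X),
    (∀ k, InHInf (g k) ∧ expSobolevNorm β (fun s => g k s) < ⊤ ∧ HolCalcEq A (g k) (S k)) ∧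
      Tendsto (fun k => expSobolevNorm β fun s => g k s - f s) atTop (𝓝 0) ∧
      Tendsto S atTop (𝓝 T)

open Classical in
/-- The bounded operator `f(A)` for `f ∘ exp ∈ W^β_2(ℝ)`, if `A` has the bounded calculus. -/
def sobolevCalc (A : X →ₗ.[ℂ] X) (β : ℝ) (f : ℝ → ℂ) : X →L[ℂ] X :=
  if h : ∃ T, IsSobolevCalcValue A β f T then h.choose else 0

/-- The dyadic dilate `φ_n = φ(2^{-n} ·)`. -/
def dyad (φ : ℝ → ℂ) (n : ℤ) (s : ℝ) : ℂ := φ ((2 : ℝ) ^ (-n) * s)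

/-- `φ ∈ C^∞_c(0, ∞)` generates a dyadic partition of unity. -/
structure IsDyadicPartition (φ : ℝ → ℂ) : Prop where
  smooth : ContDiff ℝ ((⊤ : ℕ∞) : WithTop ℕ∞) φ
  support : tsupport φ ⊆ Icc (1 / 2) 2
  sum_eq_one : ∀ s : ℝ, 0 < s → HasSum (fun n : ℤ => dyad φ n s) 1

/-- The calculus core `D_A = {x : ∃ N, φ_n(A) x = 0 for |n| ≥ N}`. -/
def core (A : X →ₗ.[ℂ] X) (β : ℝ) (φ : ℝ → ℂ) : Set X :=
  {x | ∃ N : ℕ, ∀ n : ℤ, (N : ℤ) ≤ |n| → sobolevCalc A β (dyad φ n) x = 0}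

/-- The unbounded calculus for `f` with `f ∘ exp ∈ W^β_{2,loc}(ℝ)`: `f(A)` is the closure of
`D_A → X, x ↦ ∑_n (f φ_n)(A) x` (a finite sum for each `x ∈ D_A`). Its graph is the closure of the
graph of that map. -/
def locCalc (A : X →ₗ.[ℂ] X) (β : ℝ) (φ : ℝ → ℂ) (f : ℝ → ℂ) : X →ₗ.[ℂ] X :=
  (Submodule.span ℂ {p : X × X | p.1 ∈ core A β φ ∧
    p.2 = ∑ᶠ n : ℤ, sobolevCalc A β (fun s => f s * dyad φ n s) p.1}).topologicalClosure.toLinearPMap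

/-! ### The wave functions and the Mellin transform -/

/-- `w_α(s) = |s|^{-α} (e^{is} - ∑_{j=0}^{m} (is)^j / j!)`. -/
def waveFun (α : ℝ) (m : ℕ) (s : ℝ) : ℂ :=
  ((|s| ^ (-α) : ℝ) : ℂ) * (Complex.exp (Complex.I * s) -
    ∑ j ∈ Finset.range (m + 1), (Complex.I * s) ^ j / (j.factorial : ℂ))

/-- The operator `(sA)^{1/2} w_α(sA)`. -/
def waveOp (A : X →ₗ.[ℂ] X) (β : ℝ) (φ : ℝ → ℂ) (α : ℝ) (m : ℕ) (s : ℝ) : X →ₗ.[ℂ] X :=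
  locCalc A β φ fun l => (((s * l) ^ (1 / 2 : ℝ) : ℝ) : ℂ) * waveFun α m (s * l)

open Classical in
/-- `⟨T x, x'⟩` for `x ∈ D(T)` (and `0` off the domain). -/
def pairing (T : X →ₗ.[ℂ] X) (x : X) (x' : X →L[ℂ] ℂ) : ℂ :=
  if h : x ∈ T.domain then x' (T ⟨x, h⟩) else 0

/-- The measure `ds / s` on `(0, ∞)`. -/
def mulHaar : Measure ℝ :=
  (volume.restrict (Ioi (0 : ℝ))).withDensity fun s => ENNReal.ofReal s⁻¹

/-- `f ∈ L²((0, ∞), ds/s)`, `g ∈ L²(ℝ, dt)`, and `g` is the Mellin transform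
`M f (t) = ∫_0^∞ f(s) s^{it} ds/s`, the integral being the limit in `L²(ℝ, dt)` of the integrals
over `(1/R, R)` as `R → ∞`. -/
def IsMellinTransform (f g : ℝ → ℂ) : Prop :=
  MemLp f 2 mulHaar ∧ MemLp g 2 volume ∧
    Tendsto (fun R : ℝ => eLpNorm
      (fun t : ℝ => (∫ s in R⁻¹..R, f s * (s : ℂ) ^ (Complex.I * t) / s) - g t) 2 volume)
      atTop (𝓝 0)

end

end WaveMellin

/-!
In the logarithmic variable `s = e^v`, `λ = e^u` the statement is a Fourier transform formula: the
operator `(sA)^{1/2} w_α(sA)` is the value at `G (· + v)` of a calculus for functions of `log A`,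
where `G = waveExp α m` is the function `λ^{1/2} w_α(λ)` in the variable `u`, and `A^{it}` is the
value at `u ↦ e^{itu}`. Formally `G(log A + v)` is the superposition of the operators
`e^{2πiξv} A^{2πiξ}` with the weights `𝓕 G ξ`, so the Fourier transform of
`H v = ⟨G(log A + v) x, x'⟩` is `q ξ = 𝓕 G ξ * ⟨A^{2πiξ} x, x'⟩`. The function `G` is integrable
because `m < α - 1/2 < m + 1`, and `𝓕 G` is computed in `fourier_waveExp` from the Mellin
transform of the exponential minus its Taylor polynomial: it is `i^z Γ(z)` at
`z = 1/2 - α - 2πiξ`.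

The imaginary powers are unbounded operators, which are handled through the bounded operators
`regImagPow A t = (ρ(λ) λ^{it})(A)`. Cauchy's theorem on horizontal strips (for the resolvent in the
logarithmic variable) shows that the Cauchy integrals are multiplicative (`cauchyIntegral_mul`) and
that `ρ(A) = A (1 + A)⁻²` is injective (`cauchyIntegral_rho_injective`). The bounded calculus gives
`‖regImagPow A t‖ ≤ C (1 + |t|)^β`, the growth of the Sobolev norm of `ρ(e^u) e^{itu}`
(`exists_bound_regImagPow`). For band-limited functions of `log λ`, which extend holomorphically to
all sectors, `(ρ f)(A)` is the Fourier integral of the operators `regImagPow A t`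
(`cauchyIntegral_rho_mul_holExt`). Approximation extends this to all Schwartz functions of `log λ`
(`exists_isSobolevCalcValue`), on which the Sobolev calculus becomes the multiplicative map
`schwartzCalc`.

An element `x` of the core is fixed by the value of the calculus at a finite dyadic sum
(`exists_dyadSum_apply_eq`), and `1/ρ` times that sum is smooth with compact support. Therefore
`x = ρ(A) y` for some `y`, which puts it into the domain of every `A^{it}`, with
`A^{it} x = regImagPow A t y`. It is also in the domain of the wave operators, whose values at `x` are those of the Schwartz
calculus at `G (· + v)` times the dyadic sum (`mem_graph_locCalc`).

The identity `𝓕 H = q` is first obtained in the sense of distributions (`integral_orbitCoeff_mul`).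
Since `|i^z Γ(z)|` is bounded by a multiple of `(1 + t²)^{-α/2}` on the line in question
(`exists_norm_I_cpow_mul_Gamma_le`, where the Phragmén–Lindelöf principle interpolates between lines
on which `|Γ|` is known explicitly), the first alternative of the hypothesis says that `q` is in
`L²`; the second says that `H` is. Either of them turns the distributional identity into one between
`L²` functions (`exists_fourier_toLp_ae_eq`), and Plancherel's theorem applied to the truncations of
`H` gives the limit that defines the Mellin transform (`isMellinTransform_of_fourier`).
-/

namespace WaveMellin

/-! ### Resolvents outside a sector -/

section Resolvent

variable {X : Type*} [NormedAddCommGroup X] [NormedSpace ℂ X] {A : X →ₗ.[ℂ] X}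

/-- The complement of the closed sector of half-angle `π / 4`. -/
def outerRegion : Set ℂ := {l | l.re < ‖l‖ * Real.cos (Real.pi / 4)}

theorem closure_sector_subset {ω : ℝ} (hω : ω ∈ Ioo 0 Real.pi) :
    closure (sector ω) ⊆ {z | ‖z‖ * Real.cos ω ≤ z.re} := by
  refine closure_minimal ?_ (isClosed_le (by fun_prop) Complex.continuous_re)
  rintro z ⟨hz, harg⟩
  have h1 : z.re = ‖z‖ * Real.cos z.arg := by
    rw [Complex.cos_arg hz]; field_simp [norm_ne_zero_iff.2 hz]
  rw [mem_ofPred_eq, h1]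
  refine mul_le_mul_of_nonneg_left ?_ (norm_nonneg _)
  rw [← Real.cos_abs z.arg]
  exact Real.cos_le_cos_of_nonneg_of_le_pi (abs_nonneg _) hω.2.le harg.le

theorem pi_div_four_mem : Real.pi / 4 ∈ Ioo 0 Real.pi := by
  constructor <;> linarith [Real.pi_pos]

theorem notMem_closure_sector {l : ℂ} (hl : l ∈ outerRegion) :
    l ∉ closure (sector (Real.pi / 4)) := fun h =>
  lt_irrefl _ (lt_of_lt_of_le (show l.re < ‖l‖ * Real.cos (Real.pi / 4) from hl)
    (closure_sector_subset pi_div_four_mem h))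

theorem isOpen_outerRegion : IsOpen outerRegion :=
  isOpen_lt Complex.continuous_re (by fun_prop)

theorem ne_zero_of_mem_outerRegion {l : ℂ} (hl : l ∈ outerRegion) : l ≠ 0 := by
  rintro rfl
  simp [outerRegion] at hl

theorem neg_exp_mem_outerRegion {ζ : ℂ} (hζ : |ζ.im| < 3 * Real.pi / 4) :
    -Complex.exp ζ ∈ outerRegion := by
  have h1 : Real.cos (3 * Real.pi / 4) < Real.cos ζ.im := by
    rw [← Real.cos_abs ζ.im]
    exact Real.cos_lt_cos_of_nonneg_of_le_pi (abs_nonneg _) (by linarith [Real.pi_pos]) hζ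
  have h2 : Real.cos (3 * Real.pi / 4) = -Real.cos (Real.pi / 4) := by
    rw [← Real.cos_pi_sub]; congr 1; ring
  simp only [outerRegion, mem_ofPred_eq, Complex.neg_re, Complex.exp_re, norm_neg, Complex.norm_exp]
  nlinarith [Real.exp_pos ζ.re]

theorem isResolventOp_resolvent (hA : IsZeroSectorial A) {l : ℂ} (hl : l ∈ outerRegion) :
    IsResolventOp A l (resolvent A l) := by
  have h : ∃ R, IsResolventOp A l R := by
    by_contra hc
    exact notMem_closure_sector hl ((hA _ pi_div_four_mem).spectrum_subset hc)
  rw [resolvent, dif_pos h]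
  exact h.choose_spec

theorem exists_bound_smul_resolvent (hA : IsZeroSectorial A) :
    ∃ C : ℝ, 0 ≤ C ∧ ∀ l ∈ outerRegion, ‖l • resolvent A l‖ ≤ C := by
  obtain ⟨C, hC⟩ := (hA (Real.pi / 8) ⟨by linarith [Real.pi_pos], by linarith [Real.pi_pos]⟩).bound
    (Real.pi / 4) (by linarith [Real.pi_pos])
  exact ⟨|C|, abs_nonneg _, fun l hl => (hC l (notMem_closure_sector hl)).trans (le_abs_self C)⟩

/-- The resolvent identity. -/
theorem IsResolventOp.sub_eq {l k : ℂ} {R S : X →L[ℂ] X} (hR : IsResolventOp A l R)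
    (hS : IsResolventOp A k S) : R - S = (k - l) • (R * S) := by
  ext y
  obtain ⟨h, hy⟩ := hS.2 y
  have h1 := hR.1 ⟨S y, h⟩
  have h2 : R y = R (l • S y - A ⟨S y, h⟩) + (k - l) • R (S y) := by
    have h3 : R y = R (k • S y - A ⟨S y, h⟩) := by rw [hy]
    rw [h3]
    simp only [map_sub, map_smul, sub_smul]
    abel
  simp only [sub_apply, smul_apply,
    mul_apply_eq_comp]
  rw [h2, h1]
  simp

theorem resolvent_sub (hA : IsZeroSectorial A) {l k : ℂ} (hl : l ∈ outerRegion)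
    (hk : k ∈ outerRegion) :
    resolvent A l - resolvent A k = (k - l) • (resolvent A l * resolvent A k) :=
  (isResolventOp_resolvent hA hl).sub_eq (isResolventOp_resolvent hA hk)

theorem continuousOn_resolvent (hA : IsZeroSectorial A) :
    ContinuousOn (resolvent A) outerRegion := by
  obtain ⟨C, hC0, hC⟩ := exists_bound_smul_resolvent hA
  have hb : ∀ l ∈ outerRegion, ‖resolvent A l‖ ≤ C / ‖l‖ := fun l hl => by
    rw [le_div_iff₀ (norm_pos_iff.2 (ne_zero_of_mem_outerRegion hl)), mul_comm, ← norm_smul]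
    exact hC l hl
  intro l hl
  refine (continuousWithinAt_iff_continuousAt (isOpen_outerRegion.mem_nhds hl)).2 ?_
  rw [ContinuousAt, tendsto_iff_norm_sub_tendsto_zero]
  have hl0 := ne_zero_of_mem_outerRegion hl
  have hlim : Tendsto (fun k : ℂ => ‖l - k‖ * (C / ‖k‖ * (C / ‖l‖))) (𝓝 l) (𝓝 0) := by
    have : ContinuousAt (fun k : ℂ => ‖l - k‖ * (C / ‖k‖ * (C / ‖l‖))) l := by
      have : ‖l‖ ≠ 0 := norm_ne_zero_iff.2 hl0
      fun_prop (disch := assumption)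
    simpa [ContinuousAt] using this
  refine squeeze_zero' (Eventually.of_forall fun _ => norm_nonneg _) ?_ hlim
  filter_upwards [isOpen_outerRegion.mem_nhds hl] with k hk
  rw [resolvent_sub hA hk hl, norm_smul]
  refine mul_le_mul_of_nonneg_left ((norm_mul_le _ _).trans ?_) (norm_nonneg _)
  exact mul_le_mul (hb k hk) (hb l hl) (norm_nonneg _) (by positivity)

theorem hasDerivAt_resolvent (hA : IsZeroSectorial A) {l : ℂ} (hl : l ∈ outerRegion) :
    HasDerivAt (resolvent A) (-(resolvent A l * resolvent A l)) l := by
  have hU := isOpen_outerRegion.mem_nhds hl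
  rw [hasDerivAt_iff_tendsto_slope]
  have h1 : Tendsto (fun k => -(resolvent A k * resolvent A l)) (𝓝[≠] l)
      (𝓝 (-(resolvent A l * resolvent A l))) :=
    ((((continuousOn_resolvent hA).continuousAt hU).mul continuousAt_const).neg).tendsto.mono_left
      nhdsWithin_le_nhds
  refine h1.congr' ?_
  filter_upwards [mem_nhdsWithin_of_mem_nhds hU, self_mem_nhdsWithin] with k hk hkl
  have : k - l ≠ 0 := sub_ne_zero.2 hkl
  rw [slope_def_module, resolvent_sub hA hk hl, smul_smul, ← neg_sub k l, mul_neg,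
    inv_mul_cancel₀ this, neg_one_smul]

/-- The function `l (l - A)⁻¹` in the logarithmic coordinate `l = -e^ζ`. -/
noncomputable def logResolvent (A : X →ₗ.[ℂ] X) (ζ : ℂ) : X →L[ℂ] X :=
  (-Complex.exp ζ) • resolvent A (-Complex.exp ζ)

theorem exists_bound_logResolvent (hA : IsZeroSectorial A) :
    ∃ C : ℝ, 0 ≤ C ∧ ∀ ζ : ℂ, |ζ.im| < 3 * Real.pi / 4 → ‖logResolvent A ζ‖ ≤ C := by
  obtain ⟨C, hC0, hC⟩ := exists_bound_smul_resolvent hA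
  exact ⟨C, hC0, fun ζ hζ => hC _ (neg_exp_mem_outerRegion hζ)⟩

theorem hasDerivAt_logResolvent (hA : IsZeroSectorial A) {ζ : ℂ}
    (hζ : |ζ.im| < 3 * Real.pi / 4) :
    HasDerivAt (logResolvent A)
      ((-Complex.exp ζ) • (-Complex.exp ζ) • (-(resolvent A (-Complex.exp ζ) *
        resolvent A (-Complex.exp ζ))) + (-Complex.exp ζ) • resolvent A (-Complex.exp ζ)) ζ := by
  have he : HasDerivAt (fun ζ => -Complex.exp ζ) (-Complex.exp ζ) ζ :=
    (Complex.hasDerivAt_exp ζ).neg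
  exact he.smul ((hasDerivAt_resolvent hA (neg_exp_mem_outerRegion hζ)).scomp ζ he)

theorem differentiableAt_logResolvent (hA : IsZeroSectorial A) {ζ : ℂ}
    (hζ : |ζ.im| < 3 * Real.pi / 4) : DifferentiableAt ℂ (logResolvent A) ζ :=
  (hasDerivAt_logResolvent hA hζ).differentiableAt

theorem logResolvent_mul (hA : IsZeroSectorial A) {ζ η : ℂ} (hζ : |ζ.im| < 3 * Real.pi / 4)
    (hη : |η.im| < 3 * Real.pi / 4) (hne : Complex.exp ζ ≠ Complex.exp η) :
    logResolvent A ζ * logResolvent A η =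
      (Complex.exp ζ / (Complex.exp ζ - Complex.exp η)) • logResolvent A η +
      (Complex.exp η / (Complex.exp η - Complex.exp ζ)) • logResolvent A ζ := by
  have h := resolvent_sub hA (neg_exp_mem_outerRegion hζ) (neg_exp_mem_outerRegion hη)
  have h1 : Complex.exp ζ - Complex.exp η ≠ 0 := sub_ne_zero.2 hne
  have h2 : Complex.exp η - Complex.exp ζ ≠ 0 := sub_ne_zero.2 hne.symm
  have h3 : resolvent A (-Complex.exp ζ) * resolvent A (-Complex.exp η) =
      (Complex.exp ζ - Complex.exp η)⁻¹ • (resolvent A (-Complex.exp ζ) -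
        resolvent A (-Complex.exp η)) := by
    rw [h, smul_smul, show -Complex.exp η - -Complex.exp ζ = Complex.exp ζ - Complex.exp η by ring,
      inv_mul_cancel₀ h1, one_smul]
  simp only [logResolvent, smul_mul_smul_comm]
  rw [h3]
  simp only [smul_sub, smul_smul]
  rw [add_comm, sub_eq_add_neg, ← neg_smul]
  congr 2
  · rw [← neg_sub (Complex.exp ζ) (Complex.exp η)]
    field_simp
  · field_simp

/-- A sectorial operator with dense range is injective: `c (c + A)⁻¹` fixes the kernel and tends to
`0` strongly on the range as `c → 0`. -/
theorem eq_zero_of_apply_eq_zero (hA : IsZeroSectorial A) (x : A.domain) (hx : A x = 0) :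
    (x : X) = 0 := by
  obtain ⟨C, hC0, hC⟩ := exists_bound_smul_resolvent hA
  have hreg : ∀ c : ℝ, 0 < c → (-(c : ℂ)) ∈ outerRegion := fun c hc => by
    have : 0 < Real.cos (Real.pi / 4) :=
      Real.cos_pos_of_mem_Ioo ⟨by linarith [Real.pi_pos], by linarith [Real.pi_pos]⟩
    simp only [outerRegion, mem_ofPred_eq, Complex.neg_re, Complex.ofReal_re, norm_neg]
    have : 0 ≤ ‖(c : ℂ)‖ * Real.cos (Real.pi / 4) := by positivity
    linarith
  have hfix : ∀ c : ℝ, 0 < c → (-(c : ℂ)) • resolvent A (-(c : ℂ)) (x : X) = x := fun c hc => by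
    have := (isResolventOp_resolvent hA (hreg c hc)).1 x
    rwa [hx, sub_zero, map_smul] at this
  have key : ∀ y : A.domain, ‖(x : X)‖ ≤ C * ‖(x : X) - A y‖ := by
    intro y
    have h1 : ∀ c : ℝ, 0 < c →
        ‖(x : X)‖ ≤ C * ‖(x : X) - A y‖ + c * ((C + 1) * ‖(y : X)‖) := by
      intro c hc
      set l : ℂ := -(c : ℂ)
      have hRy := (isResolventOp_resolvent hA (hreg c hc)).1 y
      have hAy : l • resolvent A l (A y) = l • (l • resolvent A l (y : X) - y) := by
        congr 1
        rw [map_sub, map_smul] at hRy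
        change l • resolvent A l (y : X) - resolvent A l (A y) = y at hRy
        exact eq_sub_of_add_eq' (sub_eq_iff_eq_add.1 hRy).symm
      have hx2 : (x : X) = (l • resolvent A l) ((x : X) - A y) + l • (l • resolvent A l (y : X) - y) := by
        rw [← hAy, map_sub]
        simp only [smul_apply]
        rw [hfix c hc]; abel
      have hn : ‖l‖ = c := by simp [l, abs_of_pos hc]
      have hb := hC l (hreg c hc)
      calc ‖(x : X)‖ ≤ ‖(l • resolvent A l) ((x : X) - A y)‖ +
            ‖l • (l • resolvent A l (y : X) - y)‖ := by
            conv_lhs => rw [hx2]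
            exact norm_add_le _ _
        _ ≤ C * ‖(x : X) - A y‖ + c * ((C + 1) * ‖(y : X)‖) := by
            gcongr
            · exact (ContinuousLinearMap.le_opNorm _ _).trans (by gcongr)
            · rw [norm_smul, hn]
              gcongr
              have h3 : ‖(l • resolvent A l) (y : X)‖ ≤ C * ‖(y : X)‖ :=
                (ContinuousLinearMap.le_opNorm _ _).trans (by gcongr)
              rw [smul_apply] at h3
              calc _ ≤ ‖l • resolvent A l (y : X)‖ + ‖(y : X)‖ := norm_sub_le _ _
                _ ≤ _ := by linarith
    have hlim : Tendsto (fun c : ℝ => C * ‖(x : X) - A y‖ + c * ((C + 1) * ‖(y : X)‖)) (𝓝[>] 0)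
        (𝓝 (C * ‖(x : X) - A y‖)) := by
      have : Continuous fun c : ℝ => C * ‖(x : X) - A y‖ + c * ((C + 1) * ‖(y : X)‖) := by fun_prop
      simpa using (this.tendsto 0).mono_left nhdsWithin_le_nhds
    exact ge_of_tendsto hlim (by filter_upwards [self_mem_nhdsWithin] with c hc using h1 c hc)
  have hd := (hA _ pi_div_four_mem).denseRange
  rw [← norm_eq_zero]
  refine le_antisymm (le_of_forall_pos_le_add fun ε hε => ?_) (norm_nonneg _)
  obtain ⟨y, hy⟩ := hd.exists_dist_lt (x : X) (show 0 < ε / (C + 1) by positivity)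
  obtain ⟨⟨y, rfl⟩, hy⟩ := hy
  rw [dist_eq_norm] at hy
  rw [zero_add]
  refine (key y).trans ?_
  calc C * ‖(x : X) - A y‖ ≤ C * (ε / (C + 1)) := by gcongr
    _ ≤ ε := by
      rw [mul_div_assoc', div_le_iff₀ (by positivity)]; nlinarith

/-- `A (1 + A)⁻² = -R - R²` with `R = (-1 - A)⁻¹` is injective. -/
theorem eq_zero_of_resolvent_neg_one (hA : IsZeroSectorial A) {x : X}
    (hx : (-(resolvent A (-1) * resolvent A (-1)) * 1 - resolvent A (-1)) x = 0) : x = 0 := by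
  have h1 : (-1 : ℂ) ∈ outerRegion := by
    simpa using neg_exp_mem_outerRegion (ζ := 0) (by simp; positivity)
  set R := resolvent A (-1)
  have hR := isResolventOp_resolvent hA h1
  have hinj : ∀ y, R y = 0 → y = 0 := fun y hy => by
    obtain ⟨h, he⟩ := hR.2 y
    have : (⟨R y, h⟩ : A.domain) = 0 := Subtype.ext hy
    change (-1 : ℂ) • R y - A ⟨R y, h⟩ = y at he
    rw [this] at he
    simpa [hy] using he.symm
  simp only [mul_one, sub_apply, neg_apply,
    mul_apply_eq_comp] at hx
  have h2 : R (R x + x) = 0 := by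
    rw [map_add, ← neg_eq_zero, ← hx]; abel
  have h3 : R x = -x := eq_neg_of_add_eq_zero_left (hinj _ h2)
  obtain ⟨h, he⟩ := hR.2 x
  change (-1 : ℂ) • R x - A ⟨R x, h⟩ = x at he
  have h4 : A ⟨R x, h⟩ = 0 := by
    have h5 : A ⟨R x, h⟩ = (-1 : ℂ) • R x - x := by
      conv_rhs => enter [2]; rw [← he]
      abel
    rw [h5, h3]
    simp
  have h5 := eq_zero_of_apply_eq_zero hA _ h4
  exact hinj _ h5

end Resolvent

/-! ### Cauchy's theorem and Cauchy's formula on horizontal strips -/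

section Strip

theorem integrable_of_continuous_of_exp_decay {E : Type*} [NormedAddCommGroup E] {f : ℝ → E} (hf : Continuous f) {C ε R : ℝ}
    (hε : 0 < ε) (hb : ∀ x, R ≤ |x| → ‖f x‖ ≤ C * Real.exp (-(ε * |x|))) : Integrable f := by
  have hI : Integrable fun x : ℝ => Real.exp (-(ε * |x|)) := by
    rw [← integrableOn_univ, ← Iic_union_Ioi (a := (0 : ℝ))]
    refine IntegrableOn.union ?_ ?_
    · refine (integrableOn_exp_mul_Iic hε 0).congr_fun (fun x hx => ?_) measurableSet_Iic
      simp [abs_of_nonpos (show x ≤ 0 from hx)]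
    · refine (integrableOn_exp_mul_Ioi (neg_lt_zero.2 hε) 0).congr_fun (fun x hx => ?_)
        measurableSet_Ioi
      simp [abs_of_pos (show 0 < x from hx)]
  have hO : ∀ l : Filter ℝ, (∀ᶠ x in l, R ≤ |x|) →
      f =O[l] fun x : ℝ => Real.exp (-(ε * |x|)) := fun l hl => by
    refine Asymptotics.IsBigO.of_bound C ?_
    filter_upwards [hl] with x hx
    rw [Real.norm_of_nonneg (Real.exp_pos _).le]
    exact hb x hx
  exact hf.locallyIntegrable.integrable_of_isBigO_atBot_atTop
    (hO _ (tendsto_abs_atBot_atTop.eventually_ge_atTop R)) (hI.integrableAtFilter _)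
    (hO _ (tendsto_abs_atTop_atTop.eventually_ge_atTop R)) (hI.integrableAtFilter _)

variable {E : Type*} [NormedAddCommGroup E] [NormedSpace ℂ E]

theorem continuous_horizontal {F : ℂ → E} {y : ℝ}
    (hF : ∀ z : ℂ, z.im = y → DifferentiableAt ℂ F z) :
    Continuous fun x : ℝ => F (x + y * Complex.I) :=
  continuous_iff_continuousAt.2 fun x => by
    have h := (hF (x + y * Complex.I) (by simp)).continuousAt
    exact h.comp (f := fun x : ℝ => (x : ℂ) + y * Complex.I) (by fun_prop)

theorem integrable_horizontal {F : ℂ → E} {y C ε R : ℝ}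
    (hF : ∀ z : ℂ, z.im = y → DifferentiableAt ℂ F z) (hε : 0 < ε)
    (hb : ∀ z : ℂ, z.im = y → R ≤ |z.re| → ‖F z‖ ≤ C * Real.exp (-(ε * |z.re|))) :
    Integrable fun x : ℝ => F (x + y * Complex.I) :=
  integrable_of_continuous_of_exp_decay (continuous_horizontal hF) hε (R := R) (C := C)
    fun x hx => by simpa using hb (x + y * Complex.I) (by simp) (by simpa using hx)

/-- Cauchy's theorem on a strip: horizontal line integrals of an exponentially decaying holomorphic
function agree. -/
theorem integral_horizontal_eq [CompleteSpace E] {F : ℂ → E} {a b C ε R : ℝ}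
    (hF : ∀ z : ℂ, z.im ∈ uIcc a b → DifferentiableAt ℂ F z) (hε : 0 < ε)
    (hb : ∀ z : ℂ, z.im ∈ uIcc a b → R ≤ |z.re| → ‖F z‖ ≤ C * Real.exp (-(ε * |z.re|))) :
    ∫ x : ℝ, F (x + a * Complex.I) = ∫ x : ℝ, F (x + b * Complex.I) := by
  have hia : Integrable fun x : ℝ => F (x + a * Complex.I) :=
    integrable_horizontal (fun z hz => hF z (hz ▸ left_mem_uIcc)) hε
      (fun z hz => hb z (hz ▸ left_mem_uIcc))
  have hib : Integrable fun x : ℝ => F (x + b * Complex.I) :=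
    integrable_horizontal (fun z hz => hF z (hz ▸ right_mem_uIcc)) hε
      (fun z hz => hb z (hz ▸ right_mem_uIcc))
  have hta := intervalIntegral_tendsto_integral hia tendsto_neg_atTop_atBot tendsto_id
  have htb := intervalIntegral_tendsto_integral hib tendsto_neg_atTop_atBot tendsto_id
  have hexp : Tendsto (fun T : ℝ => C * Real.exp (-(ε * T)) * |b - a|) atTop (𝓝 0) := by
    have : Tendsto (fun T : ℝ => Real.exp (-(ε * T))) atTop (𝓝 0) :=
      Real.tendsto_exp_neg_atTop_nhds_zero.comp (tendsto_id.const_mul_atTop hε)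
    simpa using (this.const_mul C).mul_const |b - a|
  have hvert : ∀ s : ℝ, |s| = 1 →
      Tendsto (fun T : ℝ => ∫ y in a..b, F (((s * T : ℝ) : ℂ) + y * Complex.I)) atTop (𝓝 0) := by
    intro s hs
    refine squeeze_zero_norm' ?_ hexp
    filter_upwards [eventually_ge_atTop R, eventually_ge_atTop 0] with T hT hT0
    have habs : |s * T| = T := by rw [abs_mul, hs, one_mul, abs_of_nonneg hT0]
    refine intervalIntegral.norm_integral_le_of_norm_le_const fun y hy => ?_
    have := hb (((s * T : ℝ) : ℂ) + y * Complex.I) (by simpa using uIoc_subset_uIcc hy)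
      (by simpa [habs] using hT)
    have h2 : |(((s * T : ℝ) : ℂ) + y * Complex.I).re| = T := by simp [habs]
    rwa [h2] at this
  have hrect : ∀ T : ℝ, (∫ x in (-T)..T, F (x + a * Complex.I)) -
      (∫ x in (-T)..T, F (x + b * Complex.I)) +
      Complex.I • (∫ y in a..b, F (((1 * T : ℝ) : ℂ) + y * Complex.I)) -
      Complex.I • (∫ y in a..b, F ((((-1) * T : ℝ) : ℂ) + y * Complex.I)) = 0 := by
    intro T
    have := Complex.integral_boundary_rect_eq_zero_of_differentiableOn F
      ((-T : ℝ) + a * Complex.I) ((T : ℝ) + b * Complex.I) (fun z hz => by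
        refine (hF z ?_).differentiableWithinAt
        have := hz.2
        simpa using this)
    simpa using this
  have hlim := ((hta.sub htb).add ((hvert 1 (by simp)).const_smul Complex.I)).sub
    ((hvert (-1) (by simp)).const_smul Complex.I)
  have h0 := tendsto_nhds_unique hlim (tendsto_const_nhds.congr fun T => (hrect T).symm)
  simpa [sub_eq_zero] using h0

/-- The kernel `1 / (2 sinh (ζ / 2))`, which has residue `1` at `0` and decays exponentially in
horizontal directions. -/
noncomputable def cschKernel (ζ : ℂ) : ℂ := (2 * Complex.sinh (ζ / 2))⁻¹

theorem two_sinh_half_ne_zero {ζ : ℂ} (h0 : ζ ≠ 0) (h : |ζ.im| < 2 * Real.pi) :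
    2 * Complex.sinh (ζ / 2) ≠ 0 := by
  intro hs
  rw [Complex.two_sinh, sub_eq_zero, Complex.exp_eq_exp_iff_exists_int] at hs
  obtain ⟨n, hn⟩ := hs
  have h1 : ζ = n * (2 * Real.pi * Complex.I) := by linear_combination hn
  have h2 : ζ.im = n * (2 * Real.pi) := by rw [h1]; simp
  rw [h2, abs_mul, abs_of_pos Real.two_pi_pos] at h
  have h3 : |(n : ℝ)| < 1 := by
    by_contra hc
    rw [not_lt] at hc
    nlinarith [Real.two_pi_pos]
  have h4 : n = 0 := by
    have : |n| < 1 := by exact_mod_cast h3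
    exact Int.abs_lt_one_iff.1 this
  exact h0 (by rw [h1, h4]; simp)

theorem norm_cschKernel_le {ζ : ℂ} (h : 1 ≤ |ζ.re|) :
    ‖cschKernel ζ‖ ≤ 2 * Real.exp (-(1 / 2 * |ζ.re|)) := by
  have hlow : Real.exp (|ζ.re| / 2) / 2 ≤ ‖2 * Complex.sinh (ζ / 2)‖ := by
    have h1 : |Real.exp (ζ.re / 2) - Real.exp (-(ζ.re / 2))| ≤ ‖2 * Complex.sinh (ζ / 2)‖ := by
      rw [Complex.two_sinh]
      refine le_trans (le_of_eq ?_) (abs_norm_sub_norm_le _ _)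
      simp [Complex.norm_exp]
    have h2 : |Real.exp (ζ.re / 2) - Real.exp (-(ζ.re / 2))| =
        Real.exp (|ζ.re| / 2) - Real.exp (-(|ζ.re| / 2)) := by
      rcases le_total 0 ζ.re with h | h
      · rw [abs_of_nonneg h, abs_of_nonneg]
        simpa using by linarith
      · rw [abs_of_nonpos h, abs_of_nonpos]
        · rw [neg_sub]; congr 2 <;> ring_nf
        · simpa using by linarith
    have h3 : Real.exp (-(|ζ.re| / 2)) ≤ Real.exp (|ζ.re| / 2) / 2 := by
      rw [le_div_iff₀ two_pos]
      have h4 : (2 : ℝ) ≤ Real.exp |ζ.re| := by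
        have := Real.add_one_le_exp |ζ.re|
        linarith
      calc Real.exp (-(|ζ.re| / 2)) * 2 ≤ Real.exp (-(|ζ.re| / 2)) * Real.exp |ζ.re| := by gcongr
        _ = Real.exp (|ζ.re| / 2) := by rw [← Real.exp_add]; congr 1; ring
    linarith
  rw [cschKernel, norm_inv]
  calc ‖2 * Complex.sinh (ζ / 2)‖⁻¹ ≤ (Real.exp (|ζ.re| / 2) / 2)⁻¹ :=
        inv_anti₀ (by positivity) hlow
    _ = 2 * Real.exp (-(1 / 2 * |ζ.re|)) := by
        rw [inv_div, Real.exp_neg, div_eq_mul_inv]; congr 3; ring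

theorem differentiableAt_cschKernel {ζ : ℂ} (h0 : ζ ≠ 0) (h : |ζ.im| < 2 * Real.pi) :
    DifferentiableAt ℂ cschKernel ζ := by
  unfold cschKernel
  exact DifferentiableAt.inv (by fun_prop) (two_sinh_half_ne_zero h0 h)

theorem ne_zero_of_im_ne_zero {ζ : ℂ} (h : ζ.im ≠ 0) : ζ ≠ 0 := fun h0 => h (by simp [h0])

theorem integrable_cschKernel {y : ℝ} (hy0 : y ≠ 0) (hy : |y| < 2 * Real.pi) :
    Integrable fun x : ℝ => cschKernel (x + y * Complex.I) :=
  integrable_horizontal (fun _ hz => differentiableAt_cschKernel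
    (ne_zero_of_im_ne_zero (hz ▸ hy0)) (hz ▸ hy)) one_half_pos
    (fun _ _ hR => norm_cschKernel_le hR)

theorem integral_inv_two_cosh_half : ∫ x : ℝ, (2 * Real.cosh (x / 2))⁻¹ = Real.pi := by
  have hd : ∀ x : ℝ, HasDerivAt (fun x => 2 * Real.arctan (Real.exp (x / 2)))
      (2 * Real.cosh (x / 2))⁻¹ x := by
    intro x
    have h1 : HasDerivAt (fun x : ℝ => Real.exp (x / 2)) (Real.exp (x / 2) * (1 / 2)) x :=
      ((hasDerivAt_id x).div_const 2).exp
    convert! (h1.arctan.const_mul 2) using 1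
    have h2 : 2 * Real.cosh (x / 2) = Real.exp (x / 2) + (Real.exp (x / 2))⁻¹ := by
      rw [Real.cosh_eq, Real.exp_neg]; ring
    rw [h2]
    have := Real.exp_pos (x / 2)
    field_simp
    ring
  have htop : Tendsto (fun x => 2 * Real.arctan (Real.exp (x / 2))) atTop (𝓝 Real.pi) := by
    have : Tendsto (fun x : ℝ => Real.arctan (Real.exp (x / 2))) atTop (𝓝 (Real.pi / 2)) :=
      ((Real.tendsto_arctan_atTop.mono_right nhdsWithin_le_nhds).comp Real.tendsto_exp_atTop).comp
        (tendsto_id.atTop_div_const two_pos)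
    convert this.const_mul 2 using 2; ring
  have hbot : Tendsto (fun x => 2 * Real.arctan (Real.exp (x / 2))) atBot (𝓝 0) := by
    have h1 : Tendsto (fun x : ℝ => Real.exp (x / 2)) atBot (𝓝 0) :=
      Real.tendsto_exp_atBot.comp (tendsto_id.atBot_div_const two_pos)
    have := ((Real.continuous_arctan.tendsto 0).comp h1).const_mul 2
    simpa using this
  have hint : Integrable fun x : ℝ => (2 * Real.cosh (x / 2))⁻¹ := by
    refine integrable_of_continuous_of_exp_decay (ε := 1 / 2) (C := 1) (R := 0) ?_ one_half_pos
      fun x _ => ?_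
    · exact Continuous.inv₀ (by fun_prop) fun x => by positivity
    · rw [Real.norm_of_nonneg (by positivity), one_mul, Real.exp_neg]
      refine inv_anti₀ (by positivity) ?_
      rw [← Real.cosh_abs, Real.cosh_eq, abs_div, abs_two]
      have := Real.exp_pos (-(|x| / 2))
      rw [one_div_mul_eq_div]
      linarith
  simpa using integral_of_hasDerivAt_of_tendsto hd hint hbot htop

theorem integral_cschKernel_pi (s : ℝ) (hs : |s| = 1) :
    ∫ x : ℝ, cschKernel (x + (s * Real.pi : ℝ) * Complex.I) = -(s * Real.pi * Complex.I) := by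
  have h : ∀ x : ℝ, cschKernel (x + (s * Real.pi : ℝ) * Complex.I) =
      -(s * Complex.I) * (((2 * Real.cosh (x / 2))⁻¹ : ℝ) : ℂ) := by
    intro x
    have hs2 : (s : ℂ) = 1 ∨ (s : ℂ) = -1 := by
      rcases eq_or_eq_neg_of_abs_eq hs with h | h <;> simp [h]
    have h1 : Complex.sinh ((x + (s * Real.pi : ℝ) * Complex.I) / 2) =
        s * Complex.I * Complex.cosh (x / 2) := by
      have : ((x : ℂ) + (s * Real.pi : ℝ) * Complex.I) / 2 =
          x / 2 + (s * (Real.pi / 2)) * Complex.I := by push_cast; ring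
      rw [this, Complex.sinh_add, Complex.sinh_mul_I, Complex.cosh_mul_I]
      rcases hs2 with h | h <;> rw [h] <;> simp <;> ring
    rw [cschKernel, h1]
    push_cast
    rcases hs2 with h | h <;> rw [h] <;> simp <;> ring
  simp_rw [h]
  rw [integral_const_mul, integral_complex_ofReal, integral_inv_two_cosh_half]
  ring

theorem integral_cschKernel {y s : ℝ} (hs : |s| = 1) (hy : 0 < s * y) (hy2 : s * y < 2 * Real.pi) :
    ∫ x : ℝ, cschKernel (x + y * Complex.I) = -(s * Real.pi * Complex.I) := by
  rw [← integral_cschKernel_pi s hs]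
  have hmem : ∀ z : ℂ, z.im ∈ uIcc y (s * Real.pi) → z.im ≠ 0 ∧ |z.im| < 2 * Real.pi := by
    intro z hz
    have hpi := Real.pi_pos
    rcases eq_or_eq_neg_of_abs_eq hs with rfl | rfl
    · rw [uIcc, mem_Icc] at hz
      have h1 : 0 < z.im := lt_of_lt_of_le (lt_min (by linarith) (by linarith)) hz.1
      have h2 : z.im < 2 * Real.pi := lt_of_le_of_lt hz.2 (max_lt (by linarith) (by linarith))
      exact ⟨h1.ne', by rwa [abs_of_pos h1]⟩
    · rw [uIcc, mem_Icc] at hz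
      have h1 : z.im < 0 := lt_of_le_of_lt hz.2 (max_lt (by linarith) (by linarith))
      have h2 : -(2 * Real.pi) < z.im := lt_of_lt_of_le (lt_min (by linarith) (by linarith)) hz.1
      exact ⟨h1.ne, by rw [abs_of_neg h1]; linarith⟩
  exact integral_horizontal_eq (fun z hz => differentiableAt_cschKernel
    (ne_zero_of_im_ne_zero (hmem z hz).1) (hmem z hz).2) one_half_pos
    (fun _ _ hR => norm_cschKernel_le hR)

/-- `(F w - F w₀) / (2 sinh ((w - w₀) / 2))` with the singularity at `w₀` removed. -/
noncomputable def regQuot (F : ℂ → E) (w₀ w : ℂ) : E :=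
  (dslope (fun ζ : ℂ => 2 * Complex.sinh (ζ / 2)) 0 (w - w₀))⁻¹ • dslope F w₀ w

theorem regQuot_of_ne (F : ℂ → E) {w₀ w : ℂ} (h : w ≠ w₀) :
    regQuot F w₀ w = cschKernel (w - w₀) • (F w - F w₀) := by
  have h0 : w - w₀ ≠ 0 := sub_ne_zero.2 h
  rw [regQuot, dslope_of_ne _ h, dslope_of_ne _ h0, slope_def_field, slope_def_module, smul_smul,
    cschKernel]
  congr 1
  simp
  field_simp

theorem hasDerivAt_two_sinh_half (ζ : ℂ) :
    HasDerivAt (fun ζ : ℂ => 2 * Complex.sinh (ζ / 2)) (Complex.cosh (ζ / 2)) ζ := by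
  have := (((hasDerivAt_id ζ).div_const 2).csinh).const_mul 2
  convert! this using 1
  simp [id]; ring

theorem regQuot_self (F : ℂ → E) (w₀ : ℂ) : regQuot F w₀ w₀ = deriv F w₀ := by
  rw [regQuot, dslope_same, sub_self, dslope_same, (hasDerivAt_two_sinh_half 0).deriv]
  simp

theorem differentiableOn_regQuot [CompleteSpace E] {F : ℂ → E} {U : Set ℂ} (hU : IsOpen U)
    (hF : DifferentiableOn ℂ F U) {w₀ : ℂ} (hw₀ : w₀ ∈ U)
    (hU2 : ∀ w ∈ U, |w.im - w₀.im| < 2 * Real.pi) : DifferentiableOn ℂ (regQuot F w₀) U := by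
  refine DifferentiableOn.smul (DifferentiableOn.inv ?_ ?_)
    ((Complex.differentiableOn_dslope (hU.mem_nhds hw₀)).2 hF)
  · have : DifferentiableOn ℂ (dslope (fun ζ : ℂ => 2 * Complex.sinh (ζ / 2)) 0) univ :=
      (Complex.differentiableOn_dslope univ_mem).2 (by fun_prop)
    exact this.comp (by fun_prop) (fun _ _ => mem_univ _)
  · intro w hw
    by_cases h : w - w₀ = 0
    · rw [h, dslope_same, (hasDerivAt_two_sinh_half 0).deriv]; simp
    · rw [dslope_of_ne _ h, slope_def_field]
      refine div_ne_zero ?_ (by simpa using h)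
      simpa using two_sinh_half_ne_zero h (by simpa using hU2 w hw)

theorem norm_regQuot_le {F : ℂ → E} {M : ℝ} {w₀ w : ℂ} (h1 : ‖F w‖ ≤ M) (h0 : ‖F w₀‖ ≤ M)
    (hw : 1 ≤ |w.re - w₀.re|) :
    ‖regQuot F w₀ w‖ ≤ 4 * M * Real.exp (-(1 / 2 * |w.re - w₀.re|)) := by
  have hne : w ≠ w₀ := by rintro rfl; norm_num at hw
  have hM : 0 ≤ M := (norm_nonneg _).trans h1
  rw [regQuot_of_ne F hne, norm_smul]
  have h2 : ‖cschKernel (w - w₀)‖ ≤ 2 * Real.exp (-(1 / 2 * |w.re - w₀.re|)) := by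
    simpa using norm_cschKernel_le (ζ := w - w₀) (by simpa using hw)
  calc _ ≤ (2 * Real.exp (-(1 / 2 * |w.re - w₀.re|))) * (M + M) := by
        gcongr
        exact (norm_sub_le _ _).trans (add_le_add h1 h0)
    _ = _ := by ring

/-- Shifting the centre of an exponential bound. -/
theorem exp_shift_le (x c : ℝ) :
    Real.exp (-(1 / 2 * |x - c|)) ≤ Real.exp (|c| / 2) * Real.exp (-(1 / 2 * |x|)) := by
  rw [← Real.exp_add, Real.exp_le_exp]
  have := abs_sub_abs_le_abs_sub x c
  linarith

theorem norm_regQuot_le' {F : ℂ → E} {M : ℝ} {w₀ w : ℂ} (h1 : ‖F w‖ ≤ M) (h0 : ‖F w₀‖ ≤ M)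
    (hw : |w₀.re| + 1 ≤ |w.re|) :
    ‖regQuot F w₀ w‖ ≤ 4 * M * Real.exp (|w₀.re| / 2) * Real.exp (-(1 / 2 * |w.re|)) := by
  have hM : 0 ≤ M := (norm_nonneg _).trans h1
  have := abs_sub_abs_le_abs_sub w.re w₀.re
  refine (norm_regQuot_le h1 h0 (by linarith)).trans ?_
  rw [mul_assoc (4 * M)]
  exact mul_le_mul_of_nonneg_left (exp_shift_le _ _) (by positivity)

variable [CompleteSpace E]

/-- Cauchy's integral formula on a strip, with the exponentially decaying kernel
`1 / (2 sinh ((w - w₀) / 2))` in place of `1 / (w - w₀)`. The two integrands are integrable. -/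
theorem cauchy_formula_strip {F : ℂ → E} {a b c M : ℝ} {w₀ : ℂ}
    (hF : DifferentiableOn ℂ F {z | |z.im| < c}) (ha : -c < a) (haw : a < w₀.im)
    (hwb : w₀.im < b) (hb : b < c) (hc : b - a < 2 * Real.pi)
    (hM : ∀ z : ℂ, z.im ∈ Icc a b → ‖F z‖ ≤ M) :
    Integrable (fun x : ℝ => cschKernel (x + a * Complex.I - w₀) • F (x + a * Complex.I)) ∧
    Integrable (fun x : ℝ => cschKernel (x + b * Complex.I - w₀) • F (x + b * Complex.I)) ∧
    (∫ x : ℝ, cschKernel (x + a * Complex.I - w₀) • F (x + a * Complex.I)) -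
      (∫ x : ℝ, cschKernel (x + b * Complex.I - w₀) • F (x + b * Complex.I)) =
      (2 * Real.pi * Complex.I) • F w₀ := by
  have hab : a ≤ b := (haw.trans hwb).le
  have hU : IsOpen {z : ℂ | |z.im| < c} :=
    isOpen_lt (Complex.continuous_im.abs) continuous_const
  have hw₀ : w₀ ∈ {z : ℂ | |z.im| < c} := by
    change |w₀.im| < c
    rw [abs_lt]; constructor <;> linarith
  have hin : ∀ z : ℂ, z.im ∈ Icc a b → z ∈ {z : ℂ | |z.im| < c} := fun z hz => by
    change |z.im| < c
    rw [abs_lt]; constructor <;> linarith [hz.1, hz.2]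
  -- a smaller strip on which the kernel has its only pole at `w₀`
  let V : Set ℂ := {z : ℂ | |z.im| < c} ∩ {z : ℂ | |z.im - w₀.im| < 2 * Real.pi}
  have hV : IsOpen V := hU.inter (isOpen_lt (by fun_prop) continuous_const)
  have hVin : ∀ z : ℂ, z.im ∈ Icc a b → z ∈ V := fun z hz =>
    ⟨hin z hz, by
      change |z.im - w₀.im| < _
      rw [abs_lt]; constructor <;> linarith [hz.1, hz.2]⟩
  have hreg : DifferentiableOn ℂ (regQuot F w₀) V :=
    differentiableOn_regQuot hV (hF.mono inter_subset_left)
      (hVin w₀ ⟨haw.le, hwb.le⟩) (fun w hw => hw.2)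
  have hregd : ∀ z : ℂ, z.im ∈ uIcc a b → DifferentiableAt ℂ (regQuot F w₀) z := fun z hz =>
    hreg.differentiableAt (hV.mem_nhds (hVin z (by rwa [uIcc_of_le hab] at hz)))
  have hregb : ∀ z : ℂ, z.im ∈ uIcc a b → |w₀.re| + 1 ≤ |z.re| → ‖regQuot F w₀ z‖ ≤
      4 * M * Real.exp (|w₀.re| / 2) * Real.exp (-(1 / 2 * |z.re|)) := fun z hz =>
    norm_regQuot_le' (hM z (by rwa [uIcc_of_le hab] at hz)) (hM w₀ ⟨haw.le, hwb.le⟩)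
  have hsplit : ∀ y : ℝ, y ≠ w₀.im → ∀ x : ℝ,
      cschKernel (x + y * Complex.I - w₀) • F (x + y * Complex.I) =
      regQuot F w₀ (x + y * Complex.I) + cschKernel (x + y * Complex.I - w₀) • F w₀ := by
    intro y hy x
    rw [regQuot_of_ne, smul_sub, sub_add_cancel]
    intro h
    apply hy
    rw [← h]; simp
  have hK : ∀ y : ℝ, ∀ x : ℝ, cschKernel (x + y * Complex.I - w₀) =
      cschKernel (((x - w₀.re : ℝ) : ℂ) + (y - w₀.im : ℝ) * Complex.I) := by
    intro y x
    congr 1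
    apply Complex.ext <;> simp
  have hKi : ∀ y ∈ Icc a b, y ≠ w₀.im →
      Integrable fun x : ℝ => cschKernel (x + y * Complex.I - w₀) := by
    intro y hy hyne
    simp_rw [hK]
    refine (integrable_cschKernel (sub_ne_zero.2 hyne) ?_).comp_sub_right w₀.re
    rw [abs_lt]; constructor <;> linarith [hy.1, hy.2]
  have hRi : ∀ y ∈ Icc a b, Integrable fun x : ℝ => regQuot F w₀ (x + y * Complex.I) :=
    fun y hy => integrable_horizontal
      (fun z hz => hregd z (by rw [uIcc_of_le hab, hz]; exact hy)) one_half_pos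
      (fun z hz => hregb z (by rw [uIcc_of_le hab, hz]; exact hy))
  have hKa : ∫ x : ℝ, cschKernel (x + a * Complex.I - w₀) = Real.pi * Complex.I := by
    simp_rw [hK]
    rw [integral_sub_right_eq_self (fun x : ℝ => cschKernel (x + (a - w₀.im : ℝ) * Complex.I)),
      integral_cschKernel (s := -1) (by simp) (by linarith) (by linarith)]
    simp
  have hKb : ∫ x : ℝ, cschKernel (x + b * Complex.I - w₀) = -(Real.pi * Complex.I) := by
    simp_rw [hK]
    rw [integral_sub_right_eq_self (fun x : ℝ => cschKernel (x + (b - w₀.im : ℝ) * Complex.I)),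
      integral_cschKernel (s := 1) (by simp) (by linarith) (by linarith)]
    simp
  have hma : a ∈ Icc a b := left_mem_Icc.2 hab
  have hmb : b ∈ Icc a b := right_mem_Icc.2 hab
  simp_rw [hsplit a haw.ne, hsplit b hwb.ne']
  have hia := (hKi a hma haw.ne).smul_const (F w₀)
  have hib := (hKi b hmb hwb.ne').smul_const (F w₀)
  refine ⟨(hRi a hma).add hia, (hRi b hmb).add hib, ?_⟩
  rw [integral_add (hRi a hma) hia, integral_add (hRi b hmb) hib, integral_smul_const,
    integral_smul_const, hKa, hKb, integral_horizontal_eq hregd one_half_pos hregb,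
    add_sub_add_left_eq_sub, ← sub_smul]
  congr 1
  ring

end Strip

/-! ### The Cauchy integral calculus -/

section ProductOfIntegrals

variable {𝔸 : Type*} [NormedRing 𝔸] [NormedAlgebra ℂ 𝔸]

theorem integrable_smul_of_bdd {α : Type*} [MeasurableSpace α] {μ : Measure α} {p : α → ℂ}
    {P : α → 𝔸} {C : ℝ} (hp : Integrable p μ) (hP : AEStronglyMeasurable P μ)
    (hb : ∀ x, ‖P x‖ ≤ C) : Integrable (fun x => p x • P x) μ := by
  refine (hp.norm.mul_const C).mono' (hp.aestronglyMeasurable.smul hP) (ae_of_all _ fun x => ?_)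
  rw [norm_smul]
  gcongr
  exact hb x

variable [CompleteSpace 𝔸]

/-- The product of two operator integrals whose integrands satisfy a resolvent identity. -/
theorem integral_mul_integral_of_resolvent_identity {p q : ℝ → ℂ} {P R : ℝ → 𝔸}
    {κ κ' : ℝ → ℝ → ℂ} {CP CR D : ℝ} (hp : Integrable p) (hq : Integrable q)
    (hP : Continuous P) (hR : Continuous R) (hPb : ∀ x, ‖P x‖ ≤ CP) (hRb : ∀ y, ‖R y‖ ≤ CR)
    (hκ : Continuous fun z : ℝ × ℝ => κ z.1 z.2) (hκ' : Continuous fun z : ℝ × ℝ => κ' z.1 z.2)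
    (hκb : ∀ x y, ‖κ x y‖ ≤ D) (hκb' : ∀ x y, ‖κ' x y‖ ≤ D)
    (h : ∀ x y, P x * R y = κ x y • R y + κ' x y • P x) :
    Integrable (fun x => (p x * ∫ y, q y * κ' x y) • P x) ∧
    (∫ x, p x • P x) * (∫ y, q y • R y) =
      (∫ y, (q y * ∫ x, p x * κ x y) • R y) + ∫ x, (p x * ∫ y, q y * κ' x y) • P x := by
  have hpq : Integrable (fun z : ℝ × ℝ => p z.1 * q z.2) (volume.prod volume) := hp.mul_prod hq
  have hF1 : Integrable (fun z : ℝ × ℝ => (p z.1 * q z.2) • (κ z.1 z.2 • R z.2))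
      (volume.prod volume) :=
    integrable_smul_of_bdd (C := D * CR) hpq (by fun_prop) fun z => by
      rw [norm_smul]
      exact mul_le_mul (hκb _ _) (hRb _) (norm_nonneg _) ((norm_nonneg _).trans (hκb 0 0))
  have hF2 : Integrable (fun z : ℝ × ℝ => (p z.1 * q z.2) • (κ' z.1 z.2 • P z.1))
      (volume.prod volume) :=
    integrable_smul_of_bdd (C := D * CP) hpq (by fun_prop) fun z => by
      rw [norm_smul]
      exact mul_le_mul (hκb' _ _) (hPb _) (norm_nonneg _) ((norm_nonneg _).trans (hκb' 0 0))
  have e1 : ∀ y, (∫ x, (p x * q y) • (κ x y • R y)) = (q y * ∫ x, p x * κ x y) • R y := fun y => by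
    simp_rw [smul_smul]
    rw [integral_smul_const, ← integral_const_mul]
    congr 2; ext x; ring
  have e2 : ∀ x, (∫ y, (p x * q y) • (κ' x y • P x)) = (p x * ∫ y, q y * κ' x y) • P x := fun x => by
    simp_rw [smul_smul]
    rw [integral_smul_const, ← integral_const_mul]
    congr 2; ext y; ring
  refine ⟨by simpa only [e2] using hF2.integral_prod_left, ?_⟩
  have hpP := integrable_smul_of_bdd hp hP.aestronglyMeasurable hPb
  have hqR := integrable_smul_of_bdd hq hR.aestronglyMeasurable hRb
  rw [← integral_mul_const_of_integrable hpP]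
  simp_rw [← integral_const_mul_of_integrable hqR, smul_mul_smul_comm, h, smul_add]
  have hsum : ∫ x, ∫ y, ((p x * q y) • (κ x y • R y) + (p x * q y) • (κ' x y • P x)) =
      (∫ x, ∫ y, (p x * q y) • (κ x y • R y)) + ∫ x, ∫ y, (p x * q y) • (κ' x y • P x) :=
    integral_integral_add' hF1 hF2
  rw [hsum, integral_integral_swap hF1]
  simp_rw [e1, e2]

end ProductOfIntegrals

/-- Holomorphic functions on the slit plane that are `O(min(|z|, |z|⁻¹))` on every sector. -/
structure DecaysOnSectors (f : ℂ → ℂ) : Prop where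
  differentiableOn : DifferentiableOn ℂ f Complex.slitPlane
  decay : ∀ ω ∈ Ioo 0 Real.pi, ∃ C : ℝ, ∀ z ∈ sector ω, ‖f z‖ ≤ C * Real.exp (-|Real.log ‖z‖|)

theorem arg_exp_of_abs_lt {u : ℂ} (hu : |u.im| < Real.pi) : (Complex.exp u).arg = u.im := by
  rw [Complex.arg_exp, toIocMod_eq_self]
  constructor <;> linarith [abs_lt.1 hu]

theorem exp_mem_sector {u : ℂ} {ω : ℝ} (hω : ω ≤ Real.pi) (hu : |u.im| < ω) :
    Complex.exp u ∈ sector ω :=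
  ⟨Complex.exp_ne_zero u, by rwa [arg_exp_of_abs_lt (hu.trans_le hω)]⟩

theorem exp_mem_slitPlane_of_abs_lt {u : ℂ} (hu : |u.im| < Real.pi) :
    Complex.exp u ∈ Complex.slitPlane := by
  rw [Complex.mem_slitPlane_iff_arg, arg_exp_of_abs_lt hu]
  exact ⟨by linarith [abs_lt.1 hu], Complex.exp_ne_zero u⟩

theorem isOpen_strip (c : ℝ) : IsOpen {z : ℂ | |z.im| < c} :=
  isOpen_lt (Complex.continuous_im.abs) continuous_const

theorem differentiableOn_comp_exp {f : ℂ → ℂ} (hf : DifferentiableOn ℂ f Complex.slitPlane) :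
    DifferentiableOn ℂ (fun u => f (Complex.exp u)) {u | |u.im| < Real.pi} :=
  hf.comp Complex.differentiable_exp.differentiableOn fun _ hu => exp_mem_slitPlane_of_abs_lt hu

theorem DecaysOnSectors.differentiableAt {f : ℂ → ℂ} (hf : DecaysOnSectors f) {u : ℂ}
    (hu : |u.im| < Real.pi) : DifferentiableAt ℂ (fun u => f (Complex.exp u)) u :=
  (differentiableOn_comp_exp hf.differentiableOn).differentiableAt ((isOpen_strip _).mem_nhds hu)

theorem DecaysOnSectors.exists_bound {f : ℂ → ℂ} (hf : DecaysOnSectors f) {ω : ℝ}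
    (hω : ω ∈ Ioo 0 Real.pi) :
    ∃ C : ℝ, 0 ≤ C ∧ ∀ u : ℂ, |u.im| ≤ ω → ‖f (Complex.exp u)‖ ≤ C * Real.exp (-|u.re|) := by
  obtain ⟨C, hC⟩ := hf.decay ((ω + Real.pi) / 2) ⟨by linarith [hω.1, hω.2], by linarith [hω.2]⟩
  have hb : ∀ u : ℂ, |u.im| ≤ ω → ‖f (Complex.exp u)‖ ≤ C * Real.exp (-|u.re|) := fun u hu => by
    have := hC _ (exp_mem_sector (u := u) (by linarith [hω.2]) (by linarith [hω.2]))
    rwa [Complex.norm_exp, Real.log_exp] at this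
  refine ⟨C, ?_, hb⟩
  have := (norm_nonneg _).trans (hb 0 (by simpa using hω.1.le))
  simpa using this

theorem DecaysOnSectors.integrable_line {f : ℂ → ℂ} (hf : DecaysOnSectors f) {y : ℝ}
    (hy : |y| < Real.pi) : Integrable fun x : ℝ => f (Complex.exp (x + y * Complex.I)) := by
  obtain ⟨C, -, hC⟩ := hf.exists_bound (ω := (|y| + Real.pi) / 2)
    ⟨by linarith [abs_nonneg y], by linarith⟩
  refine integrable_horizontal (F := fun u => f (Complex.exp u)) (C := C) (R := 0)
    (fun z hz => hf.differentiableAt (hz ▸ hy)) one_pos fun z hz _ => ?_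
  rw [one_mul]
  exact hC z (by rw [hz]; linarith)

theorem decaysOnSectors_rho : DecaysOnSectors rho := by
  constructor
  · refine DifferentiableOn.div differentiableOn_id (by fun_prop) fun z hz h => ?_
    have h1 : z = -1 := by
      have := pow_eq_zero_iff (two_ne_zero) |>.1 h
      linear_combination this
    rw [h1, Complex.mem_slitPlane_iff] at hz
    norm_num at hz
  · intro ω hω
    set c := 1 - |Real.cos ω| with hc
    have hc0 : 0 < c := by
      have h1 : Real.cos ω < 1 := by
        rw [← Real.cos_zero]
        exact Real.cos_lt_cos_of_nonneg_of_le_pi le_rfl hω.2.le hω.1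
      have h2 : -1 < Real.cos ω := by
        rw [← Real.cos_pi]
        exact Real.cos_lt_cos_of_nonneg_of_le_pi hω.1.le le_rfl hω.2
      have := abs_lt.2 ⟨h2, h1⟩
      linarith
    refine ⟨c⁻¹, fun z hz => ?_⟩
    have hr : 0 < ‖z‖ := norm_pos_iff.2 hz.1
    have hcos : -|Real.cos ω| * ‖z‖ ≤ z.re := by
      have h1 := closure_sector_subset hω (subset_closure hz)
      have h2 : ‖z‖ * Real.cos ω ≤ z.re := h1
      nlinarith [neg_abs_le (Real.cos ω)]
    have hlow : c * (1 + ‖z‖ ^ 2) ≤ ‖1 + z‖ ^ 2 := by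
      have h1 : ‖1 + z‖ ^ 2 = 1 + 2 * z.re + ‖z‖ ^ 2 := by
        rw [Complex.sq_norm, Complex.sq_norm, Complex.normSq_apply, Complex.normSq_apply]
        simp; ring
      rw [h1, hc]
      nlinarith [sq_nonneg (1 - ‖z‖), abs_nonneg (Real.cos ω)]
    have hmin : ‖z‖ ≤ Real.exp (-|Real.log ‖z‖|) * (1 + ‖z‖ ^ 2) := by
      rcases le_total 0 (Real.log ‖z‖) with h | h
      · rw [abs_of_nonneg h, Real.exp_neg, Real.exp_log hr, inv_mul_eq_div, le_div_iff₀ hr]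
        nlinarith
      · rw [abs_of_nonpos h, neg_neg, Real.exp_log hr]
        nlinarith [pow_pos hr 3]
    have hpos : 0 < c * (1 + ‖z‖ ^ 2) := by positivity
    rw [rho, norm_div, norm_pow, div_le_iff₀ (hpos.trans_le hlow)]
    calc ‖z‖ ≤ Real.exp (-|Real.log ‖z‖|) * (1 + ‖z‖ ^ 2) := hmin
      _ = c⁻¹ * Real.exp (-|Real.log ‖z‖|) * (c * (1 + ‖z‖ ^ 2)) := by field_simp
      _ ≤ _ := by gcongr

theorem DecaysOnSectors.inHInf {f : ℂ → ℂ} (hf : DecaysOnSectors f) : InHInf f := by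
  refine ⟨hf.differentiableOn, fun ω hω => ?_⟩
  obtain ⟨C, hC⟩ := hf.decay ω hω
  refine ⟨C, fun z hz => (hC z hz).trans ?_⟩
  have hC0 : 0 ≤ C := nonneg_of_mul_nonneg_left ((norm_nonneg _).trans (hC z hz)) (Real.exp_pos _)
  have h2 : Real.exp (-|Real.log ‖z‖|) ≤ 1 := by simp
  nlinarith

theorem DecaysOnSectors.mul_inHInf {f g : ℂ → ℂ} (hf : DecaysOnSectors f) (hg : InHInf g) :
    DecaysOnSectors fun z => f z * g z := by
  refine ⟨hf.differentiableOn.mul hg.1, fun ω hω => ?_⟩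
  obtain ⟨C, hC⟩ := hf.decay ω hω
  obtain ⟨D, hD⟩ := hg.2 ω hω
  refine ⟨C * D, fun z hz => ?_⟩
  rw [norm_mul, mul_right_comm]
  exact mul_le_mul (hC z hz) (hD z hz) (norm_nonneg _) ((norm_nonneg _).trans (hC z hz))

section Cauchy

variable {X : Type*} [NormedAddCommGroup X] [NormedSpace ℂ X] {A : X →ₗ.[ℂ] X}

/-- The integral of `f(l) (l - A)⁻¹` along the ray `arg l = -sθ` (`s = ±1`), in the coordinate
`l = exp (x - i s θ) = -exp (x + i s (π - θ))`. -/
noncomputable def rayIntegral (A : X →ₗ.[ℂ] X) (θ : ℝ) (f : ℂ → ℂ) (s : ℝ) : X →L[ℂ] X :=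
  ∫ x : ℝ, f (Complex.exp (x + (-(s * θ) : ℝ) * Complex.I)) •
    logResolvent A (x + (s * (Real.pi - θ) : ℝ) * Complex.I)

theorem integral_Ioi_eq_integral_exp {E : Type*} [NormedAddCommGroup E] [NormedSpace ℝ E]
    (g : ℝ → E) : ∫ r in Ioi (0 : ℝ), g r = ∫ x : ℝ, Real.exp x • g (Real.exp x) := by
  have h := integral_image_eq_integral_abs_deriv_smul (s := univ) (f := Real.exp)
    (f' := Real.exp) MeasurableSet.univ (fun x _ => (Real.hasDerivAt_exp x).hasDerivWithinAt)
    Real.exp_injective.injOn g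
  rw [image_univ, Real.range_exp] at h
  simpa [abs_of_pos (Real.exp_pos _)] using h

theorem neg_exp_eq {s : ℝ} (hs : s = 1 ∨ s = -1) (x θ : ℝ) :
    -Complex.exp (x + (s * (Real.pi - θ) : ℝ) * Complex.I) =
      Complex.exp (x + (-(s * θ) : ℝ) * Complex.I) := by
  have h1 : (x : ℂ) + (s * (Real.pi - θ) : ℝ) * Complex.I =
      (x + (-(s * θ) : ℝ) * Complex.I) + s * (Real.pi * Complex.I) := by push_cast; ring
  have h2 : Complex.exp (s * (Real.pi * Complex.I)) = -1 := by
    rcases hs with rfl | rfl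
    · simp
    · simp [Complex.exp_neg]
  rw [h1, Complex.exp_add, h2]
  ring

theorem ray_eq_rayIntegral {s : ℝ} (hs : s = 1 ∨ s = -1) (θ : ℝ) (f : ℂ → ℂ) :
    ∫ r in Ioi (0 : ℝ), (f (r * Complex.exp (-(s * θ * Complex.I))) *
        Complex.exp (-(s * θ * Complex.I))) • resolvent A (r * Complex.exp (-(s * θ * Complex.I))) =
      rayIntegral A θ f s := by
  rw [integral_Ioi_eq_integral_exp, rayIntegral]
  congr 1
  ext1 x
  have h1 : ((Real.exp x : ℝ) : ℂ) * Complex.exp (-(s * θ * Complex.I)) =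
      Complex.exp (x + (-(s * θ) : ℝ) * Complex.I) := by
    rw [Complex.ofReal_exp, ← Complex.exp_add]
    congr 1; push_cast; ring
  rw [h1, logResolvent, neg_exp_eq hs, smul_smul, ← Complex.coe_smul, smul_smul, ← h1]
  congr 1
  ring

theorem cauchyIntegral_eq (A : X →ₗ.[ℂ] X) (θ : ℝ) (f : ℂ → ℂ) :
    cauchyIntegral A θ f = (2 * Real.pi * Complex.I : ℂ)⁻¹ •
      (rayIntegral A θ f 1 - rayIntegral A θ f (-1)) := by
  rw [cauchyIntegral, ← ray_eq_rayIntegral (Or.inl rfl), ← ray_eq_rayIntegral (Or.inr rfl)]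
  simp

theorem continuous_logResolvent_line (hA : IsZeroSectorial A) {y : ℝ}
    (hy : |y| < 3 * Real.pi / 4) :
    Continuous fun x : ℝ => logResolvent A (x + y * Complex.I) :=
  continuous_horizontal fun _ hz => differentiableAt_logResolvent hA (hz ▸ hy)

theorem abs_sign_mul {s y : ℝ} (hs : s = 1 ∨ s = -1) : |s * y| = |y| := by
  rcases hs with rfl | rfl <;> simp

theorem integrable_rayIntegral (hA : IsZeroSectorial A) {f : ℂ → ℂ} (hf : DecaysOnSectors f)
    {s θ : ℝ} (hs : s = 1 ∨ s = -1) (h1 : |θ| < Real.pi) (h2 : |Real.pi - θ| < 3 * Real.pi / 4) :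
    Integrable fun x : ℝ => f (Complex.exp (x + (-(s * θ) : ℝ) * Complex.I)) •
      logResolvent A (x + (s * (Real.pi - θ) : ℝ) * Complex.I) := by
  obtain ⟨C, -, hC⟩ := exists_bound_logResolvent hA
  have h3 : |s * (Real.pi - θ)| < 3 * Real.pi / 4 := by rwa [abs_sign_mul hs]
  exact integrable_smul_of_bdd
    (hf.integrable_line (by rwa [abs_neg, abs_sign_mul hs]))
    (continuous_logResolvent_line hA h3).aestronglyMeasurable
    (fun x => hC _ (by simpa using h3))

variable [CompleteSpace X]

/-- The contour of the Cauchy integral can be moved from angle `π / 2` to angle `3π / 4`. -/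
theorem rayIntegral_pi_div_two (hA : IsZeroSectorial A) {f : ℂ → ℂ} (hf : DecaysOnSectors f)
    {s : ℝ} (hs : s = 1 ∨ s = -1) :
    rayIntegral A (Real.pi / 2) f s = rayIntegral A (3 * Real.pi / 4) f s := by
  have hpi := Real.pi_pos
  let F : ℂ → X →L[ℂ] X := fun ζ =>
    f (Complex.exp (ζ - (s * Real.pi : ℝ) * Complex.I)) • logResolvent A ζ
  obtain ⟨C, hC0, hC⟩ := exists_bound_logResolvent hA
  obtain ⟨D, hD0, hD⟩ := hf.exists_bound (ω := 3 * Real.pi / 4) ⟨by linarith, by linarith⟩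
  have hmem : ∀ z : ℂ, z.im ∈ uIcc (s * (Real.pi - Real.pi / 2)) (s * (Real.pi - 3 * Real.pi / 4)) →
      |z.im| < 3 * Real.pi / 4 ∧ |z.im - s * Real.pi| ≤ 3 * Real.pi / 4 := by
    intro z hz
    rcases hs with rfl | rfl
    · rw [uIcc_of_ge (by linarith), mem_Icc] at hz
      constructor
      · rw [abs_lt]; constructor <;> linarith
      · rw [abs_le]; constructor <;> linarith
    · rw [uIcc_of_le (by linarith), mem_Icc] at hz
      constructor
      · rw [abs_lt]; constructor <;> linarith
      · rw [abs_le]; constructor <;> linarith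
  have key := integral_horizontal_eq (F := F) (C := D * C) (R := 0) (ε := 1)
    (a := s * (Real.pi - Real.pi / 2)) (b := s * (Real.pi - 3 * Real.pi / 4))
    (fun z hz => by
      have h2 : |(z - (s * Real.pi : ℝ) * Complex.I).im| < Real.pi := by
        simpa using (hmem z hz).2.trans_lt (by linarith)
      exact (DifferentiableAt.comp z (f := fun ζ => ζ - (s * Real.pi : ℝ) * Complex.I)
        (hf.differentiableAt h2) (by fun_prop)).smul
        (differentiableAt_logResolvent hA (hmem z hz).1)) one_pos
    (fun z hz _ => by
      have h1 := hD (z - (s * Real.pi : ℝ) * Complex.I) (by simpa using (hmem z hz).2)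
      have h2 := hC z (hmem z hz).1
      rw [norm_smul, one_mul, mul_right_comm]
      refine mul_le_mul (by simpa using h1) h2 (norm_nonneg _) (by positivity))
  have hrew : ∀ θ x : ℝ, (x : ℂ) + (s * (Real.pi - θ) : ℝ) * Complex.I -
      (s * Real.pi : ℝ) * Complex.I = x + (-(s * θ) : ℝ) * Complex.I := by
    intro θ x; push_cast; ring
  simpa only [F, hrew, rayIntegral] using key

/-- The kernel `1 / (1 + l'/l)` is bounded when the angle between `l` and `l'` stays away from `π`. -/
theorem norm_inv_one_add_exp_le {τ : ℂ} (h : |τ.im| ≤ 3 * Real.pi / 4) :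
    1 + Complex.exp τ ≠ 0 ∧ ‖(1 + Complex.exp τ)⁻¹‖ ≤ 2 := by
  have hpi := Real.pi_pos
  have hc : -(Real.sqrt 2 / 2) ≤ Real.cos τ.im := by
    have h1 : Real.cos (3 * Real.pi / 4) = -(Real.sqrt 2 / 2) := by
      rw [← Real.cos_pi_div_four, ← Real.cos_pi_sub]; congr 1; ring
    rw [← h1, ← Real.cos_abs τ.im]
    exact Real.cos_le_cos_of_nonneg_of_le_pi (abs_nonneg _) (by linarith) h
  have hlow : 1 / 2 ≤ ‖1 + Complex.exp τ‖ ^ 2 := by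
    have h1 : ‖1 + Complex.exp τ‖ ^ 2 =
        1 + 2 * (Real.exp τ.re * Real.cos τ.im) + Real.exp τ.re ^ 2 := by
      rw [Complex.sq_norm, Complex.normSq_apply]
      simp only [Complex.add_re, Complex.add_im, Complex.one_re, Complex.one_im, Complex.exp_re,
        Complex.exp_im]
      linear_combination Real.exp τ.re ^ 2 * Real.sin_sq_add_cos_sq τ.im
    rw [h1]
    have h2 := Real.exp_pos τ.re
    have h3 : Real.sqrt 2 ^ 2 = 2 := Real.sq_sqrt zero_le_two
    nlinarith [sq_nonneg (Real.exp τ.re - Real.sqrt 2 / 2)]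
  have h2 : 1 / 2 ≤ ‖1 + Complex.exp τ‖ := by
    by_contra hc
    rw [not_le] at hc
    nlinarith [norm_nonneg (1 + Complex.exp τ)]
  refine ⟨norm_pos_iff.1 (by linarith), ?_⟩
  rw [norm_inv]
  calc ‖1 + Complex.exp τ‖⁻¹ ≤ (1 / 2)⁻¹ := inv_anti₀ (by norm_num) h2
    _ = 2 := by norm_num

/-- Cauchy's theorem in the right half-plane, for `f(l) / (l - l')` with `l' = -exp ω` outside. -/
theorem integral_ray_kernel_eq {f : ℂ → ℂ} (hf : DecaysOnSectors f) {ω : ℂ}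
    (hω : |ω.im| ≤ Real.pi / 4) :
    ∫ x : ℝ, f (Complex.exp (x + (-(1 * (Real.pi / 2)) : ℝ) * Complex.I)) *
      (1 + Complex.exp (ω - (x + (-(1 * (Real.pi / 2)) : ℝ) * Complex.I)))⁻¹ =
    ∫ x : ℝ, f (Complex.exp (x + (-(-1 * (Real.pi / 2)) : ℝ) * Complex.I)) *
      (1 + Complex.exp (ω - (x + (-(-1 * (Real.pi / 2)) : ℝ) * Complex.I)))⁻¹ := by
  have hpi := Real.pi_pos
  obtain ⟨D, hD0, hD⟩ := hf.exists_bound (ω := Real.pi / 2) ⟨by linarith, by linarith⟩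
  have hmem : ∀ z : ℂ, z.im ∈ uIcc (-(1 * (Real.pi / 2))) (-(-1 * (Real.pi / 2))) →
      |z.im| ≤ Real.pi / 2 ∧ |(ω - z).im| ≤ 3 * Real.pi / 4 := by
    intro z hz
    rw [uIcc_of_le (by linarith), mem_Icc] at hz
    have h1 : |z.im| ≤ Real.pi / 2 := by rw [abs_le]; constructor <;> linarith
    refine ⟨h1, ?_⟩
    rw [Complex.sub_im]
    have := abs_sub ω.im z.im
    linarith
  refine integral_horizontal_eq (F := fun u => f (Complex.exp u) * (1 + Complex.exp (ω - u))⁻¹)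
    (C := D * 2) (R := 0) (ε := 1) (fun z hz => ?_) one_pos (fun z hz _ => ?_)
  · refine (hf.differentiableAt ((hmem z hz).1.trans_lt (by linarith))).mul
      (DifferentiableAt.inv (by fun_prop) (norm_inv_one_add_exp_le (hmem z hz).2).1)
  · rw [norm_mul, one_mul, mul_right_comm]
    exact mul_le_mul (hD z (hmem z hz).1) (norm_inv_one_add_exp_le (hmem z hz).2).2
      (norm_nonneg _) (by positivity)

/-- Cauchy's formula on the boundary of the sector of half-angle `3π / 4`, at the point `exp u`. -/
theorem integral_ray_kernel_sub {g : ℂ → ℂ} (hg : DecaysOnSectors g) {u : ℂ}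
    (hu : |u.im| ≤ Real.pi / 2) :
    (∫ y : ℝ, g (Complex.exp (y + (-(1 * (3 * Real.pi / 4)) : ℝ) * Complex.I)) *
      (1 + Complex.exp (u - (y + (1 * (Real.pi - 3 * Real.pi / 4) : ℝ) * Complex.I)))⁻¹) -
    (∫ y : ℝ, g (Complex.exp (y + (-(-1 * (3 * Real.pi / 4)) : ℝ) * Complex.I)) *
      (1 + Complex.exp (u - (y + (-1 * (Real.pi - 3 * Real.pi / 4) : ℝ) * Complex.I)))⁻¹) =
    2 * Real.pi * Complex.I * g (Complex.exp u) := by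
  have hpi := Real.pi_pos
  obtain ⟨D, hD0, hD⟩ := hg.exists_bound (ω := 3 * Real.pi / 4) ⟨by linarith, by linarith⟩
  have hu' := abs_le.1 hu
  -- the factor `e^{(v - u) / 2}` turns `1 / (2 sinh ((v - u) / 2))` into `1 / (1 - e^{u - v})`
  have key := (cauchy_formula_strip
    (F := fun v => Complex.exp ((v - u) / 2) * g (Complex.exp v)) (w₀ := u)
    (a := -(1 * (3 * Real.pi / 4))) (b := -(-1 * (3 * Real.pi / 4))) (c := Real.pi)
    (M := Real.exp (-u.re / 2) * D)
    (DifferentiableOn.mul (by fun_prop) (differentiableOn_comp_exp hg.differentiableOn))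
    (by linarith) (by linarith) (by linarith) (by linarith) (by linarith)
    (fun z hz => by
      have h1 := hD z (by rw [abs_le]; constructor <;> linarith [hz.1, hz.2])
      rw [norm_mul, Complex.norm_exp]
      have h2 : ((z - u) / 2).re = -u.re / 2 + z.re / 2 := by
        simp; ring
      rw [h2, Real.exp_add, mul_assoc]
      gcongr
      calc Real.exp (z.re / 2) * ‖g (Complex.exp z)‖ ≤
            Real.exp (z.re / 2) * (D * Real.exp (-|z.re|)) := by gcongr
        _ = D * Real.exp (z.re / 2 - |z.re|) := by rw [sub_eq_add_neg, Real.exp_add]; ring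
        _ ≤ D * 1 := by
          gcongr
          rw [Real.exp_le_one_iff]
          linarith [le_abs_self z.re, abs_nonneg z.re]
        _ = D := mul_one D)).2.2
  have hk : ∀ s : ℝ, s = 1 ∨ s = -1 → ∀ y : ℝ,
      cschKernel (y + (-(s * (3 * Real.pi / 4)) : ℝ) * Complex.I - u) •
        (Complex.exp ((y + (-(s * (3 * Real.pi / 4)) : ℝ) * Complex.I - u) / 2) *
          g (Complex.exp (y + (-(s * (3 * Real.pi / 4)) : ℝ) * Complex.I))) =
      g (Complex.exp (y + (-(s * (3 * Real.pi / 4)) : ℝ) * Complex.I)) *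
      (1 + Complex.exp (u - (y + (s * (Real.pi - 3 * Real.pi / 4) : ℝ) * Complex.I)))⁻¹ := by
    intro s hs y
    set v : ℂ := y + (-(s * (3 * Real.pi / 4)) : ℝ) * Complex.I
    have h1 : Complex.exp (u - (y + (s * (Real.pi - 3 * Real.pi / 4) : ℝ) * Complex.I)) =
        -Complex.exp (u - v) := by
      rw [Complex.exp_sub, Complex.exp_sub, ← neg_exp_eq hs, div_neg, neg_neg]
    have h2 : 1 + -Complex.exp (u - v) = Complex.exp (-((v - u) / 2)) *
        (2 * Complex.sinh ((v - u) / 2)) := by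
      rw [Complex.two_sinh, mul_sub, ← Complex.exp_add, ← Complex.exp_add]
      have : -((v - u) / 2) + -((v - u) / 2) = u - v := by ring
      rw [this]; simp; ring
    rw [h1, h2, mul_inv, ← Complex.exp_neg, neg_neg, cschKernel, smul_eq_mul]
    ring
  have e0 : Complex.exp ((u - u) / 2) * g (Complex.exp u) = g (Complex.exp u) := by simp
  simp only [hk 1 (Or.inl rfl), hk (-1) (Or.inr rfl), e0] at key
  simpa only [smul_eq_mul] using key

/-- Multiplicativity of the Cauchy integral calculus. The contour for `g` is moved to the larger angle
`3π / 4`. After the resolvent identity the scalar integrals of `f` over the inner contour cancel, as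
the points of the outer one lie outside it, and those of `g` over the outer contour reproduce `g` on
the inner one. -/
theorem cauchyIntegral_mul (hA : IsZeroSectorial A) {f g : ℂ → ℂ} (hf : DecaysOnSectors f)
    (hg : DecaysOnSectors g) :
    cauchyIntegral A (Real.pi / 2) f * cauchyIntegral A (Real.pi / 2) g =
      cauchyIntegral A (Real.pi / 2) fun z => f z * g z := by
  have hpi := Real.pi_pos
  obtain ⟨C, hC0, hC⟩ := exists_bound_logResolvent hA
  let p : ℝ → ℝ → ℂ := fun s x => f (Complex.exp (x + (-(s * (Real.pi / 2)) : ℝ) * Complex.I))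
  let q : ℝ → ℝ → ℂ := fun s x => g (Complex.exp (x + (-(s * (3 * Real.pi / 4)) : ℝ) * Complex.I))
  let P : ℝ → ℝ → X →L[ℂ] X := fun s x =>
    logResolvent A (x + (s * (Real.pi - Real.pi / 2) : ℝ) * Complex.I)
  let R : ℝ → ℝ → X →L[ℂ] X := fun s x =>
    logResolvent A (x + (s * (Real.pi - 3 * Real.pi / 4) : ℝ) * Complex.I)
  -- the coefficients `l / (l - l')` and `l' / (l' - l)` of the resolvent identity, `l` on the inner
  -- ray `s`, `l'` on the outer ray `s'`
  let κ : ℝ → ℝ → ℝ → ℝ → ℂ := fun s s' x y =>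
    (1 + Complex.exp ((y + (s' * (Real.pi - 3 * Real.pi / 4) : ℝ) * Complex.I) -
      (x + (-(s * (Real.pi / 2)) : ℝ) * Complex.I)))⁻¹
  let κ' : ℝ → ℝ → ℝ → ℝ → ℂ := fun s s' x y =>
    (1 + Complex.exp ((x + (-(s * (Real.pi / 2)) : ℝ) * Complex.I) -
      (y + (s' * (Real.pi - 3 * Real.pi / 4) : ℝ) * Complex.I)))⁻¹
  have habs : ∀ s s' : ℝ, (s = 1 ∨ s = -1) → (s' = 1 ∨ s' = -1) →
      |s' * (Real.pi - 3 * Real.pi / 4) - -(s * (Real.pi / 2))| ≤ 3 * Real.pi / 4 := by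
    rintro s s' (rfl | rfl) (rfl | rfl) <;> rw [abs_le] <;> constructor <;> linarith
  have hκ : ∀ s s' : ℝ, (s = 1 ∨ s = -1) → (s' = 1 ∨ s' = -1) → ∀ x y : ℝ,
      1 + Complex.exp ((y + (s' * (Real.pi - 3 * Real.pi / 4) : ℝ) * Complex.I) -
      (x + (-(s * (Real.pi / 2)) : ℝ) * Complex.I)) ≠ 0 ∧ ‖κ s s' x y‖ ≤ 2 :=
    fun s s' hs hs' x y => norm_inv_one_add_exp_le (by simpa using habs s s' hs hs')
  have hκ' : ∀ s s' : ℝ, (s = 1 ∨ s = -1) → (s' = 1 ∨ s' = -1) → ∀ x y : ℝ,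
      1 + Complex.exp ((x + (-(s * (Real.pi / 2)) : ℝ) * Complex.I) -
      (y + (s' * (Real.pi - 3 * Real.pi / 4) : ℝ) * Complex.I)) ≠ 0 ∧ ‖κ' s s' x y‖ ≤ 2 :=
    fun s s' hs hs' x y => norm_inv_one_add_exp_le (by
      have := habs s s' hs hs'
      rw [abs_sub_comm] at this
      simpa using this)
  have hPs : ∀ s : ℝ, (s = 1 ∨ s = -1) → |s * (Real.pi - Real.pi / 2)| < 3 * Real.pi / 4 := by
    rintro s (rfl | rfl) <;> rw [abs_lt] <;> constructor <;> linarith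
  have hRs : ∀ s : ℝ, (s = 1 ∨ s = -1) → |s * (Real.pi - 3 * Real.pi / 4)| < 3 * Real.pi / 4 := by
    rintro s (rfl | rfl) <;> rw [abs_lt] <;> constructor <;> linarith
  have main : ∀ s s' : ℝ, (s = 1 ∨ s = -1) → (s' = 1 ∨ s' = -1) →
      Integrable (fun x => (p s x * ∫ y, q s' y * κ' s s' x y) • P s x) ∧
      rayIntegral A (Real.pi / 2) f s * rayIntegral A (3 * Real.pi / 4) g s' =
      (∫ y, (q s' y * ∫ x, p s x * κ s s' x y) • R s' y) +
        ∫ x, (p s x * ∫ y, q s' y * κ' s s' x y) • P s x := by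
    intro s s' hs hs'
    refine integral_mul_integral_of_resolvent_identity (CP := C) (CR := C) (D := 2)
      (hf.integrable_line ?_) (hg.integrable_line ?_)
      (continuous_logResolvent_line hA (hPs s hs)) (continuous_logResolvent_line hA (hRs s' hs'))
      (fun x => hC _ (by simpa using hPs s hs)) (fun x => hC _ (by simpa using hRs s' hs'))
      (Continuous.inv₀ (by fun_prop) fun z => (hκ s s' hs hs' z.1 z.2).1)
      (Continuous.inv₀ (by fun_prop) fun z => (hκ' s s' hs hs' z.1 z.2).1)
      (fun x y => (hκ s s' hs hs' x y).2) (fun x y => (hκ' s s' hs hs' x y).2) fun x y => ?_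
    · rcases hs with rfl | rfl <;> rw [abs_lt] <;> constructor <;> linarith
    · rcases hs' with rfl | rfl <;> rw [abs_lt] <;> constructor <;> linarith
    · have h1 := (hκ s s' hs hs' x y).1
      have h2 := (hκ' s s' hs hs' x y).1
      set ζ : ℂ := x + (s * (Real.pi - Real.pi / 2) : ℝ) * Complex.I with hζ
      set ω : ℂ := y + (s' * (Real.pi - 3 * Real.pi / 4) : ℝ) * Complex.I with hω
      have hu : Complex.exp (x + (-(s * (Real.pi / 2)) : ℝ) * Complex.I) = -Complex.exp ζ :=
        (neg_exp_eq hs x (Real.pi / 2)).symm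
      have e1 : κ s s' x y = Complex.exp ζ / (Complex.exp ζ - Complex.exp ω) := by
        simp only [κ]
        rw [Complex.exp_sub, hu, ← hω] at *
        have h0 := Complex.exp_ne_zero ζ
        rw [show 1 + Complex.exp ω / -Complex.exp ζ =
          (Complex.exp ζ - Complex.exp ω) / Complex.exp ζ by field_simp; ring, inv_div]
      have e2 : κ' s s' x y = Complex.exp ω / (Complex.exp ω - Complex.exp ζ) := by
        simp only [κ']
        rw [Complex.exp_sub, hu, ← hω] at *
        have h0 := Complex.exp_ne_zero ω
        rw [show 1 + -Complex.exp ζ / Complex.exp ω =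
          (Complex.exp ω - Complex.exp ζ) / Complex.exp ω by field_simp; ring, inv_div]
      rw [e1, e2]
      refine logResolvent_mul hA (by simpa [ζ] using hPs s hs) (by simpa [ω] using hRs s' hs')
        fun heq => h1 ?_
      rw [Complex.exp_sub, hu, heq, div_neg, div_self (Complex.exp_ne_zero _)]
      ring
  have hα : ∀ s' : ℝ, (s' = 1 ∨ s' = -1) → ∀ y : ℝ,
      ∫ x, p 1 x * κ 1 s' x y = ∫ x, p (-1) x * κ (-1) s' x y := fun s' hs' y =>
    integral_ray_kernel_eq hf (by
      rcases hs' with rfl | rfl <;> simp <;> rw [abs_le] <;> constructor <;> linarith)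
  have hβ : ∀ s : ℝ, (s = 1 ∨ s = -1) → ∀ x : ℝ,
      (∫ y, q 1 y * κ' s 1 x y) - (∫ y, q (-1) y * κ' s (-1) x y) =
        2 * Real.pi * Complex.I *
          g (Complex.exp (x + (-(s * (Real.pi / 2)) : ℝ) * Complex.I)) := fun s hs x =>
    integral_ray_kernel_sub hg (by
      rcases hs with rfl | rfl <;> simp <;> rw [abs_of_pos (half_pos hpi)])
  have hray : ∀ s : ℝ, (s = 1 ∨ s = -1) →
      (∫ x, (p s x * ∫ y, q 1 y * κ' s 1 x y) • P s x) -
        (∫ x, (p s x * ∫ y, q (-1) y * κ' s (-1) x y) • P s x) =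
      (2 * Real.pi * Complex.I : ℂ) • rayIntegral A (Real.pi / 2) (fun z => f z * g z) s := by
    intro s hs
    rw [← integral_sub (main s 1 hs (Or.inl rfl)).1 (main s (-1) hs (Or.inr rfl)).1, rayIntegral,
      ← integral_smul]
    congr 1
    ext1 x
    rw [← sub_smul, ← mul_sub, hβ s hs, smul_smul]
    congr 1
    simp only [p]
    ring
  have hpi0 : (2 * Real.pi * Complex.I : ℂ) ≠ 0 := Complex.two_pi_I_ne_zero
  rw [cauchyIntegral_eq, cauchyIntegral_eq, cauchyIntegral_eq,
    rayIntegral_pi_div_two hA hg (Or.inl rfl), rayIntegral_pi_div_two hA hg (Or.inr rfl),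
    smul_mul_smul_comm, sub_mul, mul_sub, mul_sub, (main 1 1 (Or.inl rfl) (Or.inl rfl)).2,
    (main 1 (-1) (Or.inl rfl) (Or.inr rfl)).2, (main (-1) 1 (Or.inr rfl) (Or.inl rfl)).2,
    (main (-1) (-1) (Or.inr rfl) (Or.inr rfl)).2]
  simp_rw [hα 1 (Or.inl rfl), hα (-1) (Or.inr rfl)]
  rw [show ∀ a b c d e f : X →L[ℂ] X, a + b - (c + d) - (a + e - (c + f)) = (b - d) - (e - f) from
    fun a b c d e f => by abel, hray 1 (Or.inl rfl), hray (-1) (Or.inr rfl), ← smul_sub, smul_smul,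
    mul_assoc, inv_mul_cancel₀ hpi0, mul_one]

theorem rho_neg_exp (ζ : ℂ) : rho (-Complex.exp ζ) = -cschKernel ζ ^ 2 := by
  have h0 := Complex.exp_ne_zero (ζ / 2)
  have h1 : Complex.exp ζ = Complex.exp (ζ / 2) ^ 2 := by rw [← Complex.exp_nat_mul]; congr 1; push_cast; ring
  rw [rho, cschKernel, Complex.two_sinh, Complex.exp_neg, h1]
  have h2 : Complex.exp (ζ / 2) - (Complex.exp (ζ / 2))⁻¹ =
      (Complex.exp (ζ / 2) ^ 2 - 1) / Complex.exp (ζ / 2) := by field_simp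
  rw [h2, inv_div, div_pow, neg_div]
  congr 2
  ring

/-- `ρ(A) = A (1 + A)⁻²`: the residue of the Cauchy integral at `-1`. -/
theorem cauchyIntegral_rho (hA : IsZeroSectorial A) :
    cauchyIntegral A (Real.pi / 2) rho = deriv (logResolvent A) 0 := by
  have hpi := Real.pi_pos
  obtain ⟨C, hC0, hC⟩ := exists_bound_logResolvent hA
  have hd : DifferentiableOn ℂ (logResolvent A) {z | |z.im| < 3 * Real.pi / 4} := fun z hz =>
    (differentiableAt_logResolvent hA hz).differentiableWithinAt
  have h0mem : (0 : ℂ) ∈ {z : ℂ | |z.im| < 3 * Real.pi / 4} := by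
    change |(0 : ℂ).im| < _; simp; positivity
  have hreg : DifferentiableOn ℂ (regQuot (logResolvent A) 0) {z | |z.im| < 3 * Real.pi / 4} :=
    differentiableOn_regQuot (isOpen_strip _) hd h0mem fun w hw => by
      have : |w.im| < 3 * Real.pi / 4 := hw
      simp; linarith
  -- boundedness of the regularized quotient: explicit far away, by compactness nearby
  obtain ⟨M, hM⟩ : ∃ M, ∀ z : ℂ, z.im ∈ Icc (-(Real.pi / 2)) (Real.pi / 2) →
      ‖regQuot (logResolvent A) 0 z‖ ≤ M := by
    have hcpt : IsCompact (Icc (-1 : ℝ) 1 ×ℂ Icc (-(Real.pi / 2)) (Real.pi / 2)) :=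
      isCompact_Icc.reProdIm isCompact_Icc
    have habs : ∀ z : ℂ, z.im ∈ Icc (-(Real.pi / 2)) (Real.pi / 2) →
        |z.im| < 3 * Real.pi / 4 := fun z hz => by
      rw [abs_lt]; constructor <;> linarith [hz.1, hz.2]
    obtain ⟨M, hM⟩ := hcpt.exists_bound_of_continuousOn
      (hreg.continuousOn.mono fun z hz => habs z hz.2)
    refine ⟨max M (4 * C), fun z hz => ?_⟩
    rcases le_total |z.re| 1 with h | h
    · exact (hM z ⟨abs_le.1 h, hz⟩).trans (le_max_left _ _)
    · refine (norm_regQuot_le (hC z (habs z hz)) (hC 0 h0mem) (by simpa using h)).trans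
        (le_trans ?_ (le_max_right _ _))
      have : Real.exp (-(1 / 2 * |z.re - (0 : ℂ).re|)) ≤ 1 := by
        rw [Real.exp_le_one_iff]; have := abs_nonneg (z.re - (0 : ℂ).re); linarith
      nlinarith
  obtain ⟨hi1, hi2, key⟩ := cauchy_formula_strip (w₀ := 0) (a := -(Real.pi / 2)) (b := Real.pi / 2)
    hreg (by linarith) (by simpa using hpi) (by simpa using hpi) (by linarith) (by linarith) hM
  rw [regQuot_self] at key
  simp only [sub_zero] at key hi1 hi2
  have hray : ∀ s : ℝ, (s = 1 ∨ s = -1) → rayIntegral A (Real.pi / 2) rho s =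
      -(∫ x : ℝ, cschKernel (x + (s * (Real.pi / 2) : ℝ) * Complex.I) •
        regQuot (logResolvent A) 0 (x + (s * (Real.pi / 2) : ℝ) * Complex.I)) -
      (∫ x : ℝ, cschKernel (x + (s * (Real.pi / 2) : ℝ) * Complex.I) ^ 2) • logResolvent A 0 := by
    intro s hs
    have hsi : |s * (Real.pi / 2)| < 2 * Real.pi := by
      rw [abs_sign_mul hs, abs_of_pos (by linarith)]; linarith
    have hs0 : s * (Real.pi / 2) ≠ 0 := by rcases hs with rfl | rfl <;> simp [hpi.ne']
    have hK2 : Integrable fun x : ℝ =>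
        cschKernel (x + (s * (Real.pi / 2) : ℝ) * Complex.I) ^ 2 := by
      refine integrable_horizontal (F := fun z => cschKernel z ^ 2) (C := 4) (R := 1) (ε := 1)
        (fun z hz => (differentiableAt_cschKernel (ne_zero_of_im_ne_zero (hz ▸ hs0))
          (hz ▸ hsi)).pow 2) one_pos fun z _ hR => ?_
      rw [norm_pow]
      calc ‖cschKernel z‖ ^ 2 ≤ (2 * Real.exp (-(1 / 2 * |z.re|))) ^ 2 := by
            gcongr; exact norm_cschKernel_le hR
        _ = 4 * Real.exp (-(1 * |z.re|)) := by
            rw [mul_pow, ← Real.exp_nat_mul]; norm_num; ring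
    have hi : Integrable fun x : ℝ => cschKernel (x + (s * (Real.pi / 2) : ℝ) * Complex.I) •
        regQuot (logResolvent A) 0 (x + (s * (Real.pi / 2) : ℝ) * Complex.I) := by
      rcases hs with rfl | rfl
      · simpa using hi2
      · simpa using hi1
    have hin : Integrable fun x : ℝ => -(cschKernel (x + (s * (Real.pi / 2) : ℝ) * Complex.I) •
        regQuot (logResolvent A) 0 (x + (s * (Real.pi / 2) : ℝ) * Complex.I)) := hi.neg
    have e := integral_smul_const (fun x : ℝ =>
      cschKernel (x + (s * (Real.pi / 2) : ℝ) * Complex.I) ^ 2) (μ := volume) (logResolvent A 0)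
    rw [rayIntegral, ← e, ← integral_neg, ← integral_sub hin (hK2.smul_const (logResolvent A 0))]
    congr 1
    ext1 x
    rw [← neg_exp_eq hs, rho_neg_exp, show s * (Real.pi - Real.pi / 2) = s * (Real.pi / 2) by ring,
      regQuot_of_ne _ (ne_zero_of_im_ne_zero (by simpa using hs0)), sub_zero, smul_smul, smul_sub,
      neg_sub, ← pow_two, sub_sub_cancel_left, neg_smul]
  -- the double pole has no residue by itself: the kernel `1 / (4 sinh²)` is even
  have heven : ∫ x : ℝ, cschKernel (x + (1 * (Real.pi / 2) : ℝ) * Complex.I) ^ 2 =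
      ∫ x : ℝ, cschKernel (x + (-1 * (Real.pi / 2) : ℝ) * Complex.I) ^ 2 := by
    rw [← integral_neg_eq_self]
    congr 1
    ext1 x
    have : ((-x : ℝ) : ℂ) + (1 * (Real.pi / 2) : ℝ) * Complex.I =
        -(x + (-1 * (Real.pi / 2) : ℝ) * Complex.I) := by push_cast; ring
    rw [this, cschKernel, cschKernel, neg_div, Complex.sinh_neg, mul_neg, inv_neg, neg_sq]
  rw [cauchyIntegral_eq, hray 1 (Or.inl rfl), hray (-1) (Or.inr rfl), heven, sub_sub_sub_cancel_right,
    neg_sub_neg]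
  simp only [one_mul, neg_mul]
  rw [key, smul_smul, inv_mul_cancel₀ Complex.two_pi_I_ne_zero, one_smul]

theorem cauchyIntegral_rho_injective (hA : IsZeroSectorial A) {x : X}
    (hx : cauchyIntegral A (Real.pi / 2) rho x = 0) : x = 0 := by
  refine eq_zero_of_resolvent_neg_one hA ?_
  have h0 : |(0 : ℂ).im| < 3 * Real.pi / 4 := by simp; positivity
  rw [cauchyIntegral_rho hA, (hasDerivAt_logResolvent hA h0).deriv] at hx
  rw [← neg_eq_zero, ← hx, Complex.exp_zero] at *
  rw [← map_neg]
  simp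
  abel

end Cauchy

open scoped FourierTransform SchwartzMap

/-! ### Schwartz functions and the Sobolev norm -/

section Schwartz

theorem schwartz_decay (F : 𝓢(ℝ, ℂ)) (K : ℝ) :
    ∃ C : ℝ, 0 ≤ C ∧ ∀ t : ℝ, ‖F t‖ ≤ C * (1 + |t|) ^ (-K) := by
  obtain ⟨k, hk⟩ := exists_nat_ge K
  refine ⟨2 ^ k * (Finset.Iic (k, 0)).sup (fun m => SchwartzMap.seminorm ℝ m.1 m.2) F,
    mul_nonneg (by positivity) (apply_nonneg _ _), fun t => ?_⟩
  have h := SchwartzMap.one_add_le_sup_seminorm_apply (𝕜 := ℝ) (m := (k, 0)) le_rfl le_rfl F t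
  rw [norm_iteratedFDeriv_zero, Real.norm_eq_abs] at h
  have h1 : 1 ≤ 1 + |t| := by linarith [abs_nonneg t]
  have h0 : 0 < 1 + |t| := by linarith
  rw [Real.rpow_neg h0.le, ← div_eq_mul_inv, le_div_iff₀ (Real.rpow_pos_of_pos h0 K), mul_comm]
  refine le_trans ?_ h
  gcongr
  rw [← Real.rpow_natCast]
  exact Real.rpow_le_rpow_of_exponent_le h1 hk

theorem integrable_weight {K : ℝ} (hK : 1 < K) : Integrable fun t : ℝ => (1 + |t|) ^ (-K) := by
  simpa using integrable_one_add_norm (E := ℝ) (μ := volume) (r := K) (by simpa using hK)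

theorem continuous_weight (K : ℝ) : Continuous fun t : ℝ => (1 + |t|) ^ K :=
  Continuous.rpow_const (by fun_prop) fun t => Or.inl (by positivity)

theorem integrable_schwartz_weight (F : 𝓢(ℝ, ℂ)) (K : ℝ) :
    Integrable fun t : ℝ => (1 + |t|) ^ K * ‖F t‖ := by
  obtain ⟨C, hC0, hC⟩ := schwartz_decay F (K + 2)
  refine ((integrable_weight one_lt_two).const_mul C).mono'
    ((continuous_weight K).mul F.continuous.norm).aestronglyMeasurable (ae_of_all _ fun t => ?_)
  have h0 : 0 < 1 + |t| := by positivity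
  rw [Real.norm_of_nonneg (by positivity)]
  calc (1 + |t|) ^ K * ‖F t‖ ≤ (1 + |t|) ^ K * (C * (1 + |t|) ^ (-(K + 2))) := by
        gcongr; exact hC t
    _ = C * (1 + |t|) ^ (-2 : ℝ) := by
        rw [mul_left_comm, ← Real.rpow_add h0]; congr 2; ring

theorem memLp_weight_mul_schwartz (F : 𝓢(ℝ, ℂ)) (K : ℝ) :
    MemLp (fun t : ℝ => (((1 + |t|) ^ K : ℝ) : ℂ) * F t) 2 := by
  have hcont : Continuous fun t : ℝ => (((1 + |t|) ^ K : ℝ) : ℂ) * F t :=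
    (Complex.continuous_ofReal.comp (continuous_weight K)).mul F.continuous
  rw [memLp_two_iff_integrable_sq_norm hcont.aestronglyMeasurable]
  obtain ⟨C, hC0, hC⟩ := schwartz_decay F (K + 1)
  refine ((integrable_weight one_lt_two).const_mul (C ^ 2)).mono'
    (hcont.norm.pow 2).aestronglyMeasurable (ae_of_all _ fun t => ?_)
  have h0 : 0 < 1 + |t| := by positivity
  rw [Real.norm_of_nonneg (by positivity), norm_mul, Complex.norm_real,
    Real.norm_of_nonneg (by positivity)]
  have h1 : (1 + |t|) ^ K * ‖F t‖ ≤ C * (1 + |t|) ^ (-1 : ℝ) := by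
    calc (1 + |t|) ^ K * ‖F t‖ ≤ (1 + |t|) ^ K * (C * (1 + |t|) ^ (-(K + 1))) := by
          gcongr; exact hC t
      _ = C * (1 + |t|) ^ (-1 : ℝ) := by
          rw [mul_left_comm, ← Real.rpow_add h0]; congr 2; ring
  calc ((1 + |t|) ^ K * ‖F t‖) ^ 2 ≤ (C * (1 + |t|) ^ (-1 : ℝ)) ^ 2 := by gcongr
    _ = C ^ 2 * (1 + |t|) ^ (-2 : ℝ) := by
      rw [mul_pow, ← Real.rpow_natCast ((1 + |t|) ^ (-1 : ℝ)), ← Real.rpow_mul h0.le]; norm_num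

theorem sobolevNorm_schwartz (β : ℝ) (F : 𝓢(ℝ, ℂ)) :
    sobolevNorm β F = eLpNorm (fun t : ℝ => (((1 + |t|) ^ β : ℝ) : ℂ) * 𝓕 F t) 2 := by
  have h : MemLp F 2 volume := F.memLp 2 volume
  rw [sobolevNorm, dif_pos h]
  refine eLpNorm_congr_ae ?_
  have h1 : FourierTransform.fourier (h.toLp F) = (𝓕 F).toLp 2 := SchwartzMap.toLp_fourier_eq F
  rw [h1]
  filter_upwards [(𝓕 F).coeFn_toLp 2 volume] with t ht
  rw [ht]

theorem sobolevNorm_schwartz_lt_top (β : ℝ) (F : 𝓢(ℝ, ℂ)) : sobolevNorm β F < ⊤ := by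
  rw [sobolevNorm_schwartz]
  exact (memLp_weight_mul_schwartz (𝓕 F) β).2

theorem fourier_apply (F : ℝ → ℂ) (ξ : ℝ) :
    𝓕 F ξ = ∫ u : ℝ, Complex.exp (-(2 * Real.pi * ξ * u * Complex.I)) * F u := by
  rw [Real.fourier_real_eq_integral_exp_smul]
  congr 1
  ext1 u
  rw [smul_eq_mul]
  congr 2
  push_cast; ring

theorem fourierInv_apply (F : ℝ → ℂ) (u : ℝ) :
    𝓕⁻ F u = ∫ ξ : ℝ, Complex.exp (2 * Real.pi * ξ * u * Complex.I) * F ξ := by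
  rw [Real.fourierInv_eq']
  congr 1
  ext1 ξ
  rw [smul_eq_mul]
  congr 2
  simp
  ring

theorem schwartz_fourierInv_apply (F : 𝓢(ℝ, ℂ)) (u : ℝ) :
    𝓕⁻ F u = ∫ ξ : ℝ, Complex.exp (2 * Real.pi * ξ * u * Complex.I) * F ξ := by
  rw [SchwartzMap.fourierInv_coe, fourierInv_apply]

theorem schwartz_inversion (F : 𝓢(ℝ, ℂ)) (u : ℝ) :
    F u = ∫ ξ : ℝ, Complex.exp (2 * Real.pi * ξ * u * Complex.I) * 𝓕 F ξ := by
  rw [← schwartz_fourierInv_apply, FourierTransform.fourierInv_fourier_eq]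

/-- The modulation `u ↦ e^{2πiξu} F(u)` of a Schwartz function. -/
noncomputable def modulate (ξ : ℝ) (F : 𝓢(ℝ, ℂ)) : 𝓢(ℝ, ℂ) :=
  𝓕⁻ ((𝓕 F).compSubConstCLM ℂ ξ)

theorem fourier_modulate (ξ : ℝ) (F : 𝓢(ℝ, ℂ)) (t : ℝ) : 𝓕 (modulate ξ F) t = 𝓕 F (t - ξ) := by
  rw [modulate, FourierTransform.fourier_fourierInv_eq, SchwartzMap.compSubConstCLM_apply]

theorem modulate_apply (ξ : ℝ) (F : 𝓢(ℝ, ℂ)) (u : ℝ) :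
    modulate ξ F u = Complex.exp (2 * Real.pi * ξ * u * Complex.I) * F u := by
  rw [modulate, schwartz_fourierInv_apply, schwartz_inversion F u, ← integral_const_mul,
    ← integral_sub_right_eq_self (fun t : ℝ => Complex.exp (2 * Real.pi * ξ * u * Complex.I) *
      (Complex.exp (2 * Real.pi * t * u * Complex.I) * 𝓕 F t)) ξ]
  congr 1
  ext1 t
  rw [SchwartzMap.compSubConstCLM_apply, ← mul_assoc, ← Complex.exp_add]
  congr 2
  push_cast; ring

theorem weight_le_mul {β : ℝ} (hβ : 0 ≤ β) (t ξ : ℝ) :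
    (1 + |t|) ^ β ≤ (1 + |ξ|) ^ β * (1 + |t - ξ|) ^ β := by
  rw [← Real.mul_rpow (by positivity) (by positivity)]
  refine Real.rpow_le_rpow (by positivity) ?_ hβ
  have h1 : |t| ≤ |t - ξ| + |ξ| := by simpa using abs_add_le (t - ξ) ξ
  nlinarith [abs_nonneg ξ, abs_nonneg (t - ξ)]

theorem sobolevNorm_modulate_le {β : ℝ} (hβ : 0 ≤ β) (ξ : ℝ) (F : 𝓢(ℝ, ℂ)) :
    sobolevNorm β (modulate ξ F) ≤ ENNReal.ofReal ((1 + |ξ|) ^ β) * sobolevNorm β F := by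
  rw [sobolevNorm_schwartz, sobolevNorm_schwartz]
  have h1 : eLpNorm (fun t : ℝ => (((1 + |t - ξ|) ^ β : ℝ) : ℂ) * 𝓕 F (t - ξ)) 2 =
      eLpNorm (fun t : ℝ => (((1 + |t|) ^ β : ℝ) : ℂ) * 𝓕 F t) 2 :=
    eLpNorm_comp_measurePreserving (f := fun t : ℝ => t - ξ)
      (g := fun t : ℝ => (((1 + |t|) ^ β : ℝ) : ℂ) * 𝓕 F t)
      (memLp_weight_mul_schwartz (𝓕 F) β).1 (measurePreserving_sub_right volume ξ)
  rw [← h1]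
  refine eLpNorm_le_mul_eLpNorm_of_ae_le_mul (ae_of_all _ fun t => ?_) 2
  rw [fourier_modulate, norm_mul, norm_mul, Complex.norm_real, Complex.norm_real,
    Real.norm_of_nonneg (by positivity), Real.norm_of_nonneg (by positivity), ← mul_assoc]
  gcongr
  exact weight_le_mul hβ t ξ

open Polynomial in
theorem iteratedDeriv_sigmoid_mul (n : ℕ) :
    ∃ s : ℝ[X], iteratedDeriv n (fun u : ℝ => ((Real.sigmoid u * (1 - Real.sigmoid u) : ℝ) : ℂ)) =
      fun u => (((s * (X * (1 - X))).eval (Real.sigmoid u) : ℝ) : ℂ) := by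
  induction n with
  | zero => exact ⟨1, by ext u; simp⟩
  | succ n ih =>
    obtain ⟨s, hs⟩ := ih
    refine ⟨derivative (s * (X * (1 - X))), ?_⟩
    rw [iteratedDeriv_succ, hs]
    ext u
    have h1 : HasDerivAt (fun u => (s * (X * (1 - X))).eval (Real.sigmoid u))
        ((derivative (s * (X * (1 - X)))).eval (Real.sigmoid u) *
          (Real.sigmoid u * (1 - Real.sigmoid u))) u :=
      ((s * (X * (1 - X))).hasDerivAt (Real.sigmoid u)).comp u (Real.hasDerivAt_sigmoid u)
    rw [h1.ofReal_comp.deriv, eval_mul]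
    simp

theorem sigmoid_mul_le (u : ℝ) : Real.sigmoid u * (1 - Real.sigmoid u) ≤ Real.exp (-|u|) := by
  have h : ∀ v : ℝ, 0 ≤ v → Real.sigmoid v * Real.sigmoid (-v) ≤ Real.exp (-v) := fun v _ => by
    rw [← Real.sigmoid_mul_rexp_neg v]
    have h0 := Real.sigmoid_nonneg v
    have h1 := Real.sigmoid_le_one v
    have := mul_le_one₀ h1 h0 h1
    nlinarith [Real.exp_pos (-v)]
  rw [← Real.sigmoid_neg]
  rcases le_total 0 u with hu | hu
  · rw [abs_of_nonneg hu]; exact h u hu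
  · rw [abs_of_nonpos hu, mul_comm]
    simpa using h (-u) (by linarith)

theorem pow_mul_exp_neg_bounded (k : ℕ) : ∃ C : ℝ, ∀ u : ℝ, |u| ^ k * Real.exp (-|u|) ≤ C := by
  refine ⟨k.factorial, fun u => ?_⟩
  have := Real.pow_div_factorial_le_exp |u| (abs_nonneg u) k
  rw [div_le_iff₀ (by positivity)] at this
  rw [Real.exp_neg, ← div_eq_mul_inv, div_le_iff₀ (Real.exp_pos _)]
  linarith

theorem rho_exp_eq_sigmoid (u : ℝ) :
    rho (Real.exp u) = ((Real.sigmoid u * (1 - Real.sigmoid u) : ℝ) : ℂ) := by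
  have h : Real.exp u / (1 + Real.exp u) ^ 2 = Real.sigmoid u * (1 - Real.sigmoid u) := by
    rw [Real.sigmoid_def, Real.exp_neg]
    have := Real.exp_pos u
    field_simp
    ring
  rw [← h, rho]
  push_cast
  rfl

/-- The function `ρ ∘ exp` as a Schwartz function. -/
noncomputable def rhoExp : 𝓢(ℝ, ℂ) where
  toFun u := rho (Real.exp u)
  smooth' := by
    simp_rw [rho_exp_eq_sigmoid]
    have h : ContDiff ℝ ⊤ Real.sigmoid := contDiff_sigmoid
    have h' := h.of_le (m := ((⊤ : ℕ∞) : WithTop ℕ∞)) le_top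
    exact Complex.ofRealCLM.contDiff.comp (h'.mul (contDiff_const.sub h'))
  decay' k n := by
    simp_rw [rho_exp_eq_sigmoid]
    obtain ⟨s, hs⟩ := iteratedDeriv_sigmoid_mul n
    obtain ⟨M, hM⟩ := isCompact_Icc.exists_bound_of_continuousOn
      (s.continuous.continuousOn (s := Icc (0 : ℝ) 1))
    obtain ⟨C, hC⟩ := pow_mul_exp_neg_bounded k
    refine ⟨M * C, fun u => ?_⟩
    have h0 : 0 ≤ Real.sigmoid u * (1 - Real.sigmoid u) :=
      mul_nonneg (Real.sigmoid_nonneg u) (by linarith [Real.sigmoid_le_one u])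
    have hMu := hM (Real.sigmoid u) ⟨Real.sigmoid_nonneg u, Real.sigmoid_le_one u⟩
    have hM0 : 0 ≤ M := (norm_nonneg _).trans hMu
    rw [norm_iteratedFDeriv_eq_norm_iteratedDeriv, hs, Complex.norm_real, Real.norm_eq_abs u]
    simp only [Polynomial.eval_mul, Polynomial.eval_X, Polynomial.eval_sub, Polynomial.eval_one]
    rw [norm_mul, Real.norm_of_nonneg h0]
    calc |u| ^ k * (‖s.eval (Real.sigmoid u)‖ * (Real.sigmoid u * (1 - Real.sigmoid u))) ≤
          |u| ^ k * (M * Real.exp (-|u|)) := by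
          gcongr
          exact sigmoid_mul_le u
      _ = M * (|u| ^ k * Real.exp (-|u|)) := by ring
      _ ≤ M * C := by gcongr; exact hC u

@[simp]
theorem rhoExp_apply (u : ℝ) : rhoExp u = rho (Real.exp u) := rfl

end Schwartz

/-! ### Regularized imaginary powers -/

section ImagPow

variable {X : Type*} [NormedAddCommGroup X] [NormedSpace ℂ X] {A : X →ₗ.[ℂ] X}

theorem exp_cpow {u w : ℂ} (hu : |u.im| < Real.pi) :
    Complex.exp u ^ w = Complex.exp (u * w) := by
  rw [Complex.cpow_def_of_ne_zero (Complex.exp_ne_zero u), Complex.log_exp] <;>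
    linarith [abs_lt.1 hu]

theorem inHInf_cpow (t : ℝ) : InHInf fun z => z ^ (Complex.I * t) := by
  constructor
  · intro z hz
    exact (DifferentiableAt.cpow_const (f := fun z : ℂ => z) differentiableAt_id
      hz).differentiableWithinAt
  · intro ω hω
    refine ⟨Real.exp (Real.pi * |t|), fun z hz => ?_⟩
    rw [Complex.norm_cpow_of_ne_zero hz.1]
    simp only [Complex.mul_re, Complex.I_re, Complex.ofReal_re, zero_mul, Complex.I_im,
      Complex.ofReal_im, mul_zero, sub_self, Real.rpow_zero, Complex.mul_im, zero_add, one_mul]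
    rw [one_div, ← Real.exp_neg, Real.exp_le_exp]
    have h1 : |z.arg * t| ≤ Real.pi * |t| := by
      rw [abs_mul]
      gcongr
      exact Complex.abs_arg_le_pi z
    linarith [neg_abs_le (z.arg * t)]

/-- The bounded operator `(ρ λ^{it})(A) = ρ(A) A^{it}`. -/
noncomputable def regImagPow (A : X →ₗ.[ℂ] X) (t : ℝ) : X →L[ℂ] X :=
  cauchyIntegral A (Real.pi / 2) fun z => rho z * z ^ (Complex.I * t)

theorem decaysOnSectors_rho_mul_cpow (t : ℝ) :
    DecaysOnSectors fun z => rho z * z ^ (Complex.I * t) :=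
  decaysOnSectors_rho.mul_inHInf (inHInf_cpow t)

theorem cauchyIntegral_congr {f g : ℂ → ℂ} (h : ∀ z ∈ Complex.slitPlane, f z = g z) :
    cauchyIntegral A (Real.pi / 2) f = cauchyIntegral A (Real.pi / 2) g := by
  have hpi := Real.pi_pos
  have hray : ∀ s : ℝ, (s = 1 ∨ s = -1) →
      rayIntegral A (Real.pi / 2) f s = rayIntegral A (Real.pi / 2) g s := by
    intro s hs
    unfold rayIntegral
    congr 1
    ext1 x
    rw [h]
    refine exp_mem_slitPlane_of_abs_lt ?_
    simp only [Complex.add_im, Complex.ofReal_im, Complex.mul_im, Complex.ofReal_re,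
      Complex.I_im, mul_one, Complex.I_re, mul_zero, add_zero, zero_add]
    rw [abs_neg, abs_sign_mul hs, abs_of_pos (by linarith)]
    linarith
  rw [cauchyIntegral_eq, cauchyIntegral_eq, hray 1 (Or.inl rfl), hray (-1) (Or.inr rfl)]

theorem ne_zero_of_mem_slitPlane {z : ℂ} (hz : z ∈ Complex.slitPlane) : z ≠ 0 :=
  Complex.slitPlane_ne_zero hz

/-- The exponent `2πξ` turns the frequency variable of the Fourier transform into an imaginary
power; on the ray at angle `-sπ/2` this is an exponential in the logarithmic coordinate. -/
theorem ray_cpow {s : ℝ} (hs : s = 1 ∨ s = -1) (x t : ℝ) :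
    Complex.exp (x + (-(s * (Real.pi / 2)) : ℝ) * Complex.I) ^ (Complex.I * t) =
      Complex.exp ((x + (-(s * (Real.pi / 2)) : ℝ) * Complex.I) * (Complex.I * t)) := by
  refine exp_cpow ?_
  simp only [Complex.add_im, Complex.ofReal_im, Complex.mul_im, Complex.ofReal_re,
    Complex.I_im, mul_one, Complex.I_re, mul_zero, add_zero, zero_add]
  rw [abs_neg, abs_sign_mul hs, abs_of_pos (half_pos Real.pi_pos)]
  linarith [Real.pi_pos]

theorem norm_ray_cpow_le {s : ℝ} (hs : s = 1 ∨ s = -1) (x t : ℝ) :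
    ‖Complex.exp ((x + (-(s * (Real.pi / 2)) : ℝ) * Complex.I) * (Complex.I * t))‖ ≤
      Real.exp (Real.pi * |t|) := by
  rw [Complex.norm_exp, Real.exp_le_exp]
  have h1 : ((x + (-(s * (Real.pi / 2)) : ℝ) * Complex.I) * (Complex.I * t)).re =
      (s * t) * (Real.pi / 2) := by
    simp [Complex.mul_re, Complex.mul_im]; ring
  rw [h1]
  have h2 : s * t ≤ |t| := (le_abs_self _).trans (abs_sign_mul hs).le
  nlinarith [Real.pi_pos, abs_nonneg t]

theorem continuous_regImagPow (hA : IsZeroSectorial A) : Continuous (regImagPow A) := by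
  have hpi := Real.pi_pos
  obtain ⟨C, hC0, hC⟩ := exists_bound_logResolvent hA
  have hray : ∀ s : ℝ, (s = 1 ∨ s = -1) → Continuous fun t : ℝ =>
      rayIntegral A (Real.pi / 2) (fun z => rho z * z ^ (Complex.I * t)) s := by
    intro s hs
    have h3 : |s * (Real.pi - Real.pi / 2)| < 3 * Real.pi / 4 := by
      rw [abs_sign_mul hs, abs_of_pos (by linarith)]; linarith
    have h4 : |(-(s * (Real.pi / 2)))| < Real.pi := by
      rw [abs_neg, abs_sign_mul hs, abs_of_pos (by linarith)]; linarith
    have hr := decaysOnSectors_rho.integrable_line h4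
    refine continuous_iff_continuousAt.2 fun t₀ => ?_
    unfold rayIntegral
    simp_rw [ray_cpow hs]
    refine continuousAt_of_dominated (bound := fun x =>
      ‖rho (Complex.exp (x + (-(s * (Real.pi / 2)) : ℝ) * Complex.I))‖ *
        (Real.exp (Real.pi * (|t₀| + 1)) * C)) (Eventually.of_forall fun t => ?_) ?_
      (hr.norm.mul_const _) (ae_of_all _ fun x => ?_)
    · exact (hr.aestronglyMeasurable.mul (by fun_prop)).smul
        (continuous_logResolvent_line hA h3).aestronglyMeasurable
    · filter_upwards [Metric.ball_mem_nhds t₀ one_pos] with t ht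
      refine ae_of_all _ fun x => ?_
      rw [norm_smul, norm_mul, mul_assoc]
      gcongr
      · refine (norm_ray_cpow_le hs x t).trans ?_
        rw [Real.exp_le_exp]
        gcongr
        rw [Metric.mem_ball, Real.dist_eq] at ht
        linarith [abs_sub_abs_le_abs_sub t t₀]
      · exact hC _ (by simpa using h3)
    · fun_prop
  unfold regImagPow
  simp_rw [cauchyIntegral_eq]
  exact ((hray 1 (Or.inl rfl)).sub (hray (-1) (Or.inr rfl))).const_smul
    (2 * Real.pi * Complex.I : ℂ)⁻¹

theorem regImagPow_zero : regImagPow A 0 = cauchyIntegral A (Real.pi / 2) rho :=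
  cauchyIntegral_congr fun z _ => by simp

variable [CompleteSpace X]

theorem regImagPow_mul (hA : IsZeroSectorial A) (s t : ℝ) :
    regImagPow A s * regImagPow A t =
      cauchyIntegral A (Real.pi / 2) rho * regImagPow A (s + t) := by
  rw [regImagPow, regImagPow, regImagPow,
    cauchyIntegral_mul hA (decaysOnSectors_rho_mul_cpow s) (decaysOnSectors_rho_mul_cpow t),
    cauchyIntegral_mul hA decaysOnSectors_rho (decaysOnSectors_rho_mul_cpow (s + t))]
  refine cauchyIntegral_congr fun z hz => ?_
  rw [Complex.ofReal_add, mul_add, Complex.cpow_add _ _ (ne_zero_of_mem_slitPlane hz)]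
  ring

theorem regImagPow_comm (hA : IsZeroSectorial A) (t : ℝ) :
    regImagPow A t * cauchyIntegral A (Real.pi / 2) rho =
      cauchyIntegral A (Real.pi / 2) rho * regImagPow A t := by
  have h := regImagPow_mul hA t 0
  rwa [regImagPow_zero, add_zero] at h

/-- The graph of `f(A) = ρ(A)⁻¹ (ρ f)(A)`. -/
theorem holCalc_graph (hA : IsZeroSectorial A) (f : ℂ → ℂ) (x y : X) :
    (x, y) ∈ (holCalc A f).graph ↔ cauchyIntegral A (Real.pi / 2) rho y =
      cauchyIntegral A (Real.pi / 2) (fun z => rho z * f z) x := by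
  rw [holCalc, Submodule.toLinearPMap_graph_eq]
  · rw [LinearMap.mem_ker, LinearMap.sub_apply, sub_eq_zero]
    rfl
  · rintro ⟨x, y⟩ h1 (rfl : x = 0)
    rw [LinearMap.mem_ker, LinearMap.sub_apply, sub_eq_zero] at h1
    refine cauchyIntegral_rho_injective hA ?_
    simpa using h1

theorem HolCalcEq.rho_mul (hA : IsZeroSectorial A) {f : ℂ → ℂ} {T : X →L[ℂ] X}
    (h : HolCalcEq A f T) : cauchyIntegral A (Real.pi / 2) rho * T =
      cauchyIntegral A (Real.pi / 2) fun z => rho z * f z := by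
  ext x
  have h1 : (x, T x) ∈ (holCalc A f).graph := by
    rw [HolCalcEq] at h
    rw [h, LinearPMap.mem_graph_iff]
    exact ⟨⟨x, trivial⟩, rfl, rfl⟩
  exact (holCalc_graph hA f x (T x)).1 h1

/-- `ρ(A)` cancels on the left of operator identities. -/
theorem rho_mul_cancel (hA : IsZeroSectorial A) {S T : X →L[ℂ] X}
    (h : cauchyIntegral A (Real.pi / 2) rho * S = cauchyIntegral A (Real.pi / 2) rho * T) :
    S = T := by
  ext x
  rw [← sub_eq_zero]
  refine cauchyIntegral_rho_injective hA ?_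
  rw [map_sub, sub_eq_zero]
  exact DFunLike.congr_fun h x

/-- A bounded Sobolev calculus bounds `ρ(A) A^{2πiξ}` polynomially. -/
theorem exists_bound_regImagPow (hA : IsZeroSectorial A) {β : ℝ} (hβ : 0 ≤ β)
    (hcalc : HasSobolevCalculus A β) :
    ∃ C : ℝ, 0 ≤ C ∧ ∀ ξ : ℝ, ‖regImagPow A (2 * Real.pi * ξ)‖ ≤ C * (1 + |ξ|) ^ β := by
  obtain ⟨C, hC⟩ := hcalc
  refine ⟨|C| * (sobolevNorm β rhoExp).toReal, by positivity, fun ξ => ?_⟩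
  have hin := (decaysOnSectors_rho_mul_cpow (2 * Real.pi * ξ)).inHInf
  have hfun : (fun u : ℝ => (fun s : ℝ => (fun z : ℂ => rho z *
      z ^ (Complex.I * ((2 * Real.pi * ξ : ℝ) : ℂ))) (s : ℂ)) (Real.exp u)) =
      modulate ξ rhoExp := by
    ext u
    rw [modulate_apply, rhoExp_apply, mul_comm (Complex.exp _)]
    change rho (Real.exp u) * _ = _
    congr 1
    rw [Complex.ofReal_exp, exp_cpow (by simpa using Real.pi_pos)]
    congr 1; push_cast; ring
  have hnorm : expSobolevNorm β (fun s : ℝ => (fun z : ℂ => rho z *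
      z ^ (Complex.I * ((2 * Real.pi * ξ : ℝ) : ℂ))) (s : ℂ)) = sobolevNorm β (modulate ξ rhoExp) := by
    rw [expSobolevNorm, hfun]
  obtain ⟨T, hT, hTb⟩ := hC _ hin (by rw [hnorm]; exact sobolevNorm_schwartz_lt_top _ _)
  have hTe : T = regImagPow A (2 * Real.pi * ξ) := by
    refine rho_mul_cancel hA ?_
    rw [hT.rho_mul hA, regImagPow,
      cauchyIntegral_mul hA decaysOnSectors_rho (decaysOnSectors_rho_mul_cpow _)]
  rw [← hTe]
  rw [hnorm] at hTb
  have h1 : (sobolevNorm β (modulate ξ rhoExp)).toReal ≤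
      (1 + |ξ|) ^ β * (sobolevNorm β rhoExp).toReal := by
    have h2 := ENNReal.toReal_mono (ENNReal.mul_ne_top ENNReal.ofReal_ne_top
      (sobolevNorm_schwartz_lt_top β rhoExp).ne) (sobolevNorm_modulate_le hβ ξ rhoExp)
    rwa [ENNReal.toReal_mul, ENNReal.toReal_ofReal (by positivity)] at h2
  calc ‖T‖ ≤ C * (sobolevNorm β (modulate ξ rhoExp)).toReal := hTb
    _ ≤ |C| * ((1 + |ξ|) ^ β * (sobolevNorm β rhoExp).toReal) :=
        mul_le_mul (le_abs_self C) h1 ENNReal.toReal_nonneg (abs_nonneg C)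
    _ = _ := by ring

end ImagPow

/-! ### Dominated convergence in `L²` and the Sobolev norm -/

section Norms

/-- Dominated convergence in `L²`. -/
theorem tendsto_eLpNorm_two_of_dominated {α ι : Type*} [MeasurableSpace α] {μ : Measure α}
    {l : Filter ι} [l.IsCountablyGenerated] {f : ι → α → ℂ} {g : α → ℂ}
    (hf : ∀ᶠ n in l, AEStronglyMeasurable (f n) μ) (hg : MemLp g 2 μ)
    (hb : ∀ᶠ n in l, ∀ᵐ x ∂μ, ‖f n x‖ ≤ ‖g x‖)
    (hlim : ∀ᵐ x ∂μ, Tendsto (fun n => f n x) l (𝓝 0)) :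
    Tendsto (fun n => eLpNorm (f n) 2 μ) l (𝓝 0) := by
  have h2 : ∀ h : α → ℂ, eLpNorm h 2 μ = (∫⁻ x, ‖h x‖ₑ ^ (2 : ℝ) ∂μ) ^ (1 / 2 : ℝ) := fun h => by
    rw [eLpNorm_eq_lintegral_rpow_enorm_toReal two_ne_zero ENNReal.ofNat_ne_top]
    simp
  have key : Tendsto (fun n => ∫⁻ x, ‖f n x‖ₑ ^ (2 : ℝ) ∂μ) l (𝓝 (∫⁻ _, 0 ∂μ)) := by
    refine tendsto_lintegral_filter_of_dominated_convergence' (fun x => ‖g x‖ₑ ^ (2 : ℝ)) ?_ ?_ ?_ ?_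
    · filter_upwards [hf] with n hn
      exact hn.enorm.pow_const _
    · filter_upwards [hb] with n hn
      filter_upwards [hn] with x hx
      gcongr
      exact enorm_le_iff_norm_le.2 hx
    · have h3 := hg.2
      rw [h2] at h3
      exact (ENNReal.rpow_lt_top_iff_of_pos (by norm_num)).1 h3 |>.ne
    · filter_upwards [hlim] with x hx
      have h3 := (ENNReal.continuous_rpow_const (y := (2 : ℝ))).continuousAt.tendsto.comp hx.enorm
      simpa [Function.comp_def] using h3
  simp_rw [h2]
  rw [lintegral_zero] at key
  have h3 := (ENNReal.continuous_rpow_const (y := (1 / 2 : ℝ))).continuousAt.tendsto.comp key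
  simpa [Function.comp_def] using h3

theorem sobolevNorm_add_le (β : ℝ) (f g : ℝ → ℂ) :
    sobolevNorm β (fun u => f u + g u) ≤ sobolevNorm β f + sobolevNorm β g := by
  by_cases hf : MemLp f 2 volume
  swap
  · simp [sobolevNorm, hf]
  by_cases hg : MemLp g 2 volume
  swap
  · simp [sobolevNorm, hg]
  have hfg : MemLp (fun u => f u + g u) 2 volume := hf.add hg
  rw [sobolevNorm, sobolevNorm, sobolevNorm, dif_pos hf, dif_pos hg, dif_pos hfg]
  have hw : Continuous fun t : ℝ => (((1 + |t|) ^ β : ℝ) : ℂ) :=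
    Complex.continuous_ofReal.comp (continuous_weight β)
  have h1 : hfg.toLp _ = hf.toLp f + hg.toLp g := MemLp.toLp_add hf hg
  rw [h1, FourierTransform.fourier_add]
  refine le_trans (le_of_eq (eLpNorm_congr_ae ?_)) (eLpNorm_add_le
    (hw.aestronglyMeasurable.mul (Lp.aestronglyMeasurable _))
    (hw.aestronglyMeasurable.mul (Lp.aestronglyMeasurable _)) one_le_two)
  filter_upwards [Lp.coeFn_add (FourierTransform.fourier (hf.toLp f) : Lp ℂ 2 (volume : Measure ℝ))
    (FourierTransform.fourier (hg.toLp g))] with t ht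
  rw [ht]
  simp [mul_add]

theorem sobolevNorm_neg (β : ℝ) (f : ℝ → ℂ) :
    sobolevNorm β (fun u => -f u) = sobolevNorm β f := by
  by_cases hf : MemLp f 2 volume
  swap
  · have hf' : ¬ MemLp (fun u => -f u) 2 volume := fun h => hf (by
      simpa [Pi.neg_def] using h.neg)
    simp [sobolevNorm, hf, hf']
  have hf' : MemLp (fun u => -f u) 2 volume := hf.neg
  rw [sobolevNorm, sobolevNorm, dif_pos hf, dif_pos hf']
  have h1 : hf'.toLp _ = -hf.toLp f := MemLp.toLp_neg hf
  rw [h1, FourierTransform.fourier_neg]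
  refine eLpNorm_congr_norm_ae ?_
  filter_upwards [Lp.coeFn_neg
    (FourierTransform.fourier (hf.toLp f) : Lp ℂ 2 (volume : Measure ℝ))] with t ht
  rw [ht]
  simp

theorem sobolevNorm_sub_le (β : ℝ) (f g h : ℝ → ℂ) :
    sobolevNorm β (fun u => f u - g u) ≤
      sobolevNorm β (fun u => f u - h u) + sobolevNorm β (fun u => g u - h u) := by
  have h1 := sobolevNorm_add_le β (fun u => f u - h u) (fun u => -(g u - h u))
  rw [sobolevNorm_neg] at h1
  refine le_trans (le_of_eq ?_) h1
  congr 1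
  ext u
  ring

end Norms

/-! ### Band-limited functions -/

section Cutoff

/-- A smooth bump function on `ℝ`, equal to `1` on `[-1, 1]` and supported in `[-2, 2]`. -/
noncomputable def bump : ContDiffBump (0 : ℝ) := ⟨1, 2, one_pos, one_lt_two⟩

theorem contDiff_bump_div (c : ℝ) :
    ContDiff ℝ ((⊤ : ℕ∞) : WithTop ℕ∞) fun ξ : ℝ => ((bump (ξ / c) : ℝ) : ℂ) :=
  Complex.ofRealCLM.contDiff.comp (bump.contDiff.comp (contDiff_id.div_const c))

theorem bump_div_eq_zero {c ξ : ℝ} (hc : 0 < c) (h : 2 * c ≤ |ξ|) : bump (ξ / c) = 0 := by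
  refine bump.zero_of_le_dist ?_
  rw [dist_zero_right, norm_div, Real.norm_eq_abs, Real.norm_of_nonneg hc.le, le_div_iff₀ hc]
  exact h

theorem bump_div_eq_one {c ξ : ℝ} (hc : 0 < c) (h : |ξ| ≤ c) : bump (ξ / c) = 1 := by
  refine bump.one_of_mem_closedBall ?_
  rw [Metric.mem_closedBall, dist_zero_right, norm_div, Real.norm_eq_abs,
    Real.norm_of_nonneg hc.le, div_le_iff₀ hc]
  simpa [bump] using h

theorem fourier_sub (F G : 𝓢(ℝ, ℂ)) : 𝓕 (F - G) = 𝓕 F - 𝓕 G := by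
  rw [sub_eq_add_neg, FourierTransform.fourier_add, FourierTransform.fourier_neg, sub_eq_add_neg]

/-- The smooth truncation of a Schwartz function to `[-2(k+1), 2(k+1)]`. -/
noncomputable def cutoff (k : ℕ) (F : 𝓢(ℝ, ℂ)) : 𝓢(ℝ, ℂ) :=
  HasCompactSupport.toSchwartzMap (f := fun ξ : ℝ => ((bump (ξ / (k + 1)) : ℝ) : ℂ) * F ξ)
    (HasCompactSupport.intro (isCompact_Icc (a := -(2 * ((k : ℝ) + 1))) (b := 2 * ((k : ℝ) + 1)))
      fun ξ hξ => by
        rw [bump_div_eq_zero (by positivity) ?_]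
        · simp
        · by_contra! h
          exact hξ ⟨by linarith [abs_lt.1 h], by linarith [abs_lt.1 h]⟩)
    ((contDiff_bump_div _).mul (F.smooth ⊤))

theorem cutoff_apply (k : ℕ) (F : 𝓢(ℝ, ℂ)) (ξ : ℝ) :
    cutoff k F ξ = ((bump (ξ / (k + 1)) : ℝ) : ℂ) * F ξ := rfl

theorem cutoff_eq_zero {k : ℕ} (F : 𝓢(ℝ, ℂ)) {ξ : ℝ} (h : 2 * ((k : ℝ) + 1) ≤ |ξ|) :
    cutoff k F ξ = 0 := by
  rw [cutoff_apply, bump_div_eq_zero (by positivity) h]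
  simp

theorem norm_cutoff_le (k : ℕ) (F : 𝓢(ℝ, ℂ)) (ξ : ℝ) : ‖cutoff k F ξ‖ ≤ ‖F ξ‖ := by
  rw [cutoff_apply, norm_mul, Complex.norm_real, Real.norm_of_nonneg bump.nonneg]
  exact mul_le_of_le_one_left (norm_nonneg _) bump.le_one

theorem norm_cutoff_sub_le (k : ℕ) (F : 𝓢(ℝ, ℂ)) (ξ : ℝ) : ‖cutoff k F ξ - F ξ‖ ≤ ‖F ξ‖ := by
  have h : cutoff k F ξ - F ξ = -((((1 - bump (ξ / (k + 1)) : ℝ)) : ℂ) * F ξ) := by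
    rw [cutoff_apply]; push_cast; ring
  rw [h, norm_neg, norm_mul, Complex.norm_real,
    Real.norm_of_nonneg (sub_nonneg.2 bump.le_one)]
  exact mul_le_of_le_one_left (norm_nonneg _) (by linarith [bump.nonneg (x := ξ / (k + 1))])

theorem eventually_cutoff_eq (F : 𝓢(ℝ, ℂ)) (ξ : ℝ) : ∀ᶠ k in atTop, cutoff k F ξ = F ξ := by
  obtain ⟨n, hn⟩ := exists_nat_ge |ξ|
  filter_upwards [eventually_ge_atTop n] with k hk
  rw [cutoff_apply, bump_div_eq_one (by positivity)]
  · simp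
  · have : (n : ℝ) ≤ k := by exact_mod_cast hk
    linarith

/-- The truncation of the frequencies of a Schwartz function to a bounded interval. -/
noncomputable def bandLimit (k : ℕ) (F : 𝓢(ℝ, ℂ)) : 𝓢(ℝ, ℂ) := 𝓕⁻ (cutoff k (𝓕 F))

theorem fourier_bandLimit (k : ℕ) (F : 𝓢(ℝ, ℂ)) : 𝓕 (bandLimit k F) = cutoff k (𝓕 F) :=
  FourierTransform.fourier_fourierInv_eq _

theorem tendsto_sobolevNorm_bandLimit (β : ℝ) (F : 𝓢(ℝ, ℂ)) :
    Tendsto (fun k => sobolevNorm β (bandLimit k F - F : 𝓢(ℝ, ℂ))) atTop (𝓝 0) := by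
  simp_rw [sobolevNorm_schwartz]
  refine tendsto_eLpNorm_two_of_dominated (Eventually.of_forall fun k =>
    (memLp_weight_mul_schwartz _ β).1) (memLp_weight_mul_schwartz (𝓕 F) β)
    (Eventually.of_forall fun k => ae_of_all _ fun t => ?_) (ae_of_all _ fun t => ?_)
  · rw [fourier_sub, fourier_bandLimit, norm_mul, norm_mul]
    gcongr
    exact norm_cutoff_sub_le k (𝓕 F) t
  · refine tendsto_const_nhds.congr' ?_
    filter_upwards [eventually_cutoff_eq (𝓕 F) t] with k hk
    rw [fourier_sub, fourier_bandLimit, sub_apply, hk]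
    simp

/-- The frequencies of `P` lie in a bounded interval. -/
def BandLimited (P : 𝓢(ℝ, ℂ)) : Prop := ∃ R : ℝ, 0 < R ∧ ∀ ξ : ℝ, R ≤ |ξ| → 𝓕 P ξ = 0

theorem bandLimited_bandLimit (k : ℕ) (F : 𝓢(ℝ, ℂ)) : BandLimited (bandLimit k F) :=
  ⟨2 * ((k : ℝ) + 1), by positivity, fun ξ hξ => by
    rw [fourier_bandLimit]; exact cutoff_eq_zero _ hξ⟩

theorem BandLimited.sub {P Q : 𝓢(ℝ, ℂ)} (hP : BandLimited P) (hQ : BandLimited Q) :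
    BandLimited (P - Q) := by
  obtain ⟨R, hR, h⟩ := hP
  obtain ⟨S, hS, h'⟩ := hQ
  refine ⟨max R S, lt_max_of_lt_left hR, fun ξ hξ => ?_⟩
  rw [fourier_sub, sub_apply, h ξ ((le_max_left _ _).trans hξ),
    h' ξ ((le_max_right _ _).trans hξ), sub_zero]

/-- The entire extension of a band-limited function. -/
noncomputable def entireExt (P : 𝓢(ℝ, ℂ)) (w : ℂ) : ℂ :=
  ∫ ξ : ℝ, Complex.exp (2 * Real.pi * ξ * w * Complex.I) * 𝓕 P ξ

theorem entireExt_ofReal (P : 𝓢(ℝ, ℂ)) (u : ℝ) : entireExt P u = P u :=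
  (schwartz_inversion P u).symm

theorem norm_exp_mul_fourier_le {P : 𝓢(ℝ, ℂ)} {R b : ℝ} (h : ∀ ξ : ℝ, R ≤ |ξ| → 𝓕 P ξ = 0)
    {w : ℂ} (hw : |w.im| ≤ b) (ξ : ℝ) :
    ‖Complex.exp (2 * Real.pi * ξ * w * Complex.I) * 𝓕 P ξ‖ ≤
      Real.exp (2 * Real.pi * R * b) * ‖𝓕 P ξ‖ := by
  rcases le_or_gt R |ξ| with hξ | hξ
  · simp [h ξ hξ]
  rw [norm_mul, Complex.norm_exp]
  gcongr
  have h1 : (2 * Real.pi * ξ * w * Complex.I : ℂ).re = 2 * Real.pi * -(ξ * w.im) := by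
    simp [Complex.mul_re, Complex.mul_im]; ring
  rw [h1, mul_assoc (2 * Real.pi)]
  have hb : 0 ≤ b := (abs_nonneg _).trans hw
  have h2 : -(ξ * w.im) ≤ R * b := by
    refine (neg_le_abs _).trans ?_
    rw [abs_mul]
    exact mul_le_mul hξ.le hw (abs_nonneg _) ((abs_nonneg _).trans hξ.le)
  exact mul_le_mul_of_nonneg_left h2 Real.two_pi_pos.le

theorem continuous_exp_mul_fourier (P : 𝓢(ℝ, ℂ)) (w : ℂ) :
    Continuous fun ξ : ℝ => Complex.exp (2 * Real.pi * ξ * w * Complex.I) * 𝓕 P ξ :=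
  Continuous.mul (by fun_prop) (𝓕 P).continuous

theorem BandLimited.exists_norm_entireExt_le {P : 𝓢(ℝ, ℂ)} (hP : BandLimited P) (b : ℝ) :
    ∃ C : ℝ, ∀ w : ℂ, |w.im| ≤ b → ‖entireExt P w‖ ≤ C := by
  obtain ⟨R, hR, h⟩ := hP
  exact ⟨∫ ξ : ℝ, Real.exp (2 * Real.pi * R * b) * ‖𝓕 P ξ‖, fun w hw =>
    norm_integral_le_of_norm_le ((𝓕 P).integrable.norm.const_mul _)
      (ae_of_all _ fun ξ => norm_exp_mul_fourier_le h hw ξ)⟩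

theorem BandLimited.differentiable_entireExt {P : 𝓢(ℝ, ℂ)} (hP : BandLimited P) :
    Differentiable ℂ (entireExt P) := by
  obtain ⟨R, hR, h⟩ := hP
  intro w₀
  have hball : ∀ w ∈ Metric.ball w₀ 1, |w.im| ≤ |w₀.im| + 1 := fun w hw => by
    have h1 : |w.im - w₀.im| ≤ ‖w - w₀‖ := by simpa using Complex.abs_im_le_norm (w - w₀)
    have h2 : ‖w - w₀‖ < 1 := by simpa [dist_eq_norm] using hw
    linarith [abs_sub_abs_le_abs_sub w.im w₀.im]
  refine (hasDerivAt_integral_of_dominated_loc_of_deriv_le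
    (F := fun (w : ℂ) (ξ : ℝ) => Complex.exp (2 * Real.pi * ξ * w * Complex.I) * 𝓕 P ξ)
    (F' := fun (w : ℂ) (ξ : ℝ) => (2 * Real.pi * ξ * Complex.I) *
      (Complex.exp (2 * Real.pi * ξ * w * Complex.I) * 𝓕 P ξ))
    (bound := fun ξ => (2 * Real.pi * R) *
      (Real.exp (2 * Real.pi * R * (|w₀.im| + 1)) * ‖𝓕 P ξ‖))
    (Metric.ball_mem_nhds w₀ one_pos)
    (Eventually.of_forall fun w => (continuous_exp_mul_fourier P w).aestronglyMeasurable)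
    ?_ ?_ (ae_of_all _ fun ξ w hw => ?_) (((𝓕 P).integrable.norm.const_mul _).const_mul _)
    (ae_of_all _ fun ξ w _ => ?_)).2.differentiableAt
  · exact ((𝓕 P).integrable.norm.const_mul _).mono'
      (continuous_exp_mul_fourier P w₀).aestronglyMeasurable
      (ae_of_all _ fun ξ => norm_exp_mul_fourier_le h (le_refl _) ξ)
  · exact (Continuous.mul (by fun_prop) (continuous_exp_mul_fourier P w₀)).aestronglyMeasurable
  · rw [norm_mul]
    rcases le_or_gt R |ξ| with hξ | hξ
    · simp [h ξ hξ]
    · refine mul_le_mul ?_ (norm_exp_mul_fourier_le h (hball w hw) ξ) (norm_nonneg _) (by positivity)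
      simp only [norm_mul, Complex.norm_real, Complex.norm_I, mul_one, Complex.norm_ofNat,
        Real.norm_eq_abs, abs_of_pos Real.pi_pos]
      exact mul_le_mul_of_nonneg_left hξ.le Real.two_pi_pos.le
  · have h1 : HasDerivAt (fun w : ℂ => 2 * Real.pi * ξ * w * Complex.I)
        (2 * Real.pi * ξ * Complex.I) w := by
      convert! ((hasDerivAt_id w).const_mul (2 * Real.pi * ξ : ℂ)).mul_const Complex.I using 1
      ring
    convert! (h1.cexp).mul_const (𝓕 P ξ) using 1
    ring

/-- The holomorphic extension `z ↦ P(log z)` of `P ∘ log` for band-limited `P`. -/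
noncomputable def holExt (P : 𝓢(ℝ, ℂ)) (z : ℂ) : ℂ := entireExt P (Complex.log z)

theorem holExt_exp (P : 𝓢(ℝ, ℂ)) {u : ℂ} (hu : |u.im| < Real.pi) :
    holExt P (Complex.exp u) = entireExt P u := by
  rw [holExt, Complex.log_exp] <;> linarith [abs_lt.1 hu]

theorem holExt_exp_ofReal (P : 𝓢(ℝ, ℂ)) (u : ℝ) : holExt P (Real.exp u : ℝ) = P u := by
  rw [Complex.ofReal_exp, holExt_exp P (by simpa using Real.pi_pos), entireExt_ofReal]

theorem BandLimited.inHInf {P : 𝓢(ℝ, ℂ)} (hP : BandLimited P) : InHInf (holExt P) := by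
  constructor
  · intro z hz
    exact ((hP.differentiable_entireExt _).comp z
      (Complex.differentiableAt_log hz)).differentiableWithinAt
  · intro ω _
    obtain ⟨C, hC⟩ := hP.exists_norm_entireExt_le Real.pi
    exact ⟨C, fun z _ => hC _ (by rw [Complex.log_im]; exact Complex.abs_arg_le_pi z)⟩

theorem expSobolevNorm_holExt (β : ℝ) (P : 𝓢(ℝ, ℂ)) :
    expSobolevNorm β (fun s => holExt P s) = sobolevNorm β P := by
  rw [expSobolevNorm]
  congr 1
  ext u
  exact holExt_exp_ofReal P u

end Cutoff

/-! ### The Sobolev calculus on Schwartz functions -/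

section SchwartzCalc

variable {X : Type*} [NormedAddCommGroup X] [NormedSpace ℂ X] {A : X →ₗ.[ℂ] X}

theorem integrable_schwartz_smul {E : Type*} [NormedAddCommGroup E] [NormedSpace ℂ E] (F : 𝓢(ℝ, ℂ))
    {W : ℝ → E} (hW : Continuous W) {C K : ℝ} (hb : ∀ ξ, ‖W ξ‖ ≤ C * (1 + |ξ|) ^ K) :
    Integrable fun ξ => F ξ • W ξ := by
  refine ((integrable_schwartz_weight F K).const_mul C).mono'
    (F.continuous.smul hW).aestronglyMeasurable (ae_of_all _ fun ξ => ?_)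
  rw [norm_smul]
  calc ‖F ξ‖ * ‖W ξ‖ ≤ ‖F ξ‖ * (C * (1 + |ξ|) ^ K) := by gcongr; exact hb ξ
    _ = _ := by ring

/-- The operator `(ρ f)(A)` for `f ∘ exp = F`, as a superposition of imaginary powers by Fourier
inversion. -/
noncomputable def fourierCalc (A : X →ₗ.[ℂ] X) (F : 𝓢(ℝ, ℂ)) : X →L[ℂ] X :=
  ∫ ξ : ℝ, 𝓕 F ξ • regImagPow A (2 * Real.pi * ξ)

/-- Fubini's theorem for the Fourier representation of a band-limited function on a contour ray. -/
theorem rayIntegral_rho_mul_holExt (hA : IsZeroSectorial A) {P : 𝓢(ℝ, ℂ)} (hP : BandLimited P)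
    {s : ℝ} (hs : s = 1 ∨ s = -1) [CompleteSpace X] :
    Integrable (fun ξ : ℝ => 𝓕 P ξ • rayIntegral A (Real.pi / 2)
      (fun z => rho z * z ^ (Complex.I * ((2 * Real.pi * ξ : ℝ) : ℂ))) s) ∧
    rayIntegral A (Real.pi / 2) (fun z => rho z * holExt P z) s =
      ∫ ξ : ℝ, 𝓕 P ξ • rayIntegral A (Real.pi / 2)
        (fun z => rho z * z ^ (Complex.I * ((2 * Real.pi * ξ : ℝ) : ℂ))) s := by
  have hpi := Real.pi_pos
  obtain ⟨C, hC0, hC⟩ := exists_bound_logResolvent hA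
  obtain ⟨R, hR, hPR⟩ := hP
  have h3 : |s * (Real.pi - Real.pi / 2)| < 3 * Real.pi / 4 := by
    rw [abs_sign_mul hs, abs_of_pos (by linarith)]; linarith
  have h4 : |(-(s * (Real.pi / 2)))| < Real.pi := by
    rw [abs_neg, abs_sign_mul hs, abs_of_pos (by linarith)]; linarith
  have hr := decaysOnSectors_rho.integrable_line h4
  set u : ℝ → ℂ := fun x => x + (-(s * (Real.pi / 2)) : ℝ) * Complex.I with hu
  set Q : ℝ → X →L[ℂ] X := fun x => logResolvent A (x + (s * (Real.pi - Real.pi / 2) : ℝ) * Complex.I)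
    with hQ
  have huim : ∀ x, (u x).im = -(s * (Real.pi / 2)) := fun x => by simp [hu]
  have huim' : ∀ x, |(u x).im| < Real.pi := fun x => by rw [huim]; exact h4
  have hucont : Continuous u := by fun_prop
  have hQcont : Continuous Q := continuous_logResolvent_line hA h3
  let K : ℝ → ℝ → X →L[ℂ] X := fun x ξ => (rho (Complex.exp (u x)) *
    (Complex.exp (2 * Real.pi * ξ * u x * Complex.I) * 𝓕 P ξ)) • Q x
  have hK : Integrable (fun p : ℝ × ℝ => K p.1 p.2) (volume.prod volume) := by
    refine ((hr.norm.mul_const C).mul_prod ((𝓕 P).integrable.norm.const_mul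
      (Real.exp (2 * Real.pi * R * Real.pi)))).mono' ?_ (ae_of_all _ fun p => ?_)
    · refine AEStronglyMeasurable.smul (hr.aestronglyMeasurable.comp_fst.mul
        (Continuous.aestronglyMeasurable ?_)) (hQcont.comp continuous_fst).aestronglyMeasurable
      exact Continuous.mul (by fun_prop) ((𝓕 P).continuous.comp continuous_snd)
    · change ‖(_ * _) • _‖ ≤ _
      rw [norm_smul, norm_mul]
      have h5 := norm_exp_mul_fourier_le hPR (huim' p.1).le p.2
      have h6 : ‖Q p.1‖ ≤ C := hC _ (by simpa using h3)
      calc _ ≤ ‖rho (Complex.exp (u p.1))‖ *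
            (Real.exp (2 * Real.pi * R * Real.pi) * ‖𝓕 P p.2‖) * C := by gcongr
        _ = _ := by ring
  have hK2 : ∀ ξ, ∫ x, K x ξ = 𝓕 P ξ • rayIntegral A (Real.pi / 2)
      (fun z => rho z * z ^ (Complex.I * ((2 * Real.pi * ξ : ℝ) : ℂ))) s := by
    intro ξ
    rw [rayIntegral, ← integral_smul]
    congr 1
    ext1 x
    rw [smul_smul]
    change (_ * _) • Q x = (_ * (_ * _)) • Q x
    congr 1
    change _ = 𝓕 P ξ * (rho (Complex.exp (u x)) * Complex.exp (u x) ^ _)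
    have he : u x * (Complex.I * ((2 * Real.pi * ξ : ℝ) : ℂ)) =
        2 * Real.pi * ξ * u x * Complex.I := by push_cast; ring
    rw [exp_cpow (huim' x), he]
    ring
  have hK1 : ∀ x, ∫ ξ, K x ξ = (rho (Complex.exp (u x)) * holExt P (Complex.exp (u x))) • Q x := by
    intro x
    rw [holExt_exp P (huim' x), entireExt, ← integral_const_mul]
    exact integral_smul_const (fun ξ : ℝ => rho (Complex.exp (u x)) *
      (Complex.exp (2 * Real.pi * ξ * u x * Complex.I) * 𝓕 P ξ)) (Q x)
  constructor
  · simp_rw [← hK2]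
    exact hK.integral_prod_right
  · simp_rw [← hK2]
    rw [← integral_integral_swap hK]
    simp_rw [hK1]
    rfl

theorem cauchyIntegral_rho_mul_holExt (hA : IsZeroSectorial A) {P : 𝓢(ℝ, ℂ)} (hP : BandLimited P)
    [CompleteSpace X] :
    cauchyIntegral A (Real.pi / 2) (fun z => rho z * holExt P z) = fourierCalc A P := by
  obtain ⟨hi1, he1⟩ := rayIntegral_rho_mul_holExt hA hP (s := 1) (Or.inl rfl)
  obtain ⟨hi2, he2⟩ := rayIntegral_rho_mul_holExt hA hP (s := -1) (Or.inr rfl)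
  rw [cauchyIntegral_eq, he1, he2, ← integral_sub hi1 hi2, ← integral_smul, fourierCalc]
  congr 1
  ext1 ξ
  rw [regImagPow, cauchyIntegral_eq, ← smul_sub, smul_comm]

theorem DecaysOnSectors.cauchyIntegral_sub (hA : IsZeroSectorial A) {f g : ℂ → ℂ}
    (hf : DecaysOnSectors f) (hg : DecaysOnSectors g) :
    cauchyIntegral A (Real.pi / 2) (fun z => f z - g z) =
      cauchyIntegral A (Real.pi / 2) f - cauchyIntegral A (Real.pi / 2) g := by
  have hpi := Real.pi_pos
  have key : ∀ s : ℝ, (s = 1 ∨ s = -1) → rayIntegral A (Real.pi / 2) (fun z => f z - g z) s =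
      rayIntegral A (Real.pi / 2) f s - rayIntegral A (Real.pi / 2) g s := fun s hs => by
    have h1 : |Real.pi / 2| < Real.pi := by rw [abs_of_pos (by linarith)]; linarith
    have h2 : |Real.pi - Real.pi / 2| < 3 * Real.pi / 4 := by
      rw [abs_of_pos (by linarith)]; linarith
    rw [rayIntegral, rayIntegral, rayIntegral, ← integral_sub
      (integrable_rayIntegral hA hf hs h1 h2) (integrable_rayIntegral hA hg hs h1 h2)]
    simp_rw [sub_smul]
  rw [cauchyIntegral_eq, cauchyIntegral_eq, cauchyIntegral_eq, key 1 (Or.inl rfl),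
    key (-1) (Or.inr rfl)]
  module

theorem InHInf.sub {f g : ℂ → ℂ} (hf : InHInf f) (hg : InHInf g) : InHInf fun z => f z - g z := by
  refine ⟨hf.1.sub hg.1, fun ω hω => ?_⟩
  obtain ⟨C, hC⟩ := hf.2 ω hω
  obtain ⟨D, hD⟩ := hg.2 ω hω
  exact ⟨C + D, fun z hz => (norm_sub_le _ _).trans (add_le_add (hC z hz) (hD z hz))⟩

variable {β : ℝ}

theorem integrable_fourierCalc (hA : IsZeroSectorial A) (hβ : 0 ≤ β) (hcalc : HasSobolevCalculus A β)
    (F : 𝓢(ℝ, ℂ)) [CompleteSpace X] :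
    Integrable fun ξ : ℝ => 𝓕 F ξ • regImagPow A (2 * Real.pi * ξ) := by
  obtain ⟨C, -, hC⟩ := exists_bound_regImagPow hA hβ hcalc
  exact integrable_schwartz_smul (𝓕 F) ((continuous_regImagPow hA).comp (by fun_prop)) hC

variable [CompleteSpace X]

theorem fourierCalc_add (hA : IsZeroSectorial A) (hβ : 0 ≤ β) (hcalc : HasSobolevCalculus A β)
    (F G : 𝓢(ℝ, ℂ)) : fourierCalc A (F + G) = fourierCalc A F + fourierCalc A G := by
  rw [fourierCalc, fourierCalc, fourierCalc, ← integral_add (integrable_fourierCalc hA hβ hcalc F)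
    (integrable_fourierCalc hA hβ hcalc G), FourierTransform.fourier_add]
  simp_rw [add_apply, add_smul]

theorem fourierCalc_sub (hA : IsZeroSectorial A) (hβ : 0 ≤ β) (hcalc : HasSobolevCalculus A β)
    (F G : 𝓢(ℝ, ℂ)) : fourierCalc A (F - G) = fourierCalc A F - fourierCalc A G := by
  rw [fourierCalc, fourierCalc, fourierCalc, ← integral_sub (integrable_fourierCalc hA hβ hcalc F)
    (integrable_fourierCalc hA hβ hcalc G), fourier_sub]
  simp_rw [sub_apply, sub_smul]

theorem tendsto_fourierCalc_bandLimit (hA : IsZeroSectorial A) (hβ : 0 ≤ β)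
    (hcalc : HasSobolevCalculus A β) (F : 𝓢(ℝ, ℂ)) :
    Tendsto (fun k => fourierCalc A (bandLimit k F)) atTop (𝓝 (fourierCalc A F)) := by
  unfold fourierCalc
  refine tendsto_integral_of_dominated_convergence
    (fun ξ => ‖𝓕 F ξ • regImagPow A (2 * Real.pi * ξ)‖)
    (fun k => (integrable_fourierCalc hA hβ hcalc _).aestronglyMeasurable)
    (integrable_fourierCalc hA hβ hcalc F).norm (fun k => ae_of_all _ fun ξ => ?_)
    (ae_of_all _ fun ξ => ?_)
  · rw [norm_smul, norm_smul, fourier_bandLimit]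
    gcongr
    exact norm_cutoff_le k _ ξ
  · refine tendsto_const_nhds.congr' ?_
    filter_upwards [eventually_cutoff_eq (𝓕 F) ξ] with k hk
    rw [fourier_bandLimit, hk]

theorem exists_holCalcEq_holExt (hA : IsZeroSectorial A) {C : ℝ}
    (hC : ∀ f : ℂ → ℂ, InHInf f → expSobolevNorm β (fun s => f s) < ⊤ →
      ∃ T : X →L[ℂ] X, HolCalcEq A f T ∧ ‖T‖ ≤ C * (expSobolevNorm β fun s => f s).toReal)
    {P : 𝓢(ℝ, ℂ)} (hP : BandLimited P) :
    ∃ T : X →L[ℂ] X, HolCalcEq A (holExt P) T ∧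
      cauchyIntegral A (Real.pi / 2) rho * T = fourierCalc A P ∧
      ‖T‖ ≤ |C| * (sobolevNorm β P).toReal := by
  obtain ⟨T, hT, hTb⟩ := hC (holExt P) hP.inHInf
    (by rw [expSobolevNorm_holExt]; exact sobolevNorm_schwartz_lt_top β P)
  rw [expSobolevNorm_holExt] at hTb
  exact ⟨T, hT, by rw [hT.rho_mul hA, cauchyIntegral_rho_mul_holExt hA hP],
    hTb.trans (mul_le_mul_of_nonneg_right (le_abs_self C) ENNReal.toReal_nonneg)⟩

/-- The Sobolev calculus at `f` with `f ∘ exp` a Schwartz function: existence of the value along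
band-limited approximations, and its identification. -/
theorem exists_isSobolevCalcValue (hA : IsZeroSectorial A) (hβ : 0 ≤ β)
    (hcalc : HasSobolevCalculus A β) {f : ℝ → ℂ} {F : 𝓢(ℝ, ℂ)}
    (hf : ∀ u : ℝ, f (Real.exp u) = F u) :
    ∃ T : X →L[ℂ] X, IsSobolevCalcValue A β f T ∧
      cauchyIntegral A (Real.pi / 2) rho * T = fourierCalc A F ∧
      ∀ T', IsSobolevCalcValue A β f T' → T' = T := by
  have hcalc' := hcalc
  obtain ⟨C, hC⟩ := hcalc
  choose S hS1 hS2 _ using fun k : ℕ =>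
    exists_holCalcEq_holExt hA hC (bandLimited_bandLimit k F)
  set a : ℕ → ℝ := fun k => (sobolevNorm β (bandLimit k F - F : 𝓢(ℝ, ℂ))).toReal with ha
  have ha0 : Tendsto a atTop (𝓝 0) := by
    exact (ENNReal.tendsto_toReal ENNReal.zero_ne_top).comp
      (tendsto_sobolevNorm_bandLimit β F)
  have hdiff : ∀ k l, ‖S k - S l‖ ≤ |C| * (a k + a l) := by
    intro k l
    obtain ⟨T, -, hT2, hT3⟩ := exists_holCalcEq_holExt hA hC
      ((bandLimited_bandLimit k F).sub (bandLimited_bandLimit l F))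
    have hTS : S k - S l = T := by
      refine rho_mul_cancel hA ?_
      rw [mul_sub, hS2, hS2, hT2, fourierCalc_sub hA hβ hcalc']
    rw [hTS]
    refine hT3.trans (mul_le_mul_of_nonneg_left ?_ (abs_nonneg C))
    rw [ha, ← ENNReal.toReal_add (sobolevNorm_schwartz_lt_top _ _).ne
      (sobolevNorm_schwartz_lt_top _ _).ne]
    refine ENNReal.toReal_mono (ENNReal.add_ne_top.2 ⟨(sobolevNorm_schwartz_lt_top _ _).ne,
      (sobolevNorm_schwartz_lt_top _ _).ne⟩) ?_
    exact sobolevNorm_sub_le β (bandLimit k F) (bandLimit l F) F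
  have hcauchy : CauchySeq S := by
    rw [Metric.cauchySeq_iff']
    intro ε hε
    have h1 : Tendsto (fun k => |C| * (a k + a k)) atTop (𝓝 0) := by
      simpa using (ha0.add ha0).const_mul |C|
    obtain ⟨N, hN⟩ := eventually_atTop.1 (h1.eventually_lt_const hε)
    refine ⟨N, fun n hn => ?_⟩
    rw [dist_eq_norm]
    have h2 := hN n hn
    have h3 := hN N le_rfl
    have h4 := hdiff n N
    nlinarith
  obtain ⟨T, hT⟩ := cauchySeq_tendsto_of_complete hcauchy
  refine ⟨T, ⟨fun k => holExt (bandLimit k F), S, fun k => ⟨(bandLimited_bandLimit k F).inHInf, ?_,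
    hS1 k⟩, ?_, hT⟩, ?_, ?_⟩
  · rw [expSobolevNorm_holExt]
    exact sobolevNorm_schwartz_lt_top β _
  · convert! tendsto_sobolevNorm_bandLimit β F using 2 with k
    rw [expSobolevNorm]
    congr 1
    ext u
    change holExt (bandLimit k F) (Real.exp u : ℝ) - _ = _
    rw [holExt_exp_ofReal, hf]
    rfl
  · refine tendsto_nhds_unique (((continuous_const_mul _).tendsto T).comp hT) ?_
    refine (tendsto_fourierCalc_bandLimit hA hβ hcalc' F).congr fun k => ?_
    exact (hS2 k).symm
  · rintro T' ⟨g, S', hg, hgf, hS'⟩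
    have hsub : ∀ k, expSobolevNorm β (fun s => g k s - holExt (bandLimit k F) s) ≤
        (expSobolevNorm β fun s => g k s - f s) +
          sobolevNorm β (bandLimit k F - F : 𝓢(ℝ, ℂ)) := by
      intro k
      refine (sobolevNorm_sub_le β _ _ fun u => f (Real.exp u)).trans (le_of_eq ?_)
      rw [expSobolevNorm]
      congr 2
      ext u
      rw [holExt_exp_ofReal, hf]
      rfl
    have hlim : Tendsto (fun k => (expSobolevNorm β fun s => g k s - f s) +
          sobolevNorm β (bandLimit k F - F : 𝓢(ℝ, ℂ))) atTop (𝓝 0) := by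
      simpa using hgf.add (tendsto_sobolevNorm_bandLimit β F)
    have hlim2 := tendsto_of_tendsto_of_tendsto_of_le_of_le tendsto_const_nhds hlim
      (fun _ => zero_le) hsub
    have hlim3 := (ENNReal.tendsto_toReal ENNReal.zero_ne_top).comp hlim2
    have hSS : Tendsto (fun k => S' k - S k) atTop (𝓝 0) := by
      refine squeeze_zero_norm' ?_ (by simpa using hlim3.const_mul C)
      filter_upwards [hlim2.eventually_lt_const ENNReal.zero_lt_top] with k hk
      have hin := (hg k).1.sub (bandLimited_bandLimit k F).inHInf
      obtain ⟨T₁, hT₁, hT₁b⟩ := hC _ hin hk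
      have : S' k - S k = T₁ := by
        refine rho_mul_cancel hA ?_
        rw [mul_sub, (hg k).2.2.rho_mul hA, (hS1 k).rho_mul hA, hT₁.rho_mul hA,
          ← (decaysOnSectors_rho.mul_inHInf (hg k).1).cauchyIntegral_sub hA
            (decaysOnSectors_rho.mul_inHInf (bandLimited_bandLimit k F).inHInf)]
        simp_rw [mul_sub]
      rw [this]
      exact hT₁b
    have := hSS.add hT
    simp only [sub_add_cancel, zero_add] at this
    exact tendsto_nhds_unique hS' this

theorem sobolevCalc_spec (hA : IsZeroSectorial A) (hβ : 0 ≤ β)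
    (hcalc : HasSobolevCalculus A β) {f : ℝ → ℂ} {F : 𝓢(ℝ, ℂ)}
    (hf : ∀ u : ℝ, f (Real.exp u) = F u) :
    cauchyIntegral A (Real.pi / 2) rho * sobolevCalc A β f = fourierCalc A F := by
  obtain ⟨T, hT, hTF, huniq⟩ := exists_isSobolevCalcValue hA hβ hcalc hf
  have h : ∃ T, IsSobolevCalcValue A β f T := ⟨T, hT⟩
  rw [sobolevCalc, dif_pos h, huniq _ h.choose_spec, hTF]

/-- The value of the Sobolev calculus at `F ∘ log`. -/
noncomputable def schwartzCalc (A : X →ₗ.[ℂ] X) (β : ℝ) (F : 𝓢(ℝ, ℂ)) : X →L[ℂ] X :=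
  sobolevCalc A β fun s => F (Real.log s)

theorem rho_mul_schwartzCalc (hA : IsZeroSectorial A) (hβ : 0 ≤ β)
    (hcalc : HasSobolevCalculus A β) (F : 𝓢(ℝ, ℂ)) :
    cauchyIntegral A (Real.pi / 2) rho * schwartzCalc A β F = fourierCalc A F :=
  sobolevCalc_spec hA hβ hcalc fun u => by rw [Real.log_exp]

theorem sobolevCalc_eq_schwartzCalc (hA : IsZeroSectorial A) (hβ : 0 ≤ β)
    (hcalc : HasSobolevCalculus A β) {f : ℝ → ℂ} {F : 𝓢(ℝ, ℂ)}
    (hf : ∀ u : ℝ, f (Real.exp u) = F u) : sobolevCalc A β f = schwartzCalc A β F :=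
  rho_mul_cancel hA (by rw [sobolevCalc_spec hA hβ hcalc hf, rho_mul_schwartzCalc hA hβ hcalc])

theorem schwartzCalc_add (hA : IsZeroSectorial A) (hβ : 0 ≤ β)
    (hcalc : HasSobolevCalculus A β) (F G : 𝓢(ℝ, ℂ)) :
    schwartzCalc A β (F + G) = schwartzCalc A β F + schwartzCalc A β G :=
  rho_mul_cancel hA (by
    rw [mul_add, rho_mul_schwartzCalc hA hβ hcalc, rho_mul_schwartzCalc hA hβ hcalc,
      rho_mul_schwartzCalc hA hβ hcalc, fourierCalc_add hA hβ hcalc])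

theorem schwartzCalc_zero (hA : IsZeroSectorial A) (hβ : 0 ≤ β)
    (hcalc : HasSobolevCalculus A β) : schwartzCalc A β 0 = 0 := by
  have := schwartzCalc_add hA hβ hcalc 0 0
  simpa using this

/-- The Fourier transform of a product is a convolution. -/
theorem fourier_mul_apply {F G H : 𝓢(ℝ, ℂ)} (h : ∀ u, H u = F u * G u) (ζ : ℝ) :
    𝓕 H ζ = ∫ η : ℝ, 𝓕 F (ζ - η) * 𝓕 G η := by
  have h1 : 𝓕 H ζ = ∫ u : ℝ, ∫ η : ℝ, (Complex.exp (-(2 * Real.pi * ζ * u * Complex.I)) * F u) *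
      (Complex.exp (2 * Real.pi * η * u * Complex.I) * 𝓕 G η) := by
    rw [SchwartzMap.fourier_coe, fourier_apply]
    congr 1
    ext1 u
    rw [h, schwartz_inversion G u, integral_const_mul]
    ring
  rw [h1, integral_integral_swap]
  · congr 1
    ext1 η
    rw [SchwartzMap.fourier_coe F, fourier_apply, ← integral_mul_const]
    congr 1
    ext1 u
    have : Complex.exp (-(2 * Real.pi * (ζ - η : ℝ) * u * Complex.I)) =
        Complex.exp (-(2 * Real.pi * ζ * u * Complex.I)) *
          Complex.exp (2 * Real.pi * η * u * Complex.I) := by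
      rw [← Complex.exp_add]; congr 1; push_cast; ring
    rw [this]
    ring
  · refine (F.integrable.norm.mul_prod (𝓕 G).integrable.norm).mono' ?_ (ae_of_all _ fun p => ?_)
    · refine Continuous.aestronglyMeasurable ?_
      exact Continuous.mul (Continuous.mul (by fun_prop) (F.continuous.comp continuous_fst))
        (Continuous.mul (by fun_prop) ((𝓕 G).continuous.comp continuous_snd))
    · simp only [Function.uncurry]
      rw [norm_mul, norm_mul, norm_mul, Complex.norm_exp, Complex.norm_exp]
      simp [Complex.mul_re, Complex.mul_im]

theorem fourierCalc_comm_rho (hA : IsZeroSectorial A) (hβ : 0 ≤ β)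
    (hcalc : HasSobolevCalculus A β) (F : 𝓢(ℝ, ℂ)) :
    fourierCalc A F * cauchyIntegral A (Real.pi / 2) rho =
      cauchyIntegral A (Real.pi / 2) rho * fourierCalc A F := by
  have hi := integrable_fourierCalc hA hβ hcalc F
  rw [fourierCalc, ← integral_const_mul_of_integrable hi, ← integral_mul_const_of_integrable hi]
  congr 1
  ext1 ξ
  rw [smul_mul_assoc, mul_smul_comm, regImagPow_comm hA]

/-- Multiplicativity of the Fourier calculus, from the group law of the imaginary powers and the
convolution formula. One factor `ρ(A)` is superfluous on the left and is kept on the right. -/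
theorem fourierCalc_mul (hA : IsZeroSectorial A) (hβ : 0 ≤ β)
    (hcalc : HasSobolevCalculus A β) {F G H : 𝓢(ℝ, ℂ)} (h : ∀ u, H u = F u * G u) :
    fourierCalc A F * fourierCalc A G =
      cauchyIntegral A (Real.pi / 2) rho * fourierCalc A H := by
  obtain ⟨C, hC0, hC⟩ := exists_bound_regImagPow hA hβ hcalc
  set W : ℝ → X →L[ℂ] X := fun ξ => regImagPow A (2 * Real.pi * ξ) with hW
  have hWc : Continuous W := (continuous_regImagPow hA).comp (by fun_prop)
  have hF := integrable_fourierCalc hA hβ hcalc F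
  have hG := integrable_fourierCalc hA hβ hcalc G
  have hH := integrable_fourierCalc hA hβ hcalc H
  have hWW : ∀ ξ η, W ξ * W η = cauchyIntegral A (Real.pi / 2) rho * W (ξ + η) := fun ξ η => by
    rw [hW]
    simp only
    rw [regImagPow_mul hA, mul_add]
  have hint : Integrable (fun p : ℝ × ℝ => (𝓕 F (p.1 - p.2) * 𝓕 G p.2) • W p.1)
      (volume.prod volume) := by
    have h1 := (integrable_schwartz_weight (𝓕 G) β).convolution_integrand
      (ContinuousLinearMap.mul ℝ ℝ) (integrable_schwartz_weight (𝓕 F) β)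
    refine (h1.const_mul C).mono' (Continuous.aestronglyMeasurable ?_) (ae_of_all _ fun p => ?_)
    · exact Continuous.smul (((𝓕 F).continuous.comp (continuous_fst.sub continuous_snd)).mul
        ((𝓕 G).continuous.comp continuous_snd)) (hWc.comp continuous_fst)
    · rw [norm_smul, norm_mul, ContinuousLinearMap.mul_apply']
      have h2 : ‖W p.1‖ ≤ C * ((1 + |p.2|) ^ β * (1 + |p.1 - p.2|) ^ β) :=
        (hC p.1).trans (mul_le_mul_of_nonneg_left (weight_le_mul hβ _ _) hC0)
      calc _ ≤ ‖𝓕 F (p.1 - p.2)‖ * ‖𝓕 G p.2‖ *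
            (C * ((1 + |p.2|) ^ β * (1 + |p.1 - p.2|) ^ β)) := by gcongr
        _ = _ := by ring
  have h1 : fourierCalc A H = ∫ η : ℝ, ∫ ζ : ℝ, (𝓕 F (ζ - η) * 𝓕 G η) • W ζ := by
    rw [← integral_integral_swap hint, fourierCalc]
    congr 1
    ext1 ζ
    rw [fourier_mul_apply h]
    exact (integral_smul_const (fun η => 𝓕 F (ζ - η) * 𝓕 G η) (W ζ)).symm
  have h2 : ∀ η : ℝ, ∫ ζ : ℝ, (𝓕 F (ζ - η) * 𝓕 G η) • W ζ =
      ∫ ξ : ℝ, (𝓕 F ξ * 𝓕 G η) • W (ξ + η) := fun η => by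
    rw [← integral_sub_right_eq_self (fun ξ : ℝ => (𝓕 F ξ * 𝓕 G η) • W (ξ + η)) η]
    simp
  have hint' : Integrable fun η : ℝ => ∫ ζ : ℝ, (𝓕 F (ζ - η) * 𝓕 G η) • W ζ :=
    hint.integral_prod_right
  rw [h1, ← integral_const_mul_of_integrable hint']
  conv_lhs => rw [fourierCalc, fourierCalc, ← integral_const_mul_of_integrable hG]
  congr 1
  ext1 η
  rw [← integral_mul_const_of_integrable hF, h2]
  have hi3 : Integrable fun ξ : ℝ => (𝓕 F ξ * 𝓕 G η) • W (ξ + η) := by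
    have : Integrable fun ξ : ℝ => 𝓕 F ξ • W (ξ + η) := by
      refine integrable_schwartz_smul (𝓕 F) (K := β) (C := C * (1 + |η|) ^ β)
        (hWc.comp (by fun_prop)) fun ξ => (hC _).trans ?_
      have := weight_le_mul hβ (ξ + η) η
      rw [add_sub_cancel_right] at this
      calc _ ≤ C * ((1 + |η|) ^ β * (1 + |ξ|) ^ β) := by gcongr
        _ = _ := by ring
    refine (this.smul (𝓕 G η)).congr (ae_of_all _ fun ξ => ?_)
    simp [smul_smul, mul_comm]
  rw [← integral_const_mul_of_integrable hi3]
  congr 1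
  ext1 ξ
  rw [mul_smul_comm (_ * _), ← hWW, ← smul_mul_smul_comm]

theorem schwartzCalc_comm_rho (hA : IsZeroSectorial A) (hβ : 0 ≤ β)
    (hcalc : HasSobolevCalculus A β) (F : 𝓢(ℝ, ℂ)) :
    schwartzCalc A β F * cauchyIntegral A (Real.pi / 2) rho =
      cauchyIntegral A (Real.pi / 2) rho * schwartzCalc A β F := by
  refine rho_mul_cancel hA ?_
  rw [← mul_assoc, rho_mul_schwartzCalc hA hβ hcalc, fourierCalc_comm_rho hA hβ hcalc]

theorem schwartzCalc_mul (hA : IsZeroSectorial A) (hβ : 0 ≤ β)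
    (hcalc : HasSobolevCalculus A β) {F G H : 𝓢(ℝ, ℂ)} (h : ∀ u, H u = F u * G u) :
    schwartzCalc A β F * schwartzCalc A β G = schwartzCalc A β H := by
  refine rho_mul_cancel hA (rho_mul_cancel hA ?_)
  rw [rho_mul_schwartzCalc hA hβ hcalc H, ← fourierCalc_mul hA hβ hcalc h,
    ← rho_mul_schwartzCalc hA hβ hcalc F, ← rho_mul_schwartzCalc hA hβ hcalc G]
  simp only [mul_assoc]
  rw [← mul_assoc (schwartzCalc A β F), schwartzCalc_comm_rho hA hβ hcalc]
  simp only [mul_assoc]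

end SchwartzCalc

/-! ### Testing against compactly supported functions -/

section Density

theorem hasCompactSupport_cutoff (k : ℕ) (F : 𝓢(ℝ, ℂ)) : HasCompactSupport (cutoff k F) :=
  HasCompactSupport.intro (isCompact_Icc (a := -(2 * ((k : ℝ) + 1))) (b := 2 * ((k : ℝ) + 1)))
    fun ξ hξ => cutoff_eq_zero F (by
      by_contra! h
      exact hξ ⟨by linarith [abs_lt.1 h], by linarith [abs_lt.1 h]⟩)

/-- The bump function dilated by `k + 1`, as a Schwartz function. -/
noncomputable def dilatedBump (k : ℕ) : 𝓢(ℝ, ℂ) :=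
  HasCompactSupport.toSchwartzMap (f := fun ξ : ℝ => ((bump (ξ / (k + 1)) : ℝ) : ℂ))
    (HasCompactSupport.intro (isCompact_Icc (a := -(2 * ((k : ℝ) + 1))) (b := 2 * ((k : ℝ) + 1)))
      fun ξ hξ => by
        rw [bump_div_eq_zero (by positivity) ?_]
        · simp
        · by_contra! h
          exact hξ ⟨by linarith [abs_lt.1 h], by linarith [abs_lt.1 h]⟩)
    (contDiff_bump_div _)

theorem dilatedBump_apply (k : ℕ) (ξ : ℝ) : dilatedBump k ξ = ((bump (ξ / (k + 1)) : ℝ) : ℂ) := rfl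

theorem fourier_dilatedBump (k : ℕ) (s : ℝ) :
    𝓕 (dilatedBump k) s = ((k : ℂ) + 1) * 𝓕 (dilatedBump 0) (((k : ℝ) + 1) * s) := by
  have hk : (0 : ℝ) < (k : ℝ) + 1 := by positivity
  rw [SchwartzMap.fourier_coe, SchwartzMap.fourier_coe, fourier_apply, fourier_apply]
  have h := Measure.integral_comp_div (fun u : ℝ =>
    Complex.exp (-(2 * Real.pi * (((k : ℝ) + 1) * s : ℝ) * u * Complex.I)) * dilatedBump 0 u)
    ((k : ℝ) + 1)
  rw [abs_of_pos hk, Complex.real_smul] at h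
  push_cast at h ⊢
  rw [← h]
  congr 1
  ext1 u
  have hk' : (k : ℂ) + 1 ≠ 0 := by exact_mod_cast hk.ne'
  rw [dilatedBump_apply, dilatedBump_apply]
  congr 2
  · field_simp
  · simp

/-- The Fourier transforms of the truncations of `F` decay uniformly: they are convolutions of `𝓕 F`
with rescalings of one integrable function. -/
theorem exists_norm_fourier_cutoff_le (F : 𝓢(ℝ, ℂ)) {K : ℝ} (hK : 0 ≤ K) :
    ∃ C : ℝ, ∀ k ζ, ‖𝓕 (cutoff k F) ζ‖ ≤ C * (1 + |ζ|) ^ (-K) := by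
  obtain ⟨C, hC0, hC⟩ := schwartz_decay (𝓕 F) K
  refine ⟨C * ∫ t : ℝ, (1 + |t|) ^ K * ‖𝓕 (dilatedBump 0) t‖, fun k ζ => ?_⟩
  have hk : (0 : ℝ) < (k : ℝ) + 1 := by positivity
  have hmul : ∀ u, cutoff k F u = F u * dilatedBump k u := fun u => by
    rw [cutoff_apply, dilatedBump_apply, mul_comm]
  rw [fourier_mul_apply hmul]
  have hb : ∀ η : ℝ, ‖𝓕 F (ζ - η) * 𝓕 (dilatedBump k) η‖ ≤
      (C * (1 + |ζ|) ^ (-K)) * ((1 + |η|) ^ K * ‖𝓕 (dilatedBump k) η‖) := by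
    intro η
    rw [norm_mul]
    have h1 := weight_le_mul hK ζ η
    have h0 : 0 < 1 + |ζ| := by positivity
    have h2 : 0 < 1 + |ζ - η| := by positivity
    have h3 : (1 + |ζ - η|) ^ (-K) ≤ (1 + |ζ|) ^ (-K) * (1 + |η|) ^ K := by
      rw [Real.rpow_neg h0.le, Real.rpow_neg h2.le, inv_mul_eq_div, le_div_iff₀ (by positivity),
        inv_mul_le_iff₀ (by positivity)]
      linarith
    calc _ ≤ (C * ((1 + |ζ|) ^ (-K) * (1 + |η|) ^ K)) * ‖𝓕 (dilatedBump k) η‖ := by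
          gcongr
          exact (hC _).trans (by gcongr)
      _ = _ := by ring
  refine (norm_integral_le_of_norm_le ((integrable_schwartz_weight _ K).const_mul _)
    (ae_of_all _ hb)).trans ?_
  rw [integral_const_mul]
  have h4 : ∫ η : ℝ, (1 + |η|) ^ K * ‖𝓕 (dilatedBump k) η‖ ≤
      ∫ t : ℝ, (1 + |t|) ^ K * ‖𝓕 (dilatedBump 0) t‖ := by
    have h5 : ∫ t : ℝ, (1 + |t / ((k : ℝ) + 1)|) ^ K * ‖𝓕 (dilatedBump 0) t‖ =
        ∫ η : ℝ, (1 + |η|) ^ K * ‖𝓕 (dilatedBump k) η‖ := by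
      have h6 := Measure.integral_comp_div (fun η : ℝ => (1 + |η|) ^ K *
        ‖𝓕 (dilatedBump 0) (((k : ℝ) + 1) * η)‖) ((k : ℝ) + 1)
      rw [abs_of_pos hk, smul_eq_mul, ← integral_const_mul] at h6
      convert! h6 using 3 with t η
      · field_simp
      · rw [fourier_dilatedBump, norm_mul]
        have : ‖(k : ℂ) + 1‖ = (k : ℝ) + 1 := by
          have := Complex.norm_of_nonneg hk.le
          push_cast at this
          exact this
        rw [this]
        ring
    rw [← h5]
    refine integral_mono_of_nonneg (ae_of_all _ fun t => by positivity)
      (integrable_schwartz_weight _ K) (ae_of_all _ fun t => ?_)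
    have h7 : |t / ((k : ℝ) + 1)| ≤ |t| := by
      rw [abs_div, abs_of_pos hk]
      exact div_le_self (abs_nonneg t) (by linarith [(Nat.cast_nonneg k : (0 : ℝ) ≤ k)])
    exact mul_le_mul_of_nonneg_right (Real.rpow_le_rpow (by positivity) (by linarith) hK)
      (norm_nonneg _)
  calc _ ≤ (C * (1 + |ζ|) ^ (-K)) * ∫ t : ℝ, (1 + |t|) ^ K * ‖𝓕 (dilatedBump 0) t‖ := by gcongr
    _ = _ := by ring

theorem tendsto_fourier_cutoff (F : 𝓢(ℝ, ℂ)) (ζ : ℝ) :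
    Tendsto (fun k => 𝓕 (cutoff k F) ζ) atTop (𝓝 (𝓕 F ζ)) := by
  simp_rw [SchwartzMap.fourier_coe, fourier_apply]
  refine tendsto_integral_of_dominated_convergence (fun u => ‖F u‖)
    (fun k => (Continuous.mul (by fun_prop) (cutoff k F).continuous).aestronglyMeasurable)
    F.integrable.norm (fun k => ae_of_all _ fun u => ?_) (ae_of_all _ fun u => ?_)
  · rw [norm_mul, Complex.norm_exp]
    simpa using norm_cutoff_le k F u
  · refine tendsto_const_nhds.congr' ?_
    filter_upwards [eventually_cutoff_eq F u] with k hk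
    rw [hk]

/-- A function of polynomial growth that annihilates the Fourier transforms of all test functions
annihilates all Schwartz functions. -/
theorem integral_fourier_smul_eq_zero {E : Type*} [NormedAddCommGroup E] [NormedSpace ℂ E]
    {W : ℝ → E} {K : ℝ} (hK : 0 ≤ K) (hW : Integrable fun ξ : ℝ => (1 + |ξ|) ^ (-K) • W ξ)
    (h : ∀ F : 𝓢(ℝ, ℂ), HasCompactSupport F → ∫ ξ, 𝓕 F ξ • W ξ = 0) (F : 𝓢(ℝ, ℂ)) :
    ∫ ξ, 𝓕 F ξ • W ξ = 0 := by
  obtain ⟨C, hC⟩ := exists_norm_fourier_cutoff_le F hK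
  have hWm : AEStronglyMeasurable W := by
    refine ((continuous_weight K).aestronglyMeasurable.smul hW.aestronglyMeasurable).congr
      (ae_of_all _ fun ξ => ?_)
    change (1 + |ξ|) ^ K • (1 + |ξ|) ^ (-K) • W ξ = W ξ
    rw [smul_smul, ← Real.rpow_add (by positivity), add_neg_cancel, Real.rpow_zero, one_smul]
  have hlim : Tendsto (fun k => ∫ ξ, 𝓕 (cutoff k F) ξ • W ξ) atTop (𝓝 (∫ ξ, 𝓕 F ξ • W ξ)) := by
    refine tendsto_integral_of_dominated_convergence
      (fun ξ => C * ‖(1 + |ξ|) ^ (-K) • W ξ‖)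
      (fun k => (𝓕 (cutoff k F)).continuous.aestronglyMeasurable.smul hWm)
      (hW.norm.const_mul C) (fun k => ae_of_all _ fun ξ => ?_) (ae_of_all _ fun ξ => ?_)
    · rw [norm_smul, norm_smul, Real.norm_of_nonneg (by positivity), ← mul_assoc]
      gcongr
      exact hC k ξ
    · exact (tendsto_fourier_cutoff F ξ).smul_const _
  refine tendsto_nhds_unique hlim ?_
  simp_rw [h _ (hasCompactSupport_cutoff _ F)]
  exact tendsto_const_nhds

end Density

/-! ### The dyadic partition and the calculus core -/

section Core

/-- The product of a smooth function and a compactly supported one, as a Schwartz function. -/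
noncomputable def smoothMul {g : ℝ → ℂ} (hg : ContDiff ℝ ((⊤ : ℕ∞) : WithTop ℕ∞) g) {P : 𝓢(ℝ, ℂ)}
    (hP : HasCompactSupport P) : 𝓢(ℝ, ℂ) :=
  HasCompactSupport.toSchwartzMap (f := fun u => g u * P u) hP.mul_left (hg.mul (P.smooth ⊤))

theorem smoothMul_apply {g : ℝ → ℂ} (hg : ContDiff ℝ ((⊤ : ℕ∞) : WithTop ℕ∞) g) {P : 𝓢(ℝ, ℂ)}
    (hP : HasCompactSupport P) (u : ℝ) : smoothMul hg hP u = g u * P u := rfl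

variable {φ : ℝ → ℂ}

theorem dyad_exp_eq_zero (hφ : IsDyadicPartition φ) {n : ℤ} {u : ℝ}
    (h : Real.log 2 < |u - n * Real.log 2|) : dyad φ n (Real.exp u) = 0 := by
  by_contra hne
  have h1 := hφ.support (subset_tsupport φ (Function.mem_support.2 hne))
  have h2 : (2 : ℝ) ^ (-n) * Real.exp u = Real.exp (u - n * Real.log 2) := by
    rw [sub_eq_neg_add, Real.exp_add, ← neg_mul, mul_comm _ (Real.log 2),
      Real.exp_mul, Real.exp_log two_pos, ← Real.rpow_intCast]
    push_cast; rfl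
  rw [h2, mem_Icc] at h1
  have h3 : -Real.log 2 ≤ u - n * Real.log 2 := by
    rw [← Real.log_inv, ← Real.exp_le_exp, Real.exp_log (by norm_num)]
    simpa using h1.1
  have h4 : u - n * Real.log 2 ≤ Real.log 2 := by
    rw [← Real.exp_le_exp, Real.exp_log two_pos]
    exact h1.2
  exact absurd h (not_lt.2 (abs_le.2 ⟨h3, h4⟩))

theorem hasCompactSupport_dyad_exp (hφ : IsDyadicPartition φ) (n : ℤ) :
    HasCompactSupport fun u => dyad φ n (Real.exp u) :=
  HasCompactSupport.intro (isCompact_Icc (a := n * Real.log 2 - Real.log 2)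
    (b := n * Real.log 2 + Real.log 2)) fun u hu => dyad_exp_eq_zero hφ (by
      by_contra! h
      exact hu ⟨by linarith [abs_le.1 h], by linarith [abs_le.1 h]⟩)

/-- The function `φ_n ∘ exp` as a Schwartz function. -/
noncomputable def dyadExp (hφ : IsDyadicPartition φ) (n : ℤ) : 𝓢(ℝ, ℂ) :=
  (hasCompactSupport_dyad_exp hφ n).toSchwartzMap
    (hφ.smooth.comp (contDiff_const.mul Real.contDiff_exp))

theorem dyadExp_apply (hφ : IsDyadicPartition φ) (n : ℤ) (u : ℝ) :
    dyadExp hφ n u = dyad φ n (Real.exp u) := rfl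

theorem hasCompactSupport_dyadExp (hφ : IsDyadicPartition φ) (n : ℤ) :
    HasCompactSupport (dyadExp hφ n) := hasCompactSupport_dyad_exp hφ n

/-- The partial sum `∑_{|n| ≤ N} φ_n ∘ exp`. -/
noncomputable def dyadSum (hφ : IsDyadicPartition φ) (N : ℕ) : 𝓢(ℝ, ℂ) :=
  ∑ n ∈ Finset.Icc (-(N : ℤ)) N, dyadExp hφ n

theorem dyadSum_apply (hφ : IsDyadicPartition φ) (N : ℕ) (u : ℝ) :
    dyadSum hφ N u = ∑ n ∈ Finset.Icc (-(N : ℤ)) N, dyad φ n (Real.exp u) := by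
  rw [dyadSum, sum_apply]
  rfl

theorem natCast_mul_log_le (N : ℕ) {n : ℤ} (hn : n ∉ Finset.Icc (-(N : ℤ)) N) {u : ℝ}
    (hu : |u| < N * Real.log 2) : Real.log 2 < |u - n * Real.log 2| := by
  have hlog : 0 < Real.log 2 := Real.log_pos one_lt_two
  rw [abs_lt] at hu
  rw [Finset.mem_Icc, not_and_or, not_le, not_le] at hn
  rw [lt_abs]
  rcases hn with hn | hn
  · left
    have : (n : ℝ) + 1 ≤ -N := by exact_mod_cast hn
    nlinarith
  · right
    have : (N : ℝ) + 1 ≤ n := by exact_mod_cast hn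
    nlinarith

theorem dyadSum_eq_one (hφ : IsDyadicPartition φ) {N : ℕ} {u : ℝ} (hu : |u| < N * Real.log 2) :
    dyadSum hφ N u = 1 := by
  rw [dyadSum_apply]
  refine HasSum.unique (hasSum_sum_of_ne_finset_zero fun n hn => ?_)
    (hφ.sum_eq_one _ (Real.exp_pos u))
  exact dyad_exp_eq_zero hφ (natCast_mul_log_le N hn hu)

theorem dyadSum_eq_zero (hφ : IsDyadicPartition φ) {N : ℕ} {u : ℝ}
    (hu : (N + 1) * Real.log 2 < |u|) : dyadSum hφ N u = 0 := by
  rw [dyadSum_apply]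
  refine Finset.sum_eq_zero fun n hn => dyad_exp_eq_zero hφ ?_
  have hlog : 0 < Real.log 2 := Real.log_pos one_lt_two
  rw [Finset.mem_Icc] at hn
  have h1 : |(n : ℝ)| ≤ N := by
    rw [abs_le]
    exact ⟨by exact_mod_cast hn.1, by exact_mod_cast hn.2⟩
  have h2 := abs_sub_abs_le_abs_sub u (n * Real.log 2)
  rw [abs_mul, abs_of_pos hlog] at h2
  nlinarith

theorem hasCompactSupport_dyadSum (hφ : IsDyadicPartition φ) (N : ℕ) :
    HasCompactSupport (dyadSum hφ N) :=
  HasCompactSupport.intro (isCompact_Icc (a := -((N + 1) * Real.log 2))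
    (b := (N + 1) * Real.log 2)) fun u hu => dyadSum_eq_zero hφ (by
      by_contra! h
      exact hu ⟨by linarith [abs_le.1 h], by linarith [abs_le.1 h]⟩)

theorem exists_dyadSum_eq_one (hφ : IsDyadicPartition φ) {F : 𝓢(ℝ, ℂ)} (hF : HasCompactSupport F) :
    ∃ N : ℕ, ∀ u, F u ≠ 0 → dyadSum hφ N u = 1 := by
  obtain ⟨R, hR⟩ := hF.isCompact.isBounded.subset_closedBall 0
  obtain ⟨N, hN⟩ := exists_nat_gt (R / Real.log 2)
  refine ⟨N, fun u hu => dyadSum_eq_one hφ ?_⟩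
  have h1 := hR (subset_tsupport _ (Function.mem_support.2 hu))
  rw [mem_closedBall_zero_iff, Real.norm_eq_abs] at h1
  rw [div_lt_iff₀ (Real.log_pos one_lt_two)] at hN
  linarith

variable {X : Type*} [NormedAddCommGroup X] [NormedSpace ℂ X] [CompleteSpace X] {A : X →ₗ.[ℂ] X}
  {β : ℝ}

theorem schwartzCalc_sum (hA : IsZeroSectorial A) (hβ : 0 ≤ β) (hcalc : HasSobolevCalculus A β)
    {ι : Type*} (s : Finset ι) (F : ι → 𝓢(ℝ, ℂ)) :
    schwartzCalc A β (∑ i ∈ s, F i) = ∑ i ∈ s, schwartzCalc A β (F i) := by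
  classical
  induction s using Finset.induction_on with
  | empty => simpa using schwartzCalc_zero hA hβ hcalc
  | insert i s hi ih => rw [Finset.sum_insert hi, Finset.sum_insert hi,
      schwartzCalc_add hA hβ hcalc, ih]

theorem schwartzCalc_comm (hA : IsZeroSectorial A) (hβ : 0 ≤ β) (hcalc : HasSobolevCalculus A β)
    (F G : 𝓢(ℝ, ℂ)) : schwartzCalc A β F * schwartzCalc A β G =
      schwartzCalc A β G * schwartzCalc A β F := by
  have h : ∀ u, SchwartzMap.pairing (ContinuousLinearMap.mul ℂ ℂ) F G u = F u * G u := fun _ => rfl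
  rw [schwartzCalc_mul hA hβ hcalc h,
    schwartzCalc_mul hA hβ hcalc fun u => (h u).trans (mul_comm (F u) (G u))]

theorem sobolevCalc_dyad (hA : IsZeroSectorial A) (hβ : 0 ≤ β) (hcalc : HasSobolevCalculus A β)
    (hφ : IsDyadicPartition φ) (n : ℤ) :
    sobolevCalc A β (dyad φ n) = schwartzCalc A β (dyadExp hφ n) :=
  sobolevCalc_eq_schwartzCalc hA hβ hcalc fun _ => rfl

theorem holCalcEq_rho (hA : IsZeroSectorial A) :
    HolCalcEq A rho (cauchyIntegral A (Real.pi / 2) rho) := by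
  refine LinearPMap.eq_of_eq_graph ?_
  ext ⟨x, y⟩
  rw [holCalc_graph hA, ← cauchyIntegral_mul hA decaysOnSectors_rho decaysOnSectors_rho,
    LinearPMap.mem_graph_iff]
  constructor
  · intro h
    refine ⟨⟨x, trivial⟩, rfl, ?_⟩
    rw [eq_comm, ← sub_eq_zero]
    refine cauchyIntegral_rho_injective hA ?_
    rw [map_sub, sub_eq_zero, h]
    rfl
  · rintro ⟨⟨x', _⟩, rfl, rfl⟩
    rfl

theorem schwartzCalc_rhoExp (hA : IsZeroSectorial A) (hβ : 0 ≤ β)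
    (hcalc : HasSobolevCalculus A β) :
    schwartzCalc A β rhoExp = cauchyIntegral A (Real.pi / 2) rho := by
  obtain ⟨T, -, hTF, huniq⟩ := exists_isSobolevCalcValue hA hβ hcalc (f := fun s : ℝ => rho s)
    (F := rhoExp) fun u => rfl
  have h0 : expSobolevNorm β (fun s : ℝ => rho s - rho s) = 0 := by
    have h1 : (fun u : ℝ => (fun s : ℝ => rho s - rho s) (Real.exp u)) = (0 : 𝓢(ℝ, ℂ)) := by
      ext u; simp
    rw [expSobolevNorm, h1, sobolevNorm_schwartz]
    have h2 : 𝓕 (0 : 𝓢(ℝ, ℂ)) = 0 := FourierTransform.fourier_zero ..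
    rw [h2]
    simp
  have h1 : IsSobolevCalcValue A β (fun s : ℝ => rho s) (cauchyIntegral A (Real.pi / 2) rho) :=
    ⟨fun _ => rho, fun _ => cauchyIntegral A (Real.pi / 2) rho,
      fun _ => ⟨decaysOnSectors_rho.inHInf, sobolevNorm_schwartz_lt_top β rhoExp,
        holCalcEq_rho hA⟩, by simp_rw [h0]; exact tendsto_const_nhds, tendsto_const_nhds⟩
  rw [huniq _ h1]
  exact rho_mul_cancel hA (by rw [rho_mul_schwartzCalc hA hβ hcalc, hTF])

theorem schwartzCalc_apply_apply (hA : IsZeroSectorial A) (hβ : 0 ≤ β)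
    (hcalc : HasSobolevCalculus A β) {F G H : 𝓢(ℝ, ℂ)} (h : ∀ u, H u = F u * G u) (z : X) :
    schwartzCalc A β F (schwartzCalc A β G z) = schwartzCalc A β H z :=
  DFunLike.congr_fun (schwartzCalc_mul hA hβ hcalc h) z

theorem fourierCalc_apply (hA : IsZeroSectorial A) (hβ : 0 ≤ β) (hcalc : HasSobolevCalculus A β)
    (F : 𝓢(ℝ, ℂ)) (z : X) :
    fourierCalc A F z = ∫ ξ : ℝ, 𝓕 F ξ • regImagPow A (2 * Real.pi * ξ) z := by
  rw [fourierCalc, ContinuousLinearMap.integral_apply (integrable_fourierCalc hA hβ hcalc F)]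
  rfl

/-- The operators `φ_n(A)` have trivial common kernel. -/
theorem eq_zero_of_dyad_apply_eq_zero (hA : IsZeroSectorial A) (hβ : 0 ≤ β)
    (hcalc : HasSobolevCalculus A β) (hφ : IsDyadicPartition φ) {z : X}
    (hz : ∀ n, schwartzCalc A β (dyadExp hφ n) z = 0) : z = 0 := by
  have h1 : ∀ F : 𝓢(ℝ, ℂ), HasCompactSupport F → schwartzCalc A β F z = 0 := by
    intro F hF
    obtain ⟨N, hN⟩ := exists_dyadSum_eq_one hφ hF
    have hFN : ∀ u, F u = F u * dyadSum hφ N u := fun u => by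
      by_cases hu : F u = 0
      · rw [hu, zero_mul]
      · rw [hN u hu, mul_one]
    rw [← schwartzCalc_apply_apply hA hβ hcalc hFN, dyadSum, schwartzCalc_sum hA hβ hcalc,
      sum_apply, Finset.sum_eq_zero fun n _ => hz n, map_zero]
  have h2 : ∫ ξ : ℝ, 𝓕 rhoExp ξ • regImagPow A (2 * Real.pi * ξ) z = 0 := by
    obtain ⟨C, -, hC⟩ := exists_bound_regImagPow hA hβ hcalc
    refine integral_fourier_smul_eq_zero (K := β + 2) (by linarith) ?_ (fun F hF => ?_) _
    · have hcont : Continuous fun ξ : ℝ => regImagPow A (2 * Real.pi * ξ) z :=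
        ((continuous_regImagPow hA).comp (continuous_const.mul continuous_id)).clm_apply
          continuous_const
      refine ((integrable_weight one_lt_two).const_mul (C * ‖z‖)).mono'
        ((continuous_weight _).smul hcont).aestronglyMeasurable (ae_of_all _ fun ξ => ?_)
      have h0 : 0 < 1 + |ξ| := by positivity
      rw [norm_smul, Real.norm_of_nonneg (by positivity)]
      calc _ ≤ (1 + |ξ|) ^ (-(β + 2)) * (C * (1 + |ξ|) ^ β * ‖z‖) := by
            gcongr
            exact (ContinuousLinearMap.le_opNorm _ _).trans (by gcongr; exact hC ξ)
        _ = C * ‖z‖ * ((1 + |ξ|) ^ (-(β + 2)) * (1 + |ξ|) ^ β) := by ring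
        _ = _ := by rw [← Real.rpow_add h0]; congr 2; ring
    · rw [← fourierCalc_apply hA hβ hcalc, ← rho_mul_schwartzCalc hA hβ hcalc]
      change cauchyIntegral A (Real.pi / 2) rho (schwartzCalc A β F z) = 0
      rw [h1 F hF, map_zero]
  rw [← fourierCalc_apply hA hβ hcalc, ← rho_mul_schwartzCalc hA hβ hcalc,
    schwartzCalc_rhoExp hA hβ hcalc] at h2
  exact cauchyIntegral_rho_injective hA (cauchyIntegral_rho_injective hA h2)

/-- Elements of the core are fixed by the spectral cutoff `∑_{|n| ≤ N} φ_n(A)` for some `N`. -/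
theorem exists_dyadSum_apply_eq (hA : IsZeroSectorial A) (hβ : 0 ≤ β)
    (hcalc : HasSobolevCalculus A β) (hφ : IsDyadicPartition φ) {x : X} (hx : x ∈ core A β φ) :
    ∃ N : ℕ, schwartzCalc A β (dyadSum hφ N) x = x := by
  obtain ⟨N, hN⟩ := hx
  refine ⟨N + 2, ?_⟩
  rw [eq_comm, ← sub_eq_zero]
  refine eq_zero_of_dyad_apply_eq_zero hA hβ hcalc hφ fun k => ?_
  rw [map_sub, sub_eq_zero]
  by_cases hk : (N : ℤ) ≤ |k|
  · have h1 := hN k hk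
    rw [sobolevCalc_dyad hA hβ hcalc hφ] at h1
    have h2 := DFunLike.congr_fun (schwartzCalc_comm hA hβ hcalc (dyadExp hφ k)
      (dyadSum hφ (N + 2))) x
    change schwartzCalc A β (dyadExp hφ k) (schwartzCalc A β (dyadSum hφ (N + 2)) x) =
      schwartzCalc A β (dyadSum hφ (N + 2)) (schwartzCalc A β (dyadExp hφ k) x) at h2
    rw [h2, h1, map_zero]
  · refine (schwartzCalc_apply_apply hA hβ hcalc (fun u => ?_) x).symm
    by_cases hu : dyadExp hφ k u = 0
    · rw [hu, zero_mul]
    · rw [dyadSum_eq_one hφ, mul_one]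
      have h3 : |u - k * Real.log 2| ≤ Real.log 2 := by
        by_contra! h
        exact hu (dyad_exp_eq_zero hφ h)
      have hlog : 0 < Real.log 2 := Real.log_pos one_lt_two
      have h4 := abs_sub_abs_le_abs_sub u (k * Real.log 2)
      rw [abs_mul, abs_of_pos hlog] at h4
      have h5 : |(k : ℝ)| ≤ N := by
        have : |k| ≤ (N : ℤ) := by omega
        exact_mod_cast this
      push_cast
      nlinarith

end Core

/-! ### Imaginary powers and the local calculus on the core -/

section CoreCalc

variable {X : Type*} [NormedAddCommGroup X] [NormedSpace ℂ X] {A : X →ₗ.[ℂ] X} {β : ℝ} {φ : ℝ → ℂ}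

theorem pairing_eq_of_mem_graph {T : X →ₗ.[ℂ] X} {x y : X} (h : (x, y) ∈ T.graph)
    (x' : X →L[ℂ] ℂ) : pairing T x x' = x' y := by
  have hx : x ∈ T.domain := LinearPMap.mem_domain_of_mem_graph h
  rw [pairing, dif_pos hx]
  congr 1
  obtain ⟨z, hz1, hz2⟩ := (LinearPMap.mem_graph_iff _).1 h
  have hz : z = ⟨x, hx⟩ := Subtype.ext hz1
  rw [← hz, hz2]

variable [CompleteSpace X]

theorem contDiff_rho_inv :
    ContDiff ℝ ((⊤ : ℕ∞) : WithTop ℕ∞) fun u : ℝ => (rhoExp u)⁻¹ := by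
  refine ContDiff.inv (rhoExp.smooth ⊤) fun u => ?_
  rw [rhoExp_apply, rho]
  have h1 : (Real.exp u : ℂ) ≠ 0 := by exact_mod_cast (Real.exp_pos u).ne'
  have h2 : (1 : ℂ) + Real.exp u ≠ 0 := by
    have := Real.exp_pos u
    exact_mod_cast (by linarith : (1 : ℝ) + Real.exp u ≠ 0)
  exact div_ne_zero h1 (pow_ne_zero 2 h2)

/-- The calculus core lies in the range of `ρ(A)`: a spectral cutoff can be divided by `ρ`. -/
theorem exists_rho_apply_eq (hA : IsZeroSectorial A) (hβ : 0 ≤ β)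
    (hcalc : HasSobolevCalculus A β) (hφ : IsDyadicPartition φ) {x : X} {N : ℕ}
    (hx : schwartzCalc A β (dyadSum hφ N) x = x) :
    ∃ y, cauchyIntegral A (Real.pi / 2) rho y = x := by
  refine ⟨schwartzCalc A β (smoothMul contDiff_rho_inv (hasCompactSupport_dyadSum hφ N)) x, ?_⟩
  rw [← schwartzCalc_rhoExp hA hβ hcalc]
  conv_rhs => rw [← hx]
  refine schwartzCalc_apply_apply hA hβ hcalc (fun u => ?_) x
  rw [smoothMul_apply, rhoExp_apply, mul_inv_cancel_left₀]
  rw [rho]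
  have h1 : (Real.exp u : ℂ) ≠ 0 := by exact_mod_cast (Real.exp_pos u).ne'
  have h2 : (1 : ℂ) + Real.exp u ≠ 0 := by
    have := Real.exp_pos u
    exact_mod_cast (by linarith : (1 : ℝ) + Real.exp u ≠ 0)
  exact div_ne_zero h1 (pow_ne_zero 2 h2)

theorem mem_graph_imagPow (hA : IsZeroSectorial A) (t : ℝ) (y : X) :
    (cauchyIntegral A (Real.pi / 2) rho y, regImagPow A t y) ∈ (imagPow A t).graph := by
  rw [imagPow, holCalc_graph hA]
  exact (DFunLike.congr_fun (regImagPow_comm hA t) y).symm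

theorem apply_schwartzCalc_rho (hA : IsZeroSectorial A) (hβ : 0 ≤ β)
    (hcalc : HasSobolevCalculus A β) (F : 𝓢(ℝ, ℂ)) (y : X) (x' : X →L[ℂ] ℂ) :
    x' (schwartzCalc A β F (cauchyIntegral A (Real.pi / 2) rho y)) =
      ∫ ξ : ℝ, 𝓕 F ξ * x' (regImagPow A (2 * Real.pi * ξ) y) := by
  have h1 : schwartzCalc A β F (cauchyIntegral A (Real.pi / 2) rho y) = fourierCalc A F y := by
    rw [← rho_mul_schwartzCalc hA hβ hcalc, ← schwartzCalc_comm_rho hA hβ hcalc]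
    rfl
  rw [h1, fourierCalc_apply hA hβ hcalc, ← ContinuousLinearMap.integral_comp_comm]
  · simp
  · exact (ContinuousLinearMap.apply ℂ X y).integrable_comp (integrable_fourierCalc hA hβ hcalc F)

/-- The finite sum in the definition of the local calculus. Only `|n| ≤ N + 3` contribute, since the
other `φ_n` vanish on the support of the dyadic sum that fixes `a`. -/
theorem finsum_sobolevCalc_eq (hA : IsZeroSectorial A) (hβ : 0 ≤ β)
    (hcalc : HasSobolevCalculus A β) (hφ : IsDyadicPartition φ) {f g : ℝ → ℂ}
    (hg : ContDiff ℝ ((⊤ : ℕ∞) : WithTop ℕ∞) g) (hfg : ∀ u, f (Real.exp u) = g u) {a : X} {N : ℕ}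
    (ha : schwartzCalc A β (dyadSum hφ N) a = a) :
    ∑ᶠ n : ℤ, sobolevCalc A β (fun s => f s * dyad φ n s) a =
      schwartzCalc A β (smoothMul hg (hasCompactSupport_dyadSum hφ N)) a := by
  have hlog : 0 < Real.log 2 := Real.log_pos one_lt_two
  have h1 : ∀ n, sobolevCalc A β (fun s => f s * dyad φ n s) =
      schwartzCalc A β (smoothMul hg (hasCompactSupport_dyadExp hφ n)) := fun n =>
    sobolevCalc_eq_schwartzCalc hA hβ hcalc fun u => by rw [hfg, smoothMul_apply, dyadExp_apply]
  simp_rw [h1]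
  rw [finsum_eq_sum_of_support_subset (s := Finset.Icc (-((N + 3 : ℕ) : ℤ)) (N + 3 : ℕ))]
  · rw [← sum_apply, ← schwartzCalc_sum hA hβ hcalc]
    conv_lhs => rw [← ha]
    refine schwartzCalc_apply_apply hA hβ hcalc (fun u => ?_) a
    rw [smoothMul_apply, sum_apply]
    simp_rw [smoothMul_apply]
    rw [← Finset.mul_sum, mul_assoc]
    congr 1
    by_cases hu : dyadSum hφ N u = 0
    · rw [hu, mul_zero]
    · have h2 : |u| ≤ (N + 1) * Real.log 2 := by
        by_contra! h
        exact hu (dyadSum_eq_zero hφ h)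
      have h3 : ∑ n ∈ Finset.Icc (-((N + 3 : ℕ) : ℤ)) (N + 3 : ℕ), dyadExp hφ n u =
          dyadSum hφ (N + 3) u := by
        rw [dyadSum_apply]; rfl
      rw [h3, dyadSum_eq_one hφ (N := N + 3) (by push_cast; nlinarith), one_mul]
  · intro n hn
    by_contra hnmem
    refine hn ?_
    change schwartzCalc A β (smoothMul hg (hasCompactSupport_dyadExp hφ n)) a = 0
    rw [← ha, schwartzCalc_apply_apply hA hβ hcalc (H := 0) (fun u => ?_),
      schwartzCalc_zero hA hβ hcalc]
    · rfl
    · by_cases hu : dyadSum hφ N u = 0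
      · rw [hu, mul_zero]; rfl
      · have h2 : |u| ≤ (N + 1) * Real.log 2 := by
          by_contra! h
          exact hu (dyadSum_eq_zero hφ h)
        have h3 : Real.log 2 < |u - n * Real.log 2| :=
          natCast_mul_log_le (N + 3) hnmem (by push_cast; nlinarith)
        rw [smoothMul_apply, dyadExp_apply, dyad_exp_eq_zero hφ h3]
        simp

/-- The local calculus is closable; on the core it is given by a spectral cutoff. -/
theorem mem_graph_locCalc (hA : IsZeroSectorial A) (hβ : 0 ≤ β)
    (hcalc : HasSobolevCalculus A β) (hφ : IsDyadicPartition φ) {f g : ℝ → ℂ}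
    (hg : ContDiff ℝ ((⊤ : ℕ∞) : WithTop ℕ∞) g) (hfg : ∀ u, f (Real.exp u) = g u) {x : X}
    (hx : x ∈ core A β φ) {N : ℕ} (hN : schwartzCalc A β (dyadSum hφ N) x = x) :
    (x, schwartzCalc A β (smoothMul hg (hasCompactSupport_dyadSum hφ N)) x) ∈
      (locCalc A β φ f).graph := by
  rw [locCalc, Submodule.toLinearPMap_graph_eq]
  · refine Submodule.le_topologicalClosure _ (Submodule.subset_span ⟨hx, ?_⟩)
    exact (finsum_sobolevCalc_eq hA hβ hcalc hφ hg hfg hN).symm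
  -- closability: `φ_j(A) b = (f φ_j)(A) a` on the graph and hence on its closure, so that `a = 0`
  -- forces `φ_j(A) b = 0` for all `j`
  · have key : ∀ j : ℤ, (Submodule.span ℂ {p : X × X | p.1 ∈ core A β φ ∧
        p.2 = ∑ᶠ n : ℤ, sobolevCalc A β (fun s => f s * dyad φ n s) p.1}).topologicalClosure ≤
        LinearMap.ker ((schwartzCalc A β (dyadExp hφ j)).comp (ContinuousLinearMap.snd ℂ X X) -
          (schwartzCalc A β (smoothMul hg (hasCompactSupport_dyadExp hφ j))).comp
            (ContinuousLinearMap.fst ℂ X X)).toLinearMap := by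
      intro j
      refine Submodule.topologicalClosure_minimal _ (Submodule.span_le.2 ?_)
        (ContinuousLinearMap.isClosed_ker _)
      rintro ⟨a, b⟩ ⟨ha, hb⟩
      change a ∈ core A β φ at ha
      obtain rfl : b = ∑ᶠ n : ℤ, sobolevCalc A β (fun s => f s * dyad φ n s) a := hb
      obtain ⟨M, hM⟩ := exists_dyadSum_apply_eq hA hβ hcalc hφ ha
      change schwartzCalc A β (dyadExp hφ j)
        (∑ᶠ n : ℤ, sobolevCalc A β (fun s => f s * dyad φ n s) a) -
        schwartzCalc A β (smoothMul hg (hasCompactSupport_dyadExp hφ j)) a = 0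
      rw [sub_eq_zero, finsum_sobolevCalc_eq hA hβ hcalc hφ hg hfg hM]
      have h1 : schwartzCalc A β (smoothMul hg (hasCompactSupport_dyadExp hφ j)) a =
          schwartzCalc A β (smoothMul hg (hasCompactSupport_dyadExp hφ j))
            (schwartzCalc A β (dyadSum hφ M) a) := by rw [hM]
      rw [h1]
      let H : 𝓢(ℝ, ℂ) := SchwartzMap.pairing (ContinuousLinearMap.mul ℂ ℂ)
        (smoothMul hg (hasCompactSupport_dyadExp hφ j)) (dyadSum hφ M)
      rw [schwartzCalc_apply_apply hA hβ hcalc (H := H) fun u => rfl,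
        schwartzCalc_apply_apply hA hβ hcalc (H := H) fun u => ?_]
      change smoothMul hg _ u * dyadSum hφ M u = _
      rw [smoothMul_apply, smoothMul_apply]
      ring
    rintro ⟨a, b⟩ hab (rfl : a = 0)
    refine eq_zero_of_dyad_apply_eq_zero hA hβ hcalc hφ fun j => ?_
    have h2 : schwartzCalc A β (dyadExp hφ j) b -
      schwartzCalc A β (smoothMul hg (hasCompactSupport_dyadExp hφ j)) 0 = 0 := key j hab
    simpa using h2

end CoreCalc

/-! ### The weak Fourier representation -/

section Weak

variable {X : Type*} [NormedAddCommGroup X] [NormedSpace ℂ X] {A : X →ₗ.[ℂ] X} {β : ℝ} {φ : ℝ → ℂ}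

/-- The translate `F(· + v)` of a Schwartz function. -/
noncomputable def translate (v : ℝ) (F : 𝓢(ℝ, ℂ)) : 𝓢(ℝ, ℂ) := F.compSubConstCLM ℂ (-v)

theorem translate_apply (v : ℝ) (F : 𝓢(ℝ, ℂ)) (u : ℝ) : translate v F u = F (u + v) := by
  rw [translate, SchwartzMap.compSubConstCLM_apply, sub_neg_eq_add]

theorem fourier_translate (v : ℝ) (F : 𝓢(ℝ, ℂ)) (ξ : ℝ) :
    𝓕 (translate v F) ξ = Complex.exp (2 * Real.pi * ξ * v * Complex.I) * 𝓕 F ξ := by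
  rw [SchwartzMap.fourier_coe, SchwartzMap.fourier_coe, fourier_apply, fourier_apply,
    ← integral_const_mul, ← integral_sub_right_eq_self (fun u : ℝ =>
      Complex.exp (-(2 * Real.pi * ξ * u * Complex.I)) * translate v F u) v]
  congr 1
  ext1 u
  rw [translate_apply, sub_add_cancel, ← mul_assoc, ← Complex.exp_add]
  congr 2
  push_cast; ring

theorem hasCompactSupport_dilatedBump (k : ℕ) : HasCompactSupport (dilatedBump k) :=
  HasCompactSupport.intro (isCompact_Icc (a := -(2 * ((k : ℝ) + 1))) (b := 2 * ((k : ℝ) + 1)))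
    fun ξ hξ => by
      rw [dilatedBump_apply, bump_div_eq_zero (by positivity) ?_]
      · simp
      · by_contra! h
        exact hξ ⟨by linarith [abs_lt.1 h], by linarith [abs_lt.1 h]⟩

/-- The smooth truncations `G χ(·/(k+1))` of a smooth function. -/
noncomputable def smoothCutoff {G : ℝ → ℂ} (hG : ContDiff ℝ ((⊤ : ℕ∞) : WithTop ℕ∞) G) (k : ℕ) :
    𝓢(ℝ, ℂ) := smoothMul hG (hasCompactSupport_dilatedBump k)

variable {G : ℝ → ℂ} (hG : ContDiff ℝ ((⊤ : ℕ∞) : WithTop ℕ∞) G)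

theorem smoothCutoff_eq {k : ℕ} {u : ℝ} (h : |u| ≤ (k : ℝ) + 1) : smoothCutoff hG k u = G u := by
  rw [smoothCutoff, smoothMul_apply, dilatedBump_apply, bump_div_eq_one (by positivity) h]
  simp

theorem norm_smoothCutoff_le (k : ℕ) (u : ℝ) : ‖smoothCutoff hG k u‖ ≤ ‖G u‖ := by
  rw [smoothCutoff, smoothMul_apply, dilatedBump_apply, norm_mul, Complex.norm_real,
    Real.norm_of_nonneg bump.nonneg]
  exact mul_le_of_le_one_right (norm_nonneg _) bump.le_one

theorem norm_fourier_le_of_norm_le {F G : ℝ → ℂ} (hG : Integrable G) (h : ∀ u, ‖F u‖ ≤ ‖G u‖)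
    (ξ : ℝ) : ‖𝓕 F ξ‖ ≤ ∫ u, ‖G u‖ := by
  rw [fourier_apply]
  refine norm_integral_le_of_norm_le hG.norm (ae_of_all _ fun u => ?_)
  rw [norm_mul, Complex.norm_exp]
  simpa using h u

theorem tendsto_fourier_smoothCutoff (hGi : Integrable G) (ξ : ℝ) :
    Tendsto (fun k => 𝓕 (smoothCutoff hG k) ξ) atTop (𝓝 (𝓕 G ξ)) := by
  simp_rw [SchwartzMap.fourier_coe, fourier_apply]
  refine tendsto_integral_of_dominated_convergence (fun u => ‖G u‖)
    (fun k => (Continuous.mul (by fun_prop) (smoothCutoff hG k).continuous).aestronglyMeasurable)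
    hGi.norm (fun k => ae_of_all _ fun u => ?_) (ae_of_all _ fun u => ?_)
  · rw [norm_mul, Complex.norm_exp]
    simpa using norm_smoothCutoff_le hG k u
  · obtain ⟨n, hn⟩ := exists_nat_ge |u|
    refine tendsto_const_nhds.congr' ?_
    filter_upwards [eventually_ge_atTop n] with k hk
    have : (n : ℝ) ≤ k := by exact_mod_cast hk
    rw [smoothCutoff_eq hG (by linarith)]

theorem contDiff_comp_add {G : ℝ → ℂ} (hG : ContDiff ℝ ((⊤ : ℕ∞) : WithTop ℕ∞) G) (v : ℝ) :
    ContDiff ℝ ((⊤ : ℕ∞) : WithTop ℕ∞) fun u => G (u + v) :=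
  hG.comp (contDiff_id.add contDiff_const)

theorem continuous_apply_regImagPow (hA : IsZeroSectorial A) (y : X) (x' : X →L[ℂ] ℂ) :
    Continuous fun ξ : ℝ => x' (regImagPow A (2 * Real.pi * ξ) y) :=
  x'.continuous.comp (((continuous_regImagPow hA).comp
    (continuous_const.mul continuous_id)).clm_apply continuous_const)

variable [CompleteSpace X]

/-- The coefficient `v ↦ ⟨(G(· + v) ∘ log)(A) x, x'⟩` of a spectrally truncated element. -/
noncomputable def orbitCoeff (A : X →ₗ.[ℂ] X) (β : ℝ) (hφ : IsDyadicPartition φ) (N : ℕ) (x : X)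
    (x' : X →L[ℂ] ℂ) (v : ℝ) : ℂ :=
  x' (schwartzCalc A β (smoothMul (contDiff_comp_add hG v) (hasCompactSupport_dyadSum hφ N)) x)

/-- On a bounded range of `v`, the function `G (· + v)` may be truncated to a Schwartz function without
affecting the orbit coefficient. -/
theorem orbitCoeff_eq (hA : IsZeroSectorial A) (hβ : 0 ≤ β)
    (hcalc : HasSobolevCalculus A β) (hφ : IsDyadicPartition φ) {y : X} {N : ℕ}
    (hN : schwartzCalc A β (dyadSum hφ N) (cauchyIntegral A (Real.pi / 2) rho y) =
      cauchyIntegral A (Real.pi / 2) rho y) (x' : X →L[ℂ] ℂ) {k : ℕ} {v : ℝ}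
    (hv : (N + 1) * Real.log 2 + |v| ≤ k) :
    orbitCoeff hG A β hφ N (cauchyIntegral A (Real.pi / 2) rho y) x' v =
      ∫ ξ : ℝ, Complex.exp (2 * Real.pi * ξ * v * Complex.I) *
        (𝓕 (smoothCutoff hG k) ξ * x' (regImagPow A (2 * Real.pi * ξ) y)) := by
  have h1 : schwartzCalc A β (smoothMul (contDiff_comp_add hG v) (hasCompactSupport_dyadSum hφ N))
      (cauchyIntegral A (Real.pi / 2) rho y) = schwartzCalc A β (translate v (smoothCutoff hG k))
        (cauchyIntegral A (Real.pi / 2) rho y) := by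
    conv_rhs => rw [← hN]
    refine (schwartzCalc_apply_apply hA hβ hcalc (fun u => ?_) _).symm
    rw [smoothMul_apply, translate_apply]
    by_cases hu : dyadSum hφ N u = 0
    · rw [hu, mul_zero, mul_zero]
    · have h2 : |u| ≤ (N + 1) * Real.log 2 := by
        by_contra! h
        exact hu (dyadSum_eq_zero hφ h)
      rw [smoothCutoff_eq hG]
      linarith [abs_add_le u v]
  rw [orbitCoeff, h1, apply_schwartzCalc_rho hA hβ hcalc]
  simp_rw [fourier_translate, mul_assoc]

theorem exists_bound_apply_regImagPow (hA : IsZeroSectorial A) (hβ : 0 ≤ β)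
    (hcalc : HasSobolevCalculus A β) (y : X) (x' : X →L[ℂ] ℂ) :
    ∃ C : ℝ, ∀ ξ : ℝ, ‖x' (regImagPow A (2 * Real.pi * ξ) y)‖ ≤ C * (1 + |ξ|) ^ β := by
  obtain ⟨C, hC0, hC⟩ := exists_bound_regImagPow hA hβ hcalc
  refine ⟨‖x'‖ * C * ‖y‖, fun ξ => (x'.le_opNorm _).trans ?_⟩
  calc ‖x'‖ * ‖regImagPow A (2 * Real.pi * ξ) y‖ ≤ ‖x'‖ * (C * (1 + |ξ|) ^ β * ‖y‖) := by
        gcongr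
        exact (ContinuousLinearMap.le_opNorm _ _).trans (by gcongr; exact hC ξ)
    _ = _ := by ring

theorem integrable_schwartz_mul_coeff (hA : IsZeroSectorial A) (hβ : 0 ≤ β)
    (hcalc : HasSobolevCalculus A β) (F : 𝓢(ℝ, ℂ)) (y : X) (x' : X →L[ℂ] ℂ) :
    Integrable fun ξ : ℝ => F ξ * x' (regImagPow A (2 * Real.pi * ξ) y) := by
  obtain ⟨C, hC⟩ := exists_bound_apply_regImagPow hA hβ hcalc y x'
  exact integrable_schwartz_smul F (continuous_apply_regImagPow hA y x') hC

theorem continuous_orbitCoeff (hA : IsZeroSectorial A) (hβ : 0 ≤ β)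
    (hcalc : HasSobolevCalculus A β) (hφ : IsDyadicPartition φ) {y : X} {N : ℕ}
    (hN : schwartzCalc A β (dyadSum hφ N) (cauchyIntegral A (Real.pi / 2) rho y) =
      cauchyIntegral A (Real.pi / 2) rho y) (x' : X →L[ℂ] ℂ) :
    Continuous (orbitCoeff hG A β hφ N (cauchyIntegral A (Real.pi / 2) rho y) x') := by
  refine continuous_iff_continuousAt.2 fun v₀ => ?_
  obtain ⟨k, hk⟩ := exists_nat_ge ((N + 1) * Real.log 2 + (|v₀| + 1))
  have hcont : Continuous fun v : ℝ => ∫ ξ : ℝ, Complex.exp (2 * Real.pi * ξ * v * Complex.I) *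
      (𝓕 (smoothCutoff hG k) ξ * x' (regImagPow A (2 * Real.pi * ξ) y)) := by
    have hi := integrable_schwartz_mul_coeff hA hβ hcalc (𝓕 (smoothCutoff hG k)) y x'
    refine continuous_of_dominated (fun v => ?_) (fun v => ae_of_all _ fun ξ => ?_) hi.norm
      (ae_of_all _ fun ξ => by fun_prop)
    · exact AEStronglyMeasurable.mul (Continuous.aestronglyMeasurable (by fun_prop))
        hi.aestronglyMeasurable
    · rw [norm_mul, Complex.norm_exp]
      simp
  refine hcont.continuousAt.congr ?_
  filter_upwards [Metric.ball_mem_nhds v₀ one_pos] with v hv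
  refine (orbitCoeff_eq hG hA hβ hcalc hφ hN x' ?_).symm
  rw [Metric.mem_ball, Real.dist_eq] at hv
  linarith [abs_sub_abs_le_abs_sub v v₀]

/-- In the sense of distributions, the Fourier transform of the orbit coefficient is the product of
`𝓕 G` and the matrix coefficient of the imaginary powers. -/
theorem integral_orbitCoeff_mul (hA : IsZeroSectorial A) (hβ : 0 ≤ β)
    (hcalc : HasSobolevCalculus A β) (hφ : IsDyadicPartition φ) (hGi : Integrable G) {y : X} {N : ℕ}
    (hN : schwartzCalc A β (dyadSum hφ N) (cauchyIntegral A (Real.pi / 2) rho y) =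
      cauchyIntegral A (Real.pi / 2) rho y) (x' : X →L[ℂ] ℂ) {η : 𝓢(ℝ, ℂ)}
    (hη : HasCompactSupport η) :
    ∫ v : ℝ, orbitCoeff hG A β hφ N (cauchyIntegral A (Real.pi / 2) rho y) x' v * η v =
      ∫ ξ : ℝ, 𝓕 G ξ * x' (regImagPow A (2 * Real.pi * ξ) y) * 𝓕⁻ η ξ := by
  obtain ⟨R, hR⟩ := hη.isCompact.isBounded.subset_closedBall 0
  have hRη : ∀ v, η v ≠ 0 → |v| ≤ R := fun v hv => by
    simpa using hR (subset_tsupport _ (Function.mem_support.2 hv))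
  set κ : ℝ → ℂ := fun ξ => x' (regImagPow A (2 * Real.pi * ξ) y) with hκ
  -- for the truncation of `G` the formula is Fubini's theorem; then the truncation is removed
  have hstep : ∀ k : ℕ, (N + 1) * Real.log 2 + R ≤ k →
      ∫ v : ℝ, orbitCoeff hG A β hφ N (cauchyIntegral A (Real.pi / 2) rho y) x' v * η v =
        ∫ ξ : ℝ, 𝓕 (smoothCutoff hG k) ξ * κ ξ * 𝓕⁻ η ξ := by
    intro k hk
    have hi : Integrable fun ξ => 𝓕 (smoothCutoff hG k) ξ * κ ξ :=
      integrable_schwartz_mul_coeff hA hβ hcalc (𝓕 (smoothCutoff hG k)) y x'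
    have h1 : ∀ v, orbitCoeff hG A β hφ N (cauchyIntegral A (Real.pi / 2) rho y) x' v * η v =
        ∫ ξ : ℝ, Complex.exp (2 * Real.pi * ξ * v * Complex.I) *
          (𝓕 (smoothCutoff hG k) ξ * κ ξ) * η v := by
      intro v
      by_cases hv : η v = 0
      · simp [hv]
      · rw [orbitCoeff_eq hG hA hβ hcalc hφ hN x' (k := k) (by linarith [hRη v hv]),
          integral_mul_const]
    simp_rw [h1]
    rw [integral_integral_swap]
    · congr 1
      ext1 ξ
      rw [schwartz_fourierInv_apply, ← integral_const_mul]
      congr 1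
      ext1 v
      have : (2 * Real.pi * v * ξ * Complex.I : ℂ) = 2 * Real.pi * ξ * v * Complex.I := by ring
      rw [this]
      ring
    · refine (η.integrable.norm.mul_prod hi.norm).mono' ?_ (ae_of_all _ fun p => ?_)
      · refine AEStronglyMeasurable.mul (AEStronglyMeasurable.mul
          (Continuous.aestronglyMeasurable (by fun_prop)) hi.aestronglyMeasurable.comp_snd)
          (η.continuous.comp continuous_fst).aestronglyMeasurable
      · simp only [Function.uncurry]
        rw [norm_mul, norm_mul, Complex.norm_exp]
        simp [mul_comm]
  have hi : Integrable fun ξ => 𝓕⁻ η ξ * κ ξ :=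
    integrable_schwartz_mul_coeff hA hβ hcalc (𝓕⁻ η) y x'
  have hlim : Tendsto (fun k => ∫ ξ : ℝ, 𝓕 (smoothCutoff hG k) ξ * κ ξ * 𝓕⁻ η ξ) atTop
      (𝓝 (∫ ξ : ℝ, 𝓕 G ξ * κ ξ * 𝓕⁻ η ξ)) := by
    refine tendsto_integral_of_dominated_convergence (fun ξ => (∫ u, ‖G u‖) * ‖𝓕⁻ η ξ * κ ξ‖)
      (fun k => ?_) (hi.norm.const_mul _) (fun k => ae_of_all _ fun ξ => ?_)
      (ae_of_all _ fun ξ => ?_)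
    · exact ((((𝓕 (smoothCutoff hG k)).continuous).mul
        (continuous_apply_regImagPow hA y x')).mul (𝓕⁻ η).continuous).aestronglyMeasurable
    · rw [mul_assoc, norm_mul, mul_comm (κ ξ)]
      gcongr
      rw [SchwartzMap.fourier_coe]
      exact norm_fourier_le_of_norm_le hGi (norm_smoothCutoff_le hG k) ξ
    · exact ((tendsto_fourier_smoothCutoff hG hGi ξ).mul_const _).mul_const _
  refine tendsto_nhds_unique ?_ hlim
  obtain ⟨k₀, hk₀⟩ := exists_nat_ge ((N + 1) * Real.log 2 + R)
  refine tendsto_const_nhds.congr' ?_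
  filter_upwards [eventually_ge_atTop k₀] with k hk
  refine hstep k (hk₀.trans ?_)
  exact_mod_cast hk

end Weak

/-! ### The Mellin transform of a truncated exponential -/

section TailExp

/-- The exponential function minus its Taylor polynomial with `n` terms. -/
noncomputable def tailExp (n : ℕ) (w : ℂ) : ℂ :=
  Complex.exp w - ∑ j ∈ Finset.range n, w ^ j / (j.factorial : ℂ)

theorem tailExp_zero (w : ℂ) : tailExp 0 w = Complex.exp w := by simp [tailExp]

theorem tailExp_succ (n : ℕ) (w : ℂ) :
    tailExp (n + 1) w = tailExp n w - w ^ n / (n.factorial : ℂ) := by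
  rw [tailExp, tailExp, Finset.sum_range_succ, sub_add_eq_sub_sub]

theorem tailExp_succ_apply_zero (n : ℕ) : tailExp (n + 1) 0 = 0 := by
  rw [tailExp, Finset.sum_range_succ']
  simp

theorem hasDerivAt_tailExp_succ (n : ℕ) (w : ℂ) :
    HasDerivAt (tailExp (n + 1)) (tailExp n w) w := by
  induction n with
  | zero =>
    have h : HasDerivAt (fun w => Complex.exp w - 1) (Complex.exp w) w :=
      (Complex.hasDerivAt_exp w).sub_const 1
    rw [tailExp_zero]
    refine h.congr_of_eventuallyEq (Eventually.of_forall fun v => ?_)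
    simp [tailExp]
  | succ n ih =>
    have h : HasDerivAt (fun w => tailExp (n + 1) w - w ^ (n + 1) / ((n + 1).factorial : ℂ))
        (tailExp n w - ((n + 1 : ℕ) * w ^ n) / ((n + 1).factorial : ℂ)) w :=
      ih.sub ((hasDerivAt_pow (n + 1) w).div_const _)
    rw [tailExp_succ]
    convert! h using 1
    · ext v; exact tailExp_succ (n + 1) v
    · congr 1
      rw [Nat.factorial_succ]
      have h1 : ((n + 1 : ℕ) : ℂ) ≠ 0 := by exact_mod_cast n.succ_ne_zero
      have h2 : (n.factorial : ℂ) ≠ 0 := by exact_mod_cast n.factorial_ne_zero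
      push_cast at h1 ⊢
      field_simp

theorem contDiff_tailExp (n : ℕ) : ContDiff ℂ ((⊤ : ℕ∞) : WithTop ℕ∞) (tailExp n) := by
  unfold tailExp
  fun_prop

theorem norm_tailExp_le (n : ℕ) {w : ℂ} (hw : w.re ≤ 0) : ‖tailExp n w‖ ≤ ‖w‖ ^ n / n.factorial := by
  induction n generalizing w with
  | zero =>
    rw [tailExp_zero, Complex.norm_exp]
    simpa using hw
  | succ n ih =>
    have hd : ∀ t : ℝ, HasDerivAt (fun t : ℝ => tailExp (n + 1) (t * w)) (tailExp n (t * w) * w) t :=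
      fun t => by
        have h1 : HasDerivAt (fun t : ℝ => (t : ℂ) * w) w t := by
          simpa using (Complex.ofRealCLM.hasDerivAt (x := t)).mul_const w
        exact (hasDerivAt_tailExp_succ n (t * w)).comp t h1
    have hB : ∀ t : ℝ, HasDerivAt (fun t : ℝ => t ^ (n + 1) * (‖w‖ ^ (n + 1) / (n + 1).factorial))
        (t ^ n * ‖w‖ ^ n / n.factorial * ‖w‖) t := fun t => by
      convert! (hasDerivAt_pow (n + 1) t).mul_const (‖w‖ ^ (n + 1) / ((n + 1).factorial : ℝ)) using 1
      rw [Nat.factorial_succ]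
      have h2 : (n.factorial : ℝ) ≠ 0 := by exact_mod_cast n.factorial_ne_zero
      push_cast
      field_simp
      ring
    have h := image_norm_le_of_norm_deriv_right_le_deriv_boundary (a := 0) (b := 1)
      (f := fun t : ℝ => tailExp (n + 1) (t * w))
      (f' := fun t : ℝ => tailExp n (t * w) * w)
      (B := fun t : ℝ => t ^ (n + 1) * (‖w‖ ^ (n + 1) / (n + 1).factorial))
      (B' := fun t : ℝ => t ^ n * ‖w‖ ^ n / n.factorial * ‖w‖)
      (fun t _ => (hd t).continuousAt.continuousWithinAt) (fun t _ => (hd t).hasDerivWithinAt)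
      (by simp [tailExp_succ_apply_zero]) hB (fun t ht => by
        have h1 := ih (w := (t : ℂ) * w) (by
          simpa using mul_nonpos_of_nonneg_of_nonpos ht.1 hw)
        rw [norm_mul]
        gcongr
        rwa [norm_mul, Complex.norm_real, Real.norm_of_nonneg ht.1, mul_pow] at h1)
      (right_mem_Icc.2 zero_le_one)
    simpa using h

theorem norm_tailExp_succ_le (n : ℕ) {w : ℂ} (hw : w.re ≤ 0) :
    ‖tailExp (n + 1) w‖ ≤ 2 * (‖w‖ ^ n / n.factorial) := by
  rw [tailExp_succ]
  refine (norm_sub_le _ _).trans ?_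
  have := norm_tailExp_le n hw
  rw [norm_div, norm_pow, Complex.norm_natCast]
  linarith

/-- The integrand `e^{zu} E(-r e^u)` of the Mellin transform of a truncated exponential, in the
logarithmic variable. -/
noncomputable def tailIntegrand (n : ℕ) (z r : ℂ) (u : ℝ) : ℂ :=
  Complex.exp (z * u) * tailExp n (-(r * Real.exp u))

theorem continuous_tailIntegrand (n : ℕ) (z r : ℂ) : Continuous (tailIntegrand n z r) := by
  have := (contDiff_tailExp n).continuous
  unfold tailIntegrand
  fun_prop

theorem norm_tailIntegrand_le {n : ℕ} {z r : ℂ} {k : ℝ} {C : ℝ} {u : ℝ}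
    (h : ‖tailExp n (-(r * Real.exp u))‖ ≤ C * Real.exp (k * u)) :
    ‖tailIntegrand n z r u‖ ≤ C * Real.exp ((z.re + k) * u) := by
  rw [tailIntegrand, norm_mul, Complex.norm_exp]
  have h1 : (z * u).re = z.re * u := by simp
  rw [h1, add_mul, Real.exp_add]
  calc _ ≤ Real.exp (z.re * u) * (C * Real.exp (k * u)) := by gcongr
    _ = _ := by ring

theorem neg_mul_exp_re_le {r : ℂ} (hr : 0 ≤ r.re) (u : ℝ) : (-(r * Real.exp u)).re ≤ 0 := by
  have : (-(r * Real.exp u)).re = -(r.re * Real.exp u) := by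
    rw [Complex.neg_re, Complex.re_mul_ofReal]
  rw [this]
  have := Real.exp_pos u
  nlinarith [mul_nonneg hr this.le]

theorem norm_mul_exp_pow (r : ℂ) (u : ℝ) (n : ℕ) :
    ‖-(r * Real.exp u)‖ ^ n = ‖r‖ ^ n * Real.exp (n * u) := by
  rw [norm_neg, norm_mul, Complex.norm_real, Real.norm_of_nonneg (Real.exp_pos u).le, mul_pow,
    Real.exp_nat_mul]

theorem le_exp_neg_abs_of_le {c a b C u : ℝ} (hC : 0 ≤ C) (h1 : c ≤ C * Real.exp (a * u))
    (h2 : c ≤ C * Real.exp (b * u)) :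
    c ≤ C * Real.exp (-(min a (-b) * |u|)) := by
  rcases le_total 0 u with hu | hu
  · refine h2.trans ?_
    gcongr
    rw [abs_of_nonneg hu]
    nlinarith [min_le_right a (-b)]
  · refine h1.trans ?_
    gcongr
    rw [abs_of_nonpos hu]
    nlinarith [min_le_left a (-b)]

/-- Exponential decay of the integrand in the strip `-(n+1) < Re z < -n`, uniformly for bounded
`r` in the closed right half plane. -/
theorem norm_tailIntegrand_succ_le {n : ℕ} {z : ℂ} (h1 : -((n : ℝ) + 1) < z.re) (h2 : z.re < -n)
    {R : ℝ} (hR : 1 ≤ R) {r : ℂ} (hr : 0 ≤ r.re) (hrR : ‖r‖ ≤ R) (u : ℝ) :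
    ‖tailIntegrand (n + 1) z r u‖ ≤
      2 * R ^ (n + 1) * Real.exp (-(min (z.re + (n + 1)) (-(z.re + n)) * |u|)) := by
  have hfac : ∀ k : ℕ, (1 : ℝ) ≤ k.factorial := fun k => by exact_mod_cast k.factorial_pos
  have hw := neg_mul_exp_re_le hr u
  refine le_exp_neg_abs_of_le (by positivity) (norm_tailIntegrand_le ?_)
    (norm_tailIntegrand_le ?_)
  · refine (norm_tailExp_le (n + 1) hw).trans ?_
    rw [norm_mul_exp_pow]
    refine (div_le_self (by positivity) (hfac _)).trans ?_
    push_cast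
    gcongr
    calc ‖r‖ ^ (n + 1) ≤ R ^ (n + 1) := by gcongr
      _ ≤ 2 * R ^ (n + 1) := by linarith [pow_pos (by linarith : 0 < R) (n + 1)]
  · refine (norm_tailExp_succ_le n hw).trans ?_
    rw [norm_mul_exp_pow, mul_assoc]
    refine mul_le_mul_of_nonneg_left ((div_le_self (by positivity) (hfac _)).trans ?_) zero_le_two
    gcongr
    calc ‖r‖ ^ n ≤ R ^ n := by gcongr
      _ ≤ R ^ (n + 1) := pow_le_pow_right₀ hR n.le_succ

theorem integrable_tailIntegrand_succ {n : ℕ} {z : ℂ} (h1 : -((n : ℝ) + 1) < z.re) (h2 : z.re < -n)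
    {r : ℂ} (hr : 0 ≤ r.re) : Integrable (tailIntegrand (n + 1) z r) :=
  integrable_of_continuous_of_exp_decay (continuous_tailIntegrand _ _ _) (R := 0)
    (lt_min (by linarith) (by linarith)) fun u _ =>
      norm_tailIntegrand_succ_le h1 h2 (le_max_left 1 ‖r‖) hr (le_max_right _ _) u

theorem norm_tailIntegrand_zero_le {z : ℂ} (h1 : 0 < z.re) (h2 : z.re < 1) {r : ℂ} (hr : 0 < r.re)
    (u : ℝ) : ‖tailIntegrand 0 z r u‖ ≤
      max 1 r.re⁻¹ * Real.exp (-(min (z.re + 0) (-(z.re + -1)) * |u|)) := by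
  have hw := neg_mul_exp_re_le hr.le u
  refine le_exp_neg_abs_of_le (by positivity) (norm_tailIntegrand_le ?_)
    (norm_tailIntegrand_le ?_)
  · refine (norm_tailExp_le 0 hw).trans ?_
    simp
  · rw [tailExp_zero, Complex.norm_exp, Complex.neg_re, Complex.re_mul_ofReal, neg_one_mul]
    have hpos : 0 < r.re * Real.exp u := by positivity
    have h3 : Real.exp (-(r.re * Real.exp u)) ≤ (r.re * Real.exp u)⁻¹ := by
      rw [Real.exp_neg]
      exact inv_anti₀ hpos (by linarith [Real.add_one_le_exp (r.re * Real.exp u)])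
    refine h3.trans ?_
    rw [mul_inv, Real.exp_neg]
    gcongr
    exact le_max_right _ _

theorem integrable_tailIntegrand {n : ℕ} {z : ℂ} (h1 : -(n : ℝ) < z.re) (h2 : z.re < 1 - n)
    {r : ℂ} (hr : 0 < r.re) : Integrable (tailIntegrand n z r) := by
  cases n with
  | zero =>
    have h1' : 0 < z.re := by simpa using h1
    have h2' : z.re < 1 := by simpa using h2
    exact integrable_of_continuous_of_exp_decay (continuous_tailIntegrand _ _ _) (R := 0)
      (lt_min (by linarith) (by linarith)) fun u _ => norm_tailIntegrand_zero_le h1' h2' hr u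
  | succ n =>
    push_cast at h1 h2
    exact integrable_tailIntegrand_succ h1 (by linarith) hr.le

theorem hasDerivAt_tailIntegrand_succ (n : ℕ) (z r : ℂ) (u : ℝ) :
    HasDerivAt (tailIntegrand (n + 1) z r)
      (z * tailIntegrand (n + 1) z r u - r * tailIntegrand n (z + 1) r u) u := by
  have h1 : HasDerivAt (fun u : ℝ => Complex.exp (z * u)) (Complex.exp (z * u) * z) u := by
    have : HasDerivAt (fun u : ℝ => z * (u : ℂ)) z u := by
      simpa using (Complex.ofRealCLM.hasDerivAt (x := u)).const_mul z
    exact this.cexp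
  have h2 : HasDerivAt (fun u : ℝ => -(r * (Real.exp u : ℂ))) (-(r * (Real.exp u : ℂ))) u :=
    ((Real.hasDerivAt_exp u).ofReal_comp.const_mul r).neg
  have h3 := (hasDerivAt_tailExp_succ n (-(r * Real.exp u))).comp u h2
  convert! h1.mul h3 using 1
  rw [tailIntegrand, tailIntegrand, add_mul, Complex.exp_add, one_mul, Complex.ofReal_exp]
  simp only [Function.comp]
  rw [Complex.ofReal_exp]
  ring

/-- Rotating the ray of integration in the Gamma integral. -/
theorem integral_tailIntegrand_zero {z : ℂ} (h1 : 0 < z.re) (h2 : z.re < 1) {r : ℂ}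
    (hr : 0 < r.re) : ∫ u, tailIntegrand 0 z r u = (1 / r) ^ z * Complex.Gamma z := by
  have hpi := Real.pi_pos
  have hr0 : r ≠ 0 := by rintro rfl; simp at hr
  set θ := r.arg with hθ
  set l := Real.log ‖r‖ with hl
  have hθ2 : |θ| < Real.pi / 2 := Complex.abs_arg_lt_pi_div_two_iff.2 (Or.inl hr)
  have hrexp : r = Complex.exp (l + θ * Complex.I) := by
    rw [Complex.exp_add, hl, ← Complex.ofReal_exp, Real.exp_log (norm_pos_iff.2 hr0),
      Complex.norm_mul_exp_arg_mul_I]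
  -- in the logarithmic variable the ray through `r` is the horizontal line at height `arg r`
  let F : ℂ → ℂ := fun w => Complex.exp (z * w) * Complex.exp (-Complex.exp w)
  have hF : ∀ x y : ℝ, F (x + y * Complex.I) = Complex.exp (z * (y * Complex.I)) *
      tailIntegrand 0 z (Complex.exp (y * Complex.I)) x := by
    intro x y
    simp only [F]
    rw [tailIntegrand, tailExp_zero, mul_add, Complex.exp_add, Complex.exp_add (x : ℂ),
      Complex.ofReal_exp, mul_comm (Complex.exp (x : ℂ))]
    ring
  have hcos : ∀ y : ℝ, y ∈ uIcc 0 θ → Real.cos θ ≤ (Complex.exp (y * Complex.I)).re ∧ |y| ≤ |θ| := by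
    intro y hy
    have hy' : |y| ≤ |θ| := by
      rcases le_total 0 θ with h | h
      · rw [uIcc_of_le h] at hy
        rw [abs_of_nonneg h, abs_of_nonneg hy.1]
        exact hy.2
      · rw [uIcc_of_ge h] at hy
        rw [abs_of_nonpos h, abs_of_nonpos hy.2]
        linarith [hy.1]
    refine ⟨?_, hy'⟩
    rw [Complex.exp_ofReal_mul_I_re, ← Real.cos_abs θ, ← Real.cos_abs y]
    exact Real.cos_le_cos_of_nonneg_of_le_pi (abs_nonneg _) (by linarith) hy'
  have hcosθ : 0 < Real.cos θ :=
    Real.cos_pos_of_mem_Ioo ⟨by linarith [abs_lt.1 hθ2], by linarith [abs_lt.1 hθ2]⟩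
  have hshift := integral_horizontal_eq (F := F) (a := 0) (b := θ) (R := 0)
    (C := Real.exp (‖z‖ * |θ|) * max 1 (Real.cos θ)⁻¹)
    (ε := min (z.re + 0) (-(z.re + -1)))
    (fun w _ => by fun_prop) (lt_min (by linarith) (by linarith)) (fun w hw _ => by
      obtain ⟨hc, hy⟩ := hcos w.im hw
      have hb := norm_tailIntegrand_zero_le h1 h2 (r := Complex.exp (w.im * Complex.I))
        (hcosθ.trans_le hc) w.re
      rw [← Complex.re_add_im w, hF, norm_mul, Complex.re_add_im, mul_assoc]
      refine mul_le_mul ?_ (hb.trans ?_) (norm_nonneg _) (Real.exp_pos _).le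
      · refine (Complex.norm_exp_le_exp_norm _).trans ?_
        rw [Real.exp_le_exp, norm_mul, norm_mul, Complex.norm_I, mul_one, Complex.norm_real,
          Real.norm_eq_abs]
        gcongr
      · gcongr)
  have hzero : ∫ x : ℝ, F (x + (0 : ℝ) * Complex.I) = Complex.Gamma z := by
    rw [Complex.Gamma_eq_integral h1, Complex.GammaIntegral, integral_Ioi_eq_integral_exp]
    congr 1
    ext1 u
    simp only [F]
    have h3 : Complex.exp (z * u) = Complex.exp u * Complex.exp (u * (z - 1)) := by
      rw [← Complex.exp_add]; congr 1; ring
    rw [Complex.real_smul, Complex.ofReal_zero, zero_mul, add_zero, Complex.ofReal_exp,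
      Complex.ofReal_exp, exp_cpow (by simpa using Real.pi_pos), h3, Complex.ofReal_neg,
      Complex.ofReal_exp]
    ring
  have htrans : ∀ u : ℝ, tailIntegrand 0 z r u =
      (1 / r) ^ z * F (((u + l : ℝ) : ℂ) + θ * Complex.I) := by
    intro u
    have h3 : (1 / r) ^ z = Complex.exp (-(l + θ * Complex.I) * z) := by
      rw [one_div, hrexp, ← Complex.exp_neg, exp_cpow]
      simpa using hθ2.trans (by linarith)
    simp only [F]
    rw [h3, ← mul_assoc, ← Complex.exp_add, tailIntegrand, tailExp_zero]
    congr 2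
    · push_cast; ring
    · congr 1
      rw [hrexp, Complex.ofReal_exp, ← Complex.exp_add]
      congr 1
      push_cast; ring
  simp_rw [htrans]
  rw [integral_const_mul, integral_add_right_eq_self
    (fun u : ℝ => F ((u : ℂ) + θ * Complex.I)) l, ← hshift, hzero]

/-- Integration by parts lowers the number of subtracted Taylor terms. -/
theorem integral_tailIntegrand (n : ℕ) {z : ℂ} (h1 : -(n : ℝ) < z.re) (h2 : z.re < 1 - n)
    {r : ℂ} (hr : 0 < r.re) : ∫ u, tailIntegrand n z r u = (1 / r) ^ z * Complex.Gamma z := by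
  induction n generalizing z with
  | zero => exact integral_tailIntegrand_zero (by simpa using h1) (by simpa using h2) hr
  | succ n ih =>
    push_cast at h1 h2
    have h2' : z.re < -n := by linarith
    have hz : z ≠ 0 := by
      rintro rfl
      have : (0 : ℝ) ≤ n := n.cast_nonneg
      rw [Complex.zero_re] at h2'
      linarith
    have hr0 : r ≠ 0 := by rintro rfl; simp at hr
    have hi1 := integrable_tailIntegrand_succ h1 h2' hr.le
    have hz1 : (z + 1).re = z.re + 1 := by simp
    have hi2 : Integrable (tailIntegrand n (z + 1) r) :=
      integrable_tailIntegrand (by rw [hz1]; linarith) (by rw [hz1]; linarith) hr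
    have hdecay := norm_tailIntegrand_succ_le h1 h2' (le_max_left 1 ‖r‖) hr.le (le_max_right _ _)
    set ε := min (z.re + (n + 1)) (-(z.re + n)) with hε
    have hε0 : 0 < ε := lt_min (by linarith) (by linarith)
    have hlim : ∀ l : Filter ℝ, Tendsto (fun u : ℝ => |u|) l atTop →
        Tendsto (tailIntegrand (n + 1) z r) l (𝓝 0) := fun l hl => by
      refine squeeze_zero_norm hdecay ?_
      have : Tendsto (fun u : ℝ => Real.exp (-(ε * |u|))) l (𝓝 0) :=
        Real.tendsto_exp_neg_atTop_nhds_zero.comp (hl.const_mul_atTop hε0)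
      simpa using this.const_mul _
    have hint := integral_of_hasDerivAt_of_tendsto (hasDerivAt_tailIntegrand_succ n z r)
      ((hi1.const_mul z).sub (hi2.const_mul r)) (hlim _ tendsto_abs_atBot_atTop)
      (hlim _ tendsto_abs_atTop_atTop)
    rw [integral_sub (hi1.const_mul z) (hi2.const_mul r), integral_const_mul, integral_const_mul,
      ih (by rw [hz1]; linarith) (by rw [hz1]; linarith), Complex.Gamma_add_one z hz,
      Complex.cpow_add _ _ (one_div_ne_zero hr0), Complex.cpow_one] at hint
    have h3 : z * (∫ u, tailIntegrand (n + 1) z r u) = z * ((1 / r) ^ z * Complex.Gamma z) := by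
      have h4 : r * ((1 / r) ^ z * (1 / r) * (z * Complex.Gamma z)) =
          z * ((1 / r) ^ z * Complex.Gamma z) := by field_simp
      rw [h4] at hint
      linear_combination hint
    exact mul_left_cancel₀ hz h3

/-- The Mellin transform of `e^{is}` minus a Taylor polynomial, as the boundary value `r → -i`. -/
theorem integral_tailIntegrand_neg_I (n : ℕ) {z : ℂ} (h1 : -((n : ℝ) + 1) < z.re)
    (h2 : z.re < -n) :
    ∫ u, tailIntegrand (n + 1) z (-Complex.I) u = Complex.I ^ z * Complex.Gamma z := by
  -- `norm_tailIntegrand_succ_le` dominates the integrands up to the imaginary axis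
  set r : ℝ → ℂ := fun δ => (δ : ℂ) - Complex.I with hr
  have hrc : Continuous r := by fun_prop
  have hr0 : r 0 = -Complex.I := by simp [hr]
  have hev : ∀ᶠ δ in 𝓝[>] (0 : ℝ), 0 < δ ∧ δ ≤ 1 := by
    filter_upwards [Ioo_mem_nhdsGT (zero_lt_one' ℝ)] with δ hδ using ⟨hδ.1, hδ.2.le⟩
  have hlim1 : Tendsto (fun δ => ∫ u, tailIntegrand (n + 1) z (r δ) u) (𝓝[>] 0)
      (𝓝 (∫ u, tailIntegrand (n + 1) z (-Complex.I) u)) := by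
    refine tendsto_integral_filter_of_dominated_convergence (fun u => 2 * 2 ^ (n + 1) *
      Real.exp (-(min (z.re + (n + 1)) (-(z.re + n)) * |u|)))
      (Eventually.of_forall fun δ => (continuous_tailIntegrand _ _ _).aestronglyMeasurable) ?_ ?_ ?_
    · filter_upwards [hev] with δ hδ
      refine ae_of_all _ fun u => norm_tailIntegrand_succ_le h1 h2 one_le_two ?_ ?_ u
      · simpa [hr] using hδ.1.le
      · refine (norm_sub_le _ _).trans ?_
        rw [Complex.norm_real, Real.norm_of_nonneg hδ.1.le, Complex.norm_I]
        linarith [hδ.2]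
    · refine integrable_of_continuous_of_exp_decay (by fun_prop) (R := 0)
        (C := 2 * 2 ^ (n + 1)) (ε := min (z.re + (n + 1)) (-(z.re + n)))
        (lt_min (by linarith) (by linarith)) fun u _ => ?_
      rw [Real.norm_of_nonneg (by positivity)]
    · refine ae_of_all _ fun u => ?_
      have hc := (contDiff_tailExp (n + 1)).continuous
      have : Continuous fun δ => tailIntegrand (n + 1) z (r δ) u := by
        unfold tailIntegrand
        fun_prop
      rw [← hr0]
      exact (this.tendsto 0).mono_left nhdsWithin_le_nhds
  have hlim2 : Tendsto (fun δ => (1 / r δ) ^ z * Complex.Gamma z) (𝓝[>] 0)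
      (𝓝 (Complex.I ^ z * Complex.Gamma z)) := by
    refine Tendsto.mul_const _ ?_
    have hI : (1 : ℂ) / r 0 = Complex.I := by rw [hr0]; simp
    have hc : ContinuousAt (fun δ => (1 / r δ) ^ z) 0 := by
      refine ContinuousAt.cpow (continuousAt_const.div hrc.continuousAt (by rw [hr0]; simp))
        continuousAt_const ?_
      rw [hI]
      exact Or.inr (by simp)
    have := hc.tendsto
    rw [hI] at this
    exact this.mono_left nhdsWithin_le_nhds
  refine tendsto_nhds_unique hlim1 (hlim2.congr' ?_)
  filter_upwards [hev] with δ hδ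
  refine (integral_tailIntegrand (n + 1) ?_ ?_ ?_).symm
  · push_cast; exact h1
  · push_cast; linarith
  · simpa [hr] using hδ.1

end TailExp

/-! ### The wave function in the logarithmic variable -/

section WaveExp

/-- The function `λ^{1/2} w_α(λ)` in the logarithmic variable `λ = e^u`. -/
noncomputable def waveExp (α : ℝ) (m : ℕ) (u : ℝ) : ℂ :=
  tailIntegrand (m + 1) (1 / 2 - α : ℝ) (-Complex.I) u

theorem contDiff_waveExp (α : ℝ) (m : ℕ) :
    ContDiff ℝ ((⊤ : ℕ∞) : WithTop ℕ∞) (waveExp α m) := by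
  have h1 : ContDiff ℝ ((⊤ : ℕ∞) : WithTop ℕ∞) (tailExp (m + 1)) :=
    (contDiff_tailExp (m + 1)).restrict_scalars ℝ
  have h2 : ContDiff ℝ ((⊤ : ℕ∞) : WithTop ℕ∞) fun u : ℝ => (u : ℂ) := Complex.ofRealCLM.contDiff
  have h3 : ContDiff ℝ ((⊤ : ℕ∞) : WithTop ℕ∞) fun u : ℝ => (Real.exp u : ℂ) :=
    Complex.ofRealCLM.contDiff.comp Real.contDiff_exp
  unfold waveExp tailIntegrand
  exact ((contDiff_const.mul h2).cexp).mul (h1.comp (contDiff_const.mul h3).neg)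

variable {α : ℝ} {m : ℕ}

theorem integrable_waveExp (hα : α - 1 / 2 ∈ Ioo (m : ℝ) (m + 1)) : Integrable (waveExp α m) := by
  refine integrable_tailIntegrand_succ ?_ ?_ (by simp)
  · rw [Complex.ofReal_re]; linarith [hα.2]
  · rw [Complex.ofReal_re]; linarith [hα.1]

theorem fourier_waveExp (hα : α - 1 / 2 ∈ Ioo (m : ℝ) (m + 1)) (ξ : ℝ) :
    𝓕 (waveExp α m) ξ = Complex.I ^ (-(α : ℂ) + 1 / 2 + Complex.I * ((-(2 * Real.pi * ξ) : ℝ) : ℂ)) *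
      Complex.Gamma (-(α : ℂ) + 1 / 2 + Complex.I * ((-(2 * Real.pi * ξ) : ℝ) : ℂ)) := by
  have hre : (-(α : ℂ) + 1 / 2 + Complex.I * ((-(2 * Real.pi * ξ) : ℝ) : ℂ)).re = 1 / 2 - α := by
    have : (-(α : ℂ) + 1 / 2 + Complex.I * ((-(2 * Real.pi * ξ) : ℝ) : ℂ)) =
        ((1 / 2 - α : ℝ) : ℂ) + ((-(2 * Real.pi * ξ) : ℝ) : ℂ) * Complex.I := by push_cast; ring
    rw [this]
    simp only [Complex.add_re, Complex.ofReal_re, Complex.re_ofReal_mul, Complex.I_re, mul_zero,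
      add_zero]
  rw [← integral_tailIntegrand_neg_I m (by rw [hre]; linarith [hα.2]) (by rw [hre]; linarith [hα.1]),
    fourier_apply]
  congr 1
  ext1 u
  rw [waveExp, tailIntegrand, tailIntegrand, ← mul_assoc, ← Complex.exp_add]
  congr 2
  push_cast; ring

theorem mul_waveFun_eq_waveExp (α : ℝ) (m : ℕ) {s : ℝ} (hs : 0 < s) (u : ℝ) :
    (((s * Real.exp u) ^ (1 / 2 : ℝ) : ℝ) : ℂ) * waveFun α m (s * Real.exp u) =
      waveExp α m (u + Real.log s) := by
  have h1 : s * Real.exp u = Real.exp (u + Real.log s) := by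
    rw [Real.exp_add, Real.exp_log hs, mul_comm]
  set v := u + Real.log s
  rw [h1, waveFun, waveExp, tailIntegrand, tailExp, ← mul_assoc]
  have h2 : (((Real.exp v) ^ (1 / 2 : ℝ) : ℝ) : ℂ) * ((|Real.exp v| ^ (-α) : ℝ) : ℂ) =
      Complex.exp (((1 / 2 - α : ℝ) : ℂ) * v) := by
    rw [abs_of_pos (Real.exp_pos v), ← Complex.ofReal_mul, ← Real.exp_mul, ← Real.exp_mul,
      ← Real.exp_add, Complex.ofReal_exp]
    congr 1
    push_cast; ring
  rw [h2]
  simp only [neg_mul, neg_neg]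

end WaveExp

/-! ### Decay of the Gamma function on vertical lines -/

section Gamma

/-- The reflection formula gives `|Γ(1 + it)|² = π t / sinh (π t)`. -/
theorem norm_sq_Gamma_one_add_mul_exp_le (t : ℝ) :
    ‖Complex.Gamma (1 + t * Complex.I)‖ ^ 2 * Real.exp (Real.pi * |t|) ≤ 1 + 2 * Real.pi * |t| := by
  have hpi := Real.pi_pos
  rcases eq_or_ne t 0 with rfl | ht
  · simp
  have ht' : (t : ℂ) * Complex.I ≠ 0 := mul_ne_zero (by exact_mod_cast ht) Complex.I_ne_zero
  have hconj : Complex.Gamma (1 - t * Complex.I) =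
      (starRingEnd ℂ) (Complex.Gamma (1 + t * Complex.I)) := by
    rw [← Complex.Gamma_conj]
    congr 1
    simp [sub_eq_add_neg]
  have h1 : ‖Complex.Gamma (1 + t * Complex.I)‖ ^ 2 =
      Real.pi * |t| / Real.sinh (Real.pi * |t|) := by
    have h2 : Complex.Gamma (1 + t * Complex.I) * Complex.Gamma (1 - t * Complex.I) =
        (t * Complex.I) * (Real.pi / (Complex.sinh (Real.pi * t) * Complex.I)) := by
      rw [add_comm, Complex.Gamma_add_one _ ht', mul_assoc, Complex.Gamma_mul_Gamma_one_sub,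
        ← mul_assoc (Real.pi : ℂ), Complex.sin_mul_I]
    have h3 : ‖Complex.Gamma (1 + t * Complex.I)‖ ^ 2 =
        ‖Complex.Gamma (1 + t * Complex.I) * Complex.Gamma (1 - t * Complex.I)‖ := by
      rw [hconj, norm_mul, RCLike.norm_conj, sq]
    rw [h3, h2]
    have h4 : Complex.sinh (Real.pi * t) = (Real.sinh (Real.pi * t) : ℝ) := by push_cast; rfl
    rw [h4]
    simp only [norm_mul, norm_div, Complex.norm_I, mul_one, Complex.norm_real, Real.norm_eq_abs,
      abs_of_pos hpi]
    rw [Real.abs_sinh, abs_mul, abs_of_pos hpi]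
    ring
  set x := Real.pi * |t| with hx
  have hx0 : 0 < x := mul_pos hpi (abs_pos.2 ht)
  have h5 : 2 * Real.pi * |t| = 2 * x := by rw [hx]; ring
  rw [h1, h5, div_mul_eq_mul_div, div_le_iff₀ (Real.sinh_pos_iff.2 hx0), Real.sinh_eq]
  have h6 : (1 + 2 * x) * Real.exp (-x) ≤ Real.exp x := by
    have : Real.exp x = Real.exp (2 * x) * Real.exp (-x) := by rw [← Real.exp_add]; congr 1; ring
    rw [this]
    gcongr
    linarith [Real.add_one_le_exp (2 * x)]
  nlinarith

/-- The Gamma function divided by the factor `z^{z - 1/2}` of Stirling's formula. The remaining factor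
`e^{-z}` of that formula has constant modulus on vertical lines. -/
noncomputable def gammaQuot (z : ℂ) : ℂ := Complex.Gamma z * z ^ (1 / 2 - z)

theorem norm_stirling_factor {z : ℂ} (hz : z ≠ 0) :
    ‖z ^ (1 / 2 - z)‖ = ‖z‖ ^ (1 / 2 - z.re) * Real.exp (z.im * z.arg) := by
  rw [Complex.norm_cpow_of_ne_zero hz, div_eq_mul_inv, ← Real.exp_neg]
  congr 2
  · simp
  · simp
    ring

theorem im_mul_arg_eq (z : ℂ) : z.im * z.arg = |z.im| * |z.arg| := by
  rcases le_total 0 z.im with h | h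
  · rw [abs_of_nonneg h, abs_of_nonneg (Complex.arg_nonneg_iff.2 h)]
  · rcases h.eq_or_lt with h | h
    · simp [h]
    · rw [abs_of_neg h, abs_of_neg (Complex.arg_neg_iff.2 h), neg_mul_neg]

theorem im_mul_arg_le {z : ℂ} (hz : 0 < z.re) : z.im * z.arg ≤ Real.pi / 2 * |z.im| := by
  rw [im_mul_arg_eq, mul_comm]
  gcongr
  exact (Complex.abs_arg_lt_pi_div_two_iff.2 (Or.inl hz)).le

theorem le_im_mul_arg {z : ℂ} (hz : 0 < z.re) :
    Real.pi / 2 * |z.im| - Real.pi / 2 * z.re ≤ z.im * z.arg := by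
  have hpi := Real.pi_pos
  have hz0 : z ≠ 0 := by rintro rfl; simp at hz
  have hn : 0 < ‖z‖ := norm_pos_iff.2 hz0
  have harg := Complex.abs_arg_lt_pi_div_two_iff.2 (Or.inl hz)
  have h1 := Real.mul_le_sin (x := Real.pi / 2 - |z.arg|) (by linarith)
    (by linarith [abs_nonneg z.arg])
  rw [Real.sin_pi_div_two_sub, Real.cos_abs, Complex.cos_arg hz0, div_mul_eq_mul_div,
    div_le_div_iff₀ hpi hn] at h1
  have h2 : |z.im| ≤ ‖z‖ := Complex.abs_im_le_norm z
  have h3 : |z.im| * (Real.pi / 2 - |z.arg|) ≤ ‖z‖ * (Real.pi / 2 - |z.arg|) := by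
    gcongr
  rw [im_mul_arg_eq]
  nlinarith

theorem norm_gammaQuot_le_of_re_eq_one {z : ℂ} (hz : z.re = 1) :
    ‖gammaQuot z‖ ≤ 1 + 2 * Real.pi := by
  have hpi := Real.pi_pos
  have hz0 : z ≠ 0 := by rintro rfl; simp at hz
  have hn1 : 1 ≤ ‖z‖ := by simpa [hz] using Complex.abs_re_le_norm z
  have hn2 : |z.im| ≤ ‖z‖ := Complex.abs_im_le_norm z
  have hzeq : z = 1 + z.im * Complex.I := by
    conv_lhs => rw [← Complex.re_add_im z, hz, Complex.ofReal_one]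
  have h1 := norm_sq_Gamma_one_add_mul_exp_le z.im
  rw [← hzeq] at h1
  have hsq : ‖gammaQuot z‖ ^ 2 ≤ 1 + 2 * Real.pi := by
    rw [gammaQuot, norm_mul, norm_stirling_factor hz0, hz, mul_pow, mul_pow,
      ← Real.rpow_natCast (‖z‖ ^ (1 / 2 - 1 : ℝ)), ← Real.rpow_mul (norm_nonneg z),
      ← Real.exp_nat_mul]
    have e1 : ((1 / 2 - 1 : ℝ) * ((2 : ℕ) : ℝ)) = -1 := by norm_num
    rw [e1, Real.rpow_neg_one]
    have h2 : Real.exp ((2 : ℕ) * (z.im * z.arg)) ≤ Real.exp (Real.pi * |z.im|) := by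
      rw [Real.exp_le_exp]
      have := im_mul_arg_le (z := z) (by rw [hz]; exact one_pos)
      push_cast
      linarith
    calc _ ≤ ‖Complex.Gamma z‖ ^ 2 * (‖z‖⁻¹ * Real.exp (Real.pi * |z.im|)) := by gcongr
      _ = (‖Complex.Gamma z‖ ^ 2 * Real.exp (Real.pi * |z.im|)) / ‖z‖ := by ring
      _ ≤ (1 + 2 * Real.pi * |z.im|) / ‖z‖ := by gcongr
      _ ≤ 1 + 2 * Real.pi := by
        rw [div_le_iff₀ (by linarith)]
        nlinarith
  nlinarith [norm_nonneg (gammaQuot z)]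

theorem norm_gammaQuot_le_of_re_eq_two {z : ℂ} (hz : z.re = 2) :
    ‖gammaQuot z‖ ≤ 1 + 2 * Real.pi := by
  have hpi := Real.pi_pos
  have hz0 : z ≠ 0 := by rintro rfl; simp at hz
  have hn1 : 2 ≤ ‖z‖ := by simpa [hz] using Complex.abs_re_le_norm z
  have hn2 : |z.im| ≤ ‖z‖ := Complex.abs_im_le_norm z
  have h10 : (1 : ℂ) + z.im * Complex.I ≠ 0 := fun h => by
    have := congrArg Complex.re h
    simp at this
  have hzeq : z = (1 + z.im * Complex.I) + 1 := by
    conv_lhs => rw [← Complex.re_add_im z, hz]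
    push_cast; ring
  have h1 := norm_sq_Gamma_one_add_mul_exp_le z.im
  have hG : Complex.Gamma z = (1 + z.im * Complex.I) * Complex.Gamma (1 + z.im * Complex.I) := by
    conv_lhs => rw [hzeq]
    exact Complex.Gamma_add_one _ h10
  have hle : ‖(1 : ℂ) + z.im * Complex.I‖ ≤ ‖z‖ := by
    rw [← sq_le_sq₀ (norm_nonneg _) (norm_nonneg _), Complex.sq_norm, Complex.sq_norm,
      Complex.normSq_apply, Complex.normSq_apply, hz]
    simp
    norm_num
  have hsq : ‖gammaQuot z‖ ^ 2 ≤ 1 + 2 * Real.pi := by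
    rw [gammaQuot, norm_mul, norm_stirling_factor hz0, hz, mul_pow, mul_pow, hG, norm_mul,
      ← Real.rpow_natCast (‖z‖ ^ (1 / 2 - 2 : ℝ)), ← Real.rpow_mul (norm_nonneg z),
      ← Real.exp_nat_mul]
    have e1 : ((1 / 2 - 2 : ℝ) * ((2 : ℕ) : ℝ)) = -((3 : ℕ) : ℝ) := by norm_num
    rw [e1, Real.rpow_neg (norm_nonneg z), Real.rpow_natCast]
    have h2 : Real.exp ((2 : ℕ) * (z.im * z.arg)) ≤ Real.exp (Real.pi * |z.im|) := by
      rw [Real.exp_le_exp]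
      have := im_mul_arg_le (z := z) (by rw [hz]; exact two_pos)
      push_cast
      linarith
    calc _ ≤ (‖z‖ * ‖Complex.Gamma (1 + z.im * Complex.I)‖) ^ 2 *
          ((‖z‖ ^ 3)⁻¹ * Real.exp (Real.pi * |z.im|)) := by gcongr
      _ = (‖Complex.Gamma (1 + z.im * Complex.I)‖ ^ 2 * Real.exp (Real.pi * |z.im|)) / ‖z‖ := by
        have : ‖z‖ ≠ 0 := by linarith
        field_simp
      _ ≤ (1 + 2 * Real.pi * |z.im|) / ‖z‖ := by gcongr
      _ ≤ 1 + 2 * Real.pi := by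
        rw [div_le_iff₀ (by linarith)]
        nlinarith
  nlinarith [norm_nonneg (gammaQuot z)]

theorem norm_Gamma_le_Gamma_re {z : ℂ} (hz : 0 < z.re) : ‖Complex.Gamma z‖ ≤ Real.Gamma z.re := by
  rw [Complex.Gamma_eq_integral hz, Real.Gamma_eq_integral hz, Complex.GammaIntegral]
  refine (norm_integral_le_integral_norm _).trans (le_of_eq ?_)
  refine setIntegral_congr_fun measurableSet_Ioi fun x (hx : 0 < x) => ?_
  simp only [norm_mul, Complex.norm_real, Real.norm_eq_abs, Real.abs_exp]
  rw [Complex.norm_cpow_eq_rpow_re_of_pos hx]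
  simp

theorem differentiableAt_gammaQuot {z : ℂ} (hz : 0 < z.re) : DifferentiableAt ℂ gammaQuot z := by
  refine (Complex.differentiableAt_Gamma z fun n h => ?_).mul ?_
  · rw [h] at hz
    simp at hz
    linarith [(Nat.cast_nonneg n : (0 : ℝ) ≤ n)]
  · exact DifferentiableAt.cpow differentiableAt_id (by fun_prop) (Or.inl hz)

/-- The Phragmén–Lindelöf principle extends the exact bounds on two lines to the strip. -/
theorem norm_gammaQuot_le {z : ℂ} (h1 : 1 ≤ z.re) (h2 : z.re ≤ 2) :
    ‖gammaQuot z‖ ≤ 1 + 2 * Real.pi := by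
  have hpi := Real.pi_pos
  refine PhragmenLindelof.vertical_strip (a := 1) (b := 2) (f := gammaQuot) ?_ ?_
    (fun z hz => norm_gammaQuot_le_of_re_eq_one hz) (fun z hz => norm_gammaQuot_le_of_re_eq_two hz)
    h1 h2
  · refine DifferentiableOn.diffContOnCl fun z hz => ?_
    have hcl : closure (Complex.re ⁻¹' Ioo (1 : ℝ) 2) ⊆ Complex.re ⁻¹' Icc 1 2 :=
      closure_minimal (preimage_mono Ioo_subset_Icc_self)
        (isClosed_Icc.preimage Complex.continuous_re)
    exact (differentiableAt_gammaQuot (one_pos.trans_le (hcl hz).1)).differentiableWithinAt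
  · obtain ⟨M, hM⟩ := isCompact_Icc.exists_bound_of_continuousOn
      (f := Real.Gamma) (s := Icc (1 : ℝ) 2) fun x hx => by
        refine (Real.differentiableAt_Gamma fun n h => ?_).continuousAt.continuousWithinAt
        have := hx.1
        linarith [(Nat.cast_nonneg n : (0 : ℝ) ≤ n)]
    refine ⟨1, by norm_num; linarith [Real.pi_gt_three], Real.pi / 2,
      Asymptotics.IsBigO.of_bound M ?_⟩
    refine Filter.Eventually.filter_mono inf_le_right ?_
    rw [eventually_principal]
    intro z hz
    have hz1 : 1 < z.re := hz.1
    have hz0 : z ≠ 0 := by rintro rfl; simp at hz1; linarith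
    have hn1 : 1 ≤ ‖z‖ := by
      have := Complex.re_le_norm z
      linarith
    have hG : ‖Complex.Gamma z‖ ≤ M := (norm_Gamma_le_Gamma_re (by linarith)).trans
      ((le_abs_self _).trans (hM z.re ⟨hz1.le, (show z.re < 2 from hz.2).le⟩))
    have hM0 : 0 ≤ M := (norm_nonneg _).trans hG
    rw [gammaQuot, norm_mul, norm_stirling_factor hz0, Real.norm_of_nonneg (Real.exp_pos _).le]
    have h3 : ‖z‖ ^ (1 / 2 - z.re) ≤ 1 :=
      Real.rpow_le_one_of_one_le_of_nonpos hn1 (by linarith)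
    have h4 : Real.exp (z.im * z.arg) ≤
        Real.exp (Real.pi / 2 * Real.exp (1 * |z.im|)) := by
      rw [Real.exp_le_exp, one_mul]
      refine (im_mul_arg_le (by linarith)).trans ?_
      gcongr
      linarith [Real.add_one_le_exp |z.im|]
    calc _ ≤ M * (1 * Real.exp (Real.pi / 2 * Real.exp (1 * |z.im|))) := by gcongr
      _ = _ := by ring

/-- The decay of the Gamma function on the vertical line through a non-integer `σ < 2`, by descent from
the strip `1 < σ < 2` with the functional equation. -/
theorem exists_norm_Gamma_le (n : ℕ) : ∀ σ ∈ Ioo (1 - n : ℝ) (2 - n), ∃ C : ℝ, 0 ≤ C ∧ ∀ t : ℝ,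
    ‖Complex.Gamma (σ + t * Complex.I)‖ ≤
      C * (1 + |t|) ^ (σ - 1 / 2) * Real.exp (-(Real.pi / 2 * |t|)) := by
  have hpi := Real.pi_pos
  induction n with
  | zero =>
    intro σ hσ
    simp only [Nat.cast_zero, sub_zero] at hσ
    refine ⟨(1 + 2 * Real.pi) * Real.exp Real.pi * 2 ^ (σ - 1 / 2), by positivity, fun t => ?_⟩
    set z : ℂ := σ + t * Complex.I with hz
    have hre : z.re = σ := by simp [hz]
    have him : z.im = t := by simp [hz]
    have hz0 : z ≠ 0 := by
      intro h
      rw [h, Complex.zero_re] at hre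
      linarith [hσ.1]
    have hn : 0 < ‖z‖ := norm_pos_iff.2 hz0
    have h1 := norm_gammaQuot_le (z := z) (by rw [hre]; exact hσ.1.le) (by rw [hre]; exact hσ.2.le)
    rw [gammaQuot, norm_mul, norm_stirling_factor hz0, hre] at h1
    have h2 := le_im_mul_arg (z := z) (by rw [hre]; linarith [hσ.1])
    rw [hre, him] at h2
    have h3 : Real.exp (Real.pi / 2 * |t|) * Real.exp (-Real.pi) ≤ Real.exp (z.im * z.arg) := by
      rw [← Real.exp_add, Real.exp_le_exp, him]
      nlinarith [hσ.2]
    have h4 : ‖z‖ ≤ 2 * (1 + |t|) := by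
      refine (norm_add_le _ _).trans ?_
      rw [norm_mul, Complex.norm_I, Complex.norm_real, Complex.norm_real, Real.norm_eq_abs,
        Real.norm_eq_abs, abs_of_pos (by linarith [hσ.1])]
      linarith [hσ.2, abs_nonneg t]
    have h5 : ‖z‖ ^ (σ - 1 / 2) ≤ 2 ^ (σ - 1 / 2) * (1 + |t|) ^ (σ - 1 / 2) := by
      rw [← Real.mul_rpow zero_le_two (by positivity)]
      exact Real.rpow_le_rpow hn.le h4 (by linarith [hσ.1])
    have h6 : ‖z‖ ^ (1 / 2 - σ) * ‖z‖ ^ (σ - 1 / 2) = 1 := by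
      rw [← Real.rpow_add hn]; simp
    have h7 : Real.exp (Real.pi / 2 * |t|) * Real.exp (-(Real.pi / 2 * |t|)) = 1 := by
      rw [← Real.exp_add]; simp
    have h8 : Real.exp (-Real.pi) * Real.exp Real.pi = 1 := by
      rw [← Real.exp_add]; simp
    calc ‖Complex.Gamma z‖ = (‖Complex.Gamma z‖ * (‖z‖ ^ (1 / 2 - σ) *
          (Real.exp (Real.pi / 2 * |t|) * Real.exp (-Real.pi)))) * (‖z‖ ^ (σ - 1 / 2) *
          Real.exp (-(Real.pi / 2 * |t|)) * Real.exp Real.pi) := by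
          linear_combination (-‖Complex.Gamma z‖) * (h6 + (‖z‖ ^ (1 / 2 - σ) * ‖z‖ ^ (σ - 1 / 2)) * h7
            + (‖z‖ ^ (1 / 2 - σ) * ‖z‖ ^ (σ - 1 / 2)) * (Real.exp (Real.pi / 2 * |t|) *
              Real.exp (-(Real.pi / 2 * |t|))) * h8)
      _ ≤ (‖Complex.Gamma z‖ * (‖z‖ ^ (1 / 2 - σ) * Real.exp (z.im * z.arg))) *
          ((2 ^ (σ - 1 / 2) * (1 + |t|) ^ (σ - 1 / 2)) *
          Real.exp (-(Real.pi / 2 * |t|)) * Real.exp Real.pi) := by gcongr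
      _ ≤ (1 + 2 * Real.pi) * ((2 ^ (σ - 1 / 2) * (1 + |t|) ^ (σ - 1 / 2)) *
          Real.exp (-(Real.pi / 2 * |t|)) * Real.exp Real.pi) := by gcongr
      _ = _ := by ring
  | succ n ih =>
    intro σ hσ
    push_cast at hσ
    obtain ⟨C, hC0, hC⟩ := ih (σ + 1) ⟨by linarith [hσ.1], by linarith [hσ.2]⟩
    have hσ0 : σ ≠ 0 := by
      rintro rfl
      have h1 : (0 : ℝ) < (1 : ℤ) - (n : ℤ) := by push_cast; linarith [hσ.2]
      have h2 : ((1 : ℤ) - (n : ℤ) : ℝ) < 1 := by push_cast; linarith [hσ.1]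
      have h1' : 0 < 1 - (n : ℤ) := by exact_mod_cast h1
      have h2' : 1 - (n : ℤ) < 1 := by exact_mod_cast h2
      omega
    refine ⟨C * (|σ|⁻¹ + 1), by positivity, fun t => ?_⟩
    set z : ℂ := σ + t * Complex.I with hz
    have hre : z.re = σ := by simp [hz]
    have him : z.im = t := by simp [hz]
    have hz0 : z ≠ 0 := by
      intro h
      rw [h, Complex.zero_re] at hre
      exact hσ0 hre.symm
    have hn : 0 < ‖z‖ := norm_pos_iff.2 hz0
    have hge : 1 + |t| ≤ (|σ|⁻¹ + 1) * ‖z‖ := by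
      have h1 : |σ| ≤ ‖z‖ := hre ▸ Complex.abs_re_le_norm z
      have h2 : |t| ≤ ‖z‖ := him ▸ Complex.abs_im_le_norm z
      have h3 : 1 ≤ |σ|⁻¹ * ‖z‖ := by
        rw [inv_mul_eq_div, le_div_iff₀ (abs_pos.2 hσ0), one_mul]
        exact h1
      linarith
    have h1 := hC t
    have h2 : ((σ + 1 : ℝ) : ℂ) + t * Complex.I = z + 1 := by rw [hz]; push_cast; ring
    rw [h2, Complex.Gamma_add_one _ hz0, norm_mul] at h1
    have ht : 0 < 1 + |t| := by positivity
    have h3 : (1 + |t|) ^ (σ + 1 - 1 / 2) = (1 + |t|) ^ (σ - 1 / 2) * (1 + |t|) := by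
      rw [← Real.rpow_add_one ht.ne']; congr 1; ring
    rw [h3] at h1
    rw [← mul_le_mul_iff_right₀ hn]
    refine h1.trans ?_
    calc _ ≤ C * ((1 + |t|) ^ (σ - 1 / 2) * ((|σ|⁻¹ + 1) * ‖z‖)) *
          Real.exp (-(Real.pi / 2 * |t|)) := by gcongr
      _ = _ := by ring

/-- The Fourier transform of the wave function is bounded by the weight of the hypothesis on the
imaginary powers. -/
theorem exists_norm_I_cpow_mul_Gamma_le {α : ℝ} {m : ℕ} (hα : α - 1 / 2 ∈ Ioo (m : ℝ) (m + 1)) :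
    ∃ C : ℝ, 0 ≤ C ∧ ∀ t : ℝ, ‖Complex.I ^ (-(α : ℂ) + 1 / 2 + Complex.I * t) *
      Complex.Gamma (-(α : ℂ) + 1 / 2 + Complex.I * t)‖ ≤ C * (1 + t ^ 2) ^ (-α / 2) := by
  have hpi := Real.pi_pos
  obtain ⟨C, hC0, hC⟩ := exists_norm_Gamma_le (m + 2) (1 / 2 - α)
    ⟨by push_cast; linarith [hα.2], by push_cast; linarith [hα.1]⟩
  refine ⟨C, hC0, fun t => ?_⟩
  have hz : (-(α : ℂ) + 1 / 2 + Complex.I * t) = ((1 / 2 - α : ℝ) : ℂ) + t * Complex.I := by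
    push_cast; ring
  rw [hz, norm_mul, Complex.norm_cpow_of_ne_zero Complex.I_ne_zero, Complex.norm_I, Real.one_rpow,
    Complex.arg_I, one_div, ← Real.exp_neg]
  have him : (((1 / 2 - α : ℝ) : ℂ) + t * Complex.I).im = t := by simp
  rw [him]
  have h1 : Real.exp (-(Real.pi / 2 * t)) ≤ Real.exp (Real.pi / 2 * |t|) := by
    rw [Real.exp_le_exp]
    nlinarith [neg_abs_le t]
  have h7 : Real.exp (Real.pi / 2 * |t|) * Real.exp (-(Real.pi / 2 * |t|)) = 1 := by
    rw [← Real.exp_add]; simp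
  have h8 : (1 + |t|) ^ (1 / 2 - α - 1 / 2) ≤ (1 + t ^ 2) ^ (-α / 2) := by
    have hα0 : 0 < α := by linarith [hα.1, (Nat.cast_nonneg m : (0 : ℝ) ≤ m)]
    have h9 : (1 + |t|) ^ (1 / 2 - α - 1 / 2) = ((1 + |t|) ^ 2) ^ (-α / 2) := by
      rw [← Real.rpow_natCast, ← Real.rpow_mul (by positivity)]
      congr 1
      push_cast; ring
    rw [h9]
    refine Real.rpow_le_rpow_of_nonpos (by positivity) ?_ (by linarith)
    nlinarith [abs_nonneg t, sq_abs t]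
  calc _ ≤ Real.exp (Real.pi / 2 * |t|) * (C * (1 + |t|) ^ (1 / 2 - α - 1 / 2) *
        Real.exp (-(Real.pi / 2 * |t|))) := by
        gcongr
        exact hC t
    _ = C * (1 + |t|) ^ (1 / 2 - α - 1 / 2) * (Real.exp (Real.pi / 2 * |t|) *
        Real.exp (-(Real.pi / 2 * |t|))) := by ring
    _ ≤ C * (1 + t ^ 2) ^ (-α / 2) := by rw [h7, mul_one]; gcongr

end Gamma

/-! ### Weak Fourier transforms in `L²` -/

section WeakFourier

theorem integral_mul_fourier_lp (f : Lp ℂ 2 (volume : Measure ℝ)) (η : 𝓢(ℝ, ℂ)) :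
    ∫ ξ, η ξ * (𝓕 f : Lp ℂ 2 (volume : Measure ℝ)) ξ = ∫ u, 𝓕 η u * f u := by
  have h := congrArg (fun T => T η) (Lp.fourier_toTemperedDistribution_eq f)
  simpa only [TemperedDistribution.fourier_apply, Lp.toTemperedDistribution_apply, smul_eq_mul]
    using h.symm

theorem integral_mul_fourierInv_lp (f : Lp ℂ 2 (volume : Measure ℝ)) (η : 𝓢(ℝ, ℂ)) :
    ∫ u, η u * (𝓕⁻ f : Lp ℂ 2 (volume : Measure ℝ)) u = ∫ ξ, 𝓕⁻ η ξ * f ξ := by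
  have h := integral_mul_fourier_lp (𝓕⁻ f) (𝓕⁻ η)
  rw [FourierTransform.fourier_fourierInv_eq, FourierTransform.fourier_fourierInv_eq] at h
  exact h.symm

theorem ae_eq_of_forall_integral_schwartz_mul_eq {f g : ℝ → ℂ} (hf : LocallyIntegrable f)
    (hg : LocallyIntegrable g)
    (h : ∀ η : 𝓢(ℝ, ℂ), HasCompactSupport η → ∫ x, η x * f x = ∫ x, η x * g x) :
    f =ᵐ[volume] g := by
  refine ae_eq_of_integral_contDiff_smul_eq hf hg fun b hb hbc => ?_
  have h1 : HasCompactSupport fun x => ((b x : ℝ) : ℂ) := hbc.comp_left Complex.ofReal_zero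
  simpa only [Complex.real_smul] using! h (h1.toSchwartzMap (Complex.ofRealCLM.contDiff.comp hb)) h1

/-- A function which is a Fourier transform in the sense of distributions and has polynomial growth
lies in `L²` as soon as its inverse transform does, and conversely; the two functions then correspond
to each other under the Plancherel isometry. -/
theorem exists_fourier_toLp_ae_eq {H q : ℝ → ℂ} {C β : ℝ} (hβ : 0 ≤ β) (hH : Continuous H)
    (hq : Continuous q) (hC : ∀ ξ, ‖q ξ‖ ≤ C * (1 + |ξ|) ^ β)
    (hHq : ∀ η : 𝓢(ℝ, ℂ), HasCompactSupport η → ∫ v, H v * η v = ∫ ξ, q ξ * 𝓕⁻ η ξ)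
    (h : MemLp q 2 volume ∨ MemLp H 2 volume) :
    ∃ (hH2 : MemLp H 2 volume), MemLp q 2 volume ∧
      (𝓕 (hH2.toLp H) : Lp ℂ 2 (volume : Measure ℝ)) =ᵐ[volume] q := by
  rcases h with h | h
  · have h1 : (𝓕⁻ (h.toLp q) : Lp ℂ 2 (volume : Measure ℝ)) =ᵐ[volume] H := by
      refine ae_eq_of_forall_integral_schwartz_mul_eq ((Lp.memLp _).locallyIntegrable one_le_two)
        hH.locallyIntegrable fun η hη => ?_
      rw [integral_mul_fourierInv_lp]
      have h2 := hHq η hη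
      simp only [mul_comm (η _)]
      rw [h2]
      refine integral_congr_ae ?_
      filter_upwards [h.coeFn_toLp] with ξ hξ
      rw [hξ, mul_comm]
    have hH2 : MemLp H 2 volume := (memLp_congr_ae h1).1 (Lp.memLp _)
    refine ⟨hH2, h, ?_⟩
    have h3 : hH2.toLp H = (𝓕⁻ (h.toLp q) : Lp ℂ 2 (volume : Measure ℝ)) :=
      Lp.ext (hH2.coeFn_toLp.trans h1.symm)
    rw [h3, FourierTransform.fourier_fourierInv_eq]
    exact h.coeFn_toLp
  · set p : Lp ℂ 2 (volume : Measure ℝ) := 𝓕 (h.toLp H) with hp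
    have hp2 : MemLp p 2 volume := Lp.memLp _
    have hpinv : (𝓕⁻ p : Lp ℂ 2 (volume : Measure ℝ)) = h.toLp H := by
      rw [hp, FourierTransform.fourierInv_fourier_eq]
    -- the weight makes both functions integrable
    have hwp : Integrable fun ξ : ℝ => (((1 + |ξ|) ^ (-(β + 2)) : ℝ) : ℂ) * p ξ := by
      have hw : MemLp (fun ξ : ℝ => (((1 + |ξ|) ^ (-(β + 2)) : ℝ) : ℂ)) 2 volume := by
        have hc : Continuous fun ξ : ℝ => (((1 + |ξ|) ^ (-(β + 2)) : ℝ) : ℂ) :=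
          Complex.continuous_ofReal.comp (continuous_weight _)
        rw [memLp_two_iff_integrable_sq_norm hc.aestronglyMeasurable]
        refine (integrable_weight (K := 2 * (β + 2)) (by linarith)).congr (ae_of_all _ fun ξ => ?_)
        simp only
        rw [Complex.norm_real, Real.norm_of_nonneg (by positivity), ← Real.rpow_natCast,
          ← Real.rpow_mul (by positivity)]
        congr 1
        push_cast; ring
      exact hw.integrable_mul hp2
    have hwq : Integrable fun ξ : ℝ => (((1 + |ξ|) ^ (-(β + 2)) : ℝ) : ℂ) * q ξ := by
      refine Integrable.mono' ((integrable_weight (K := 2) one_lt_two).const_mul C)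
        ((Complex.continuous_ofReal.comp (continuous_weight _)).mul hq).aestronglyMeasurable
        (ae_of_all _ fun ξ => ?_)
      rw [norm_mul, Complex.norm_real, Real.norm_of_nonneg (by positivity)]
      calc (1 + |ξ|) ^ (-(β + 2)) * ‖q ξ‖ ≤ (1 + |ξ|) ^ (-(β + 2)) * (C * (1 + |ξ|) ^ β) := by
            gcongr
            exact hC ξ
        _ = C * ((1 + |ξ|) ^ (-(β + 2)) * (1 + |ξ|) ^ β) := by ring
        _ = C * (1 + |ξ|) ^ (-2 : ℝ) := by
            rw [← Real.rpow_add (by positivity)]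
            ring_nf
    set W : ℝ → ℂ := fun ξ => p (-ξ) - q (-ξ) with hWdef
    have hW : Integrable fun ξ : ℝ => (1 + |ξ|) ^ (-(β + 2)) • W ξ := by
      refine ((hwp.comp_neg).sub hwq.comp_neg).congr (ae_of_all _ fun ξ => ?_)
      simp [hWdef, Complex.real_smul, mul_sub]
    have hneg : ∀ (F : 𝓢(ℝ, ℂ)) (ξ : ℝ), 𝓕 F (-ξ) = 𝓕⁻ F ξ := fun F ξ => by
      rw [SchwartzMap.fourier_coe, SchwartzMap.fourierInv_coe, Real.fourierInv_eq_fourier_neg]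
    have hWl : LocallyIntegrable W := by
      refine LocallyIntegrable.sub ?_ (hq.comp continuous_neg).locallyIntegrable
      exact (hp2.comp_measurePreserving (Measure.measurePreserving_neg volume)).locallyIntegrable
        one_le_two
    have hqi : ∀ F : 𝓢(ℝ, ℂ), Integrable fun ξ => q ξ * F ξ := fun F => by
      refine Integrable.mono' ((integrable_schwartz_weight F β).const_mul C)
        (hq.mul F.continuous).aestronglyMeasurable (ae_of_all _ fun ξ => ?_)
      rw [norm_mul, ← mul_assoc]
      gcongr
      exact hC ξ
    have hpi : ∀ F : 𝓢(ℝ, ℂ), Integrable fun ξ => F ξ * p ξ := fun F =>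
      (F.memLp 2).integrable_mul hp2
    have hzero : ∀ F : 𝓢(ℝ, ℂ), HasCompactSupport F → ∫ ξ, 𝓕 F ξ • W ξ = 0 := fun F hF => by
      have e1 : ∫ ξ, 𝓕 F ξ • W ξ = ∫ ξ, 𝓕⁻ F ξ * p ξ - q ξ * 𝓕⁻ F ξ := by
        rw [← integral_neg_eq_self]
        congr 1
        ext1 ξ
        simp only [hWdef, hneg, neg_neg, smul_eq_mul]
        ring
      rw [e1, integral_sub (hpi _) (hqi _), ← integral_mul_fourierInv_lp, ← hHq F hF, hpinv,
        sub_eq_zero]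
      refine integral_congr_ae ?_
      filter_upwards [h.coeFn_toLp] with ξ hξ
      rw [hξ, mul_comm]
    have hW0 : W =ᵐ[volume] 0 := by
      refine ae_eq_of_forall_integral_schwartz_mul_eq hWl
        (locallyIntegrable_const (0 : ℂ)) fun η _ => ?_
      have h3 := integral_fourier_smul_eq_zero (by linarith) hW hzero (𝓕⁻ η)
      rw [FourierTransform.fourier_fourierInv_eq] at h3
      simpa using h3
    have hpq : p =ᵐ[volume] q := by
      have h4 := (Measure.measurePreserving_neg (volume : Measure ℝ)).quasiMeasurePreserving.ae hW0
      filter_upwards [h4] with ξ hξ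
      simpa [hWdef, sub_eq_zero] using hξ
    exact ⟨h, (memLp_congr_ae hpq).1 hp2, hpq⟩

theorem integral_mul_fourier_eq_flip {f g : ℝ → ℂ} (hf : Integrable f) (hg : Integrable g) :
    ∫ ξ, 𝓕 f ξ * g ξ = ∫ x, f x * 𝓕 g x := by
  simpa using! (VectorFourier.integral_fourierIntegral_smul_eq_flip (L := innerₗ ℝ)
    Real.continuous_fourierChar continuous_inner hf hg)

theorem continuous_fourier {f : ℝ → ℂ} (hf : Integrable f) : Continuous (𝓕 f) :=
  VectorFourier.fourierIntegral_continuous Real.continuous_fourierChar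
    (by exact continuous_inner) hf

theorem fourier_toLp_ae_eq {f : ℝ → ℂ} (hf : Integrable f) (hf2 : MemLp f 2 volume) :
    (𝓕 (hf2.toLp f) : Lp ℂ 2 (volume : Measure ℝ)) =ᵐ[volume] 𝓕 f := by
  refine ae_eq_of_forall_integral_schwartz_mul_eq ((Lp.memLp _).locallyIntegrable one_le_two)
    (continuous_fourier hf).locallyIntegrable fun η _ => ?_
  rw [integral_mul_fourier_lp]
  have h1 := integral_mul_fourier_eq_flip hf η.integrable
  simp only [mul_comm (η _), h1]
  refine integral_congr_ae ?_
  filter_upwards [hf2.coeFn_toLp] with x hx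
  rw [hx, SchwartzMap.fourier_coe, mul_comm]

/-- The Fourier integral of a truncation of an `L²` function is as far from the Fourier transform of
the function as the truncation is from the function. -/
theorem eLpNorm_fourier_sub_eq {f H q : ℝ → ℂ} (hf : Integrable f) (hf2 : MemLp f 2 volume)
    (hH : MemLp H 2 volume)
    (hq : (𝓕 (hH.toLp H) : Lp ℂ 2 (volume : Measure ℝ)) =ᵐ[volume] q) :
    eLpNorm (fun ξ => 𝓕 f ξ - q ξ) 2 volume = eLpNorm (fun u => f u - H u) 2 volume := by
  have h1 : eLpNorm (fun ξ => 𝓕 f ξ - q ξ) 2 volume =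
      ‖(𝓕 (hf2.toLp f - hH.toLp H) : Lp ℂ 2 (volume : Measure ℝ))‖ₑ := by
    rw [Lp.enorm_def]
    refine eLpNorm_congr_ae ?_
    have e : (𝓕 (hf2.toLp f - hH.toLp H) : Lp ℂ 2 (volume : Measure ℝ)) =
        𝓕 (hf2.toLp f) - 𝓕 (hH.toLp H) :=
      map_sub (FourierTransform.fourierCLM ℂ (Lp ℂ 2 (volume : Measure ℝ))) _ _
    rw [e]
    filter_upwards [Lp.coeFn_sub (𝓕 (hf2.toLp f) : Lp ℂ 2 (volume : Measure ℝ))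
      (𝓕 (hH.toLp H)), fourier_toLp_ae_eq hf hf2, hq] with ξ h2 h3 h4
    rw [h2, Pi.sub_apply, h3, h4]
  rw [h1, ← enorm_norm, Lp.norm_fourier_eq, enorm_norm, ← MemLp.toLp_sub, Lp.enorm_def]
  exact eLpNorm_congr_ae (MemLp.coeFn_toLp _)

end WeakFourier

/-! ### The Mellin transform in the logarithmic variable -/

section Mellin

theorem mulHaar_eq_map_exp : mulHaar = Measure.map Real.exp volume := by
  ext s hs
  have hm : Measurable fun s : ℝ => ENNReal.ofReal s⁻¹ := by fun_prop
  rw [mulHaar, withDensity_apply _ hs, ← lintegral_indicator hs, Measure.map_apply (by fun_prop) hs]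
  have h1 := lintegral_image_eq_lintegral_abs_deriv_mul (f := Real.exp) (f' := Real.exp)
    MeasurableSet.univ (fun x _ => (Real.hasDerivAt_exp x).hasDerivWithinAt)
    Real.exp_injective.injOn (s.indicator fun s : ℝ => ENNReal.ofReal s⁻¹)
  rw [image_univ, Real.range_exp, Measure.restrict_univ] at h1
  rw [h1, ← lintegral_indicator_one (measurableSet_preimage (by fun_prop) hs)]
  refine lintegral_congr fun x => ?_
  by_cases hx : Real.exp x ∈ s
  · rw [indicator_of_mem hx, indicator_of_mem (show x ∈ Real.exp ⁻¹' s from hx),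
      abs_of_pos (Real.exp_pos x), ← ENNReal.ofReal_mul (Real.exp_pos x).le,
      mul_inv_cancel₀ (Real.exp_pos x).ne', ENNReal.ofReal_one, Pi.one_apply]
  · rw [indicator_of_notMem hx, indicator_of_notMem (show x ∉ Real.exp ⁻¹' s from hx), mul_zero]

theorem memLp_mulHaar_iff {f : ℝ → ℂ} :
    MemLp f 2 mulHaar ↔ MemLp (fun u => f (Real.exp u)) 2 volume := by
  rw [mulHaar_eq_map_exp, Real.isOpenEmbedding_exp.measurableEmbedding.memLp_map_measure_iff]
  rfl

theorem eLpNorm_comp_mul_left {a : ℝ} (ha : a ≠ 0) (F : ℝ → ℂ) :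
    eLpNorm (fun t => F (a * t)) 2 volume =
      ENNReal.ofReal |a⁻¹| ^ (1 / 2 : ℝ) * eLpNorm F 2 volume := by
  have h1 := (Homeomorph.mulLeft₀ a ha).measurableEmbedding.eLpNorm_map_measure (g := F) (p := 2)
    (μ := volume)
  have h2 : Measure.map (Homeomorph.mulLeft₀ a ha) volume = ENNReal.ofReal |a⁻¹| • volume :=
    Real.map_volume_mul_left ha
  rw [h2, eLpNorm_smul_measure_of_ne_top ENNReal.ofNat_ne_top] at h1
  rw [show (fun t => F (a * t)) = F ∘ (Homeomorph.mulLeft₀ a ha) from rfl, ← h1]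
  simp

theorem memLp_comp_mul_left {a : ℝ} (ha : a ≠ 0) {F : ℝ → ℂ} (hF : MemLp F 2 volume) :
    MemLp (fun t => F (a * t)) 2 volume := by
  have h2 : MemLp F 2 (Measure.map (Homeomorph.mulLeft₀ a ha) volume) := by
    rw [show Measure.map (Homeomorph.mulLeft₀ a ha) volume = ENNReal.ofReal |a⁻¹| • volume from
      Real.map_volume_mul_left ha]
    exact hF.smul_measure ENNReal.ofReal_ne_top
  exact (Homeomorph.mulLeft₀ a ha).measurableEmbedding.memLp_map_measure_iff.1 h2

/-- The substitution `s = e^u` in a truncated Mellin integral. -/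
theorem truncated_mellin_eq_fourier {f H : ℝ → ℂ} (hfH : ∀ u, f (Real.exp u) = H u) {R : ℝ}
    (hR : 1 ≤ R) (t : ℝ) :
    ∫ s in R⁻¹..R, f s * (s : ℂ) ^ (Complex.I * t) / s =
      𝓕 ((Ioc (-Real.log R) (Real.log R)).indicator H) (-(2 * Real.pi)⁻¹ * t) := by
  have hR0 : 0 < R := by linarith
  have hmem : ∀ u, Real.exp u ∈ Ioc R⁻¹ R ↔ u ∈ Ioc (-Real.log R) (Real.log R) := fun u => by
    rw [mem_Ioc, mem_Ioc, Real.le_log_iff_exp_le hR0, ← Real.log_inv,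
      Real.log_lt_iff_lt_exp (inv_pos.2 hR0)]
  have hsub : Ioc R⁻¹ R ⊆ Ioi 0 := fun s hs => (inv_pos.2 hR0).trans hs.1
  rw [intervalIntegral.integral_of_le ((inv_le_one_of_one_le₀ hR).trans hR),
    ← inter_eq_right.2 hsub, ← setIntegral_indicator measurableSet_Ioc,
    integral_Ioi_eq_integral_exp, fourier_apply]
  congr 1
  ext1 u
  by_cases hu : u ∈ Ioc (-Real.log R) (Real.log R)
  · rw [indicator_of_mem hu, indicator_of_mem ((hmem u).2 hu), hfH, Complex.ofReal_exp,
      exp_cpow (by simpa using Real.pi_pos), Complex.real_smul, Complex.ofReal_exp]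
    have hpi : (Real.pi : ℂ) ≠ 0 := by exact_mod_cast Real.pi_ne_zero
    have h1 : -(2 * (Real.pi : ℂ) * ((-(2 * Real.pi)⁻¹ * t : ℝ) : ℂ) * u * Complex.I) =
        u * (Complex.I * t) := by
      push_cast
      field_simp
    rw [h1]
    field_simp [Complex.exp_ne_zero]
  · rw [indicator_of_notMem hu, indicator_of_notMem (fun h => hu ((hmem u).1 h)), smul_zero,
      mul_zero]

/-- The Mellin transform is the Fourier transform in the logarithmic variable; since `s^{it}` becomes
`e^{itu}`, the Mellin variable `t` corresponds to the frequency `-t / 2π`. -/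
theorem isMellinTransform_of_fourier {f H q : ℝ → ℂ} (hfH : ∀ u, f (Real.exp u) = H u)
    (hH : MemLp H 2 volume) (hq2 : MemLp q 2 volume)
    (hq : (𝓕 (hH.toLp H) : Lp ℂ 2 (volume : Measure ℝ)) =ᵐ[volume] q) :
    IsMellinTransform f fun t => q (-(2 * Real.pi)⁻¹ * t) := by
  have ha : -(2 * Real.pi)⁻¹ ≠ 0 := by have := Real.pi_pos; simp [this.ne']
  refine ⟨memLp_mulHaar_iff.2 (by simpa only [hfH] using hH), memLp_comp_mul_left ha hq2, ?_⟩
  set T : ℝ → ℝ → ℂ := fun R => (Ioc (-Real.log R) (Real.log R)).indicator H with hT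
  have hT2 : ∀ R, MemLp (T R) 2 volume := fun R => hH.indicator measurableSet_Ioc
  have hTi : ∀ R, Integrable (T R) := fun R =>
    (integrable_indicator_iff measurableSet_Ioc).2
      ((hH.locallyIntegrable one_le_two).integrableOn_isCompact isCompact_Icc |>.mono_set
        Ioc_subset_Icc_self)
  have hlim : Tendsto (fun R => eLpNorm (fun u => T R u - H u) 2 volume) atTop (𝓝 0) := by
    refine tendsto_eLpNorm_two_of_dominated
      (Eventually.of_forall fun R => ((hT2 R).sub hH).aestronglyMeasurable) hH
      (Eventually.of_forall fun R => ae_of_all _ fun u => ?_) (ae_of_all _ fun u => ?_)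
    · by_cases hu : u ∈ Ioc (-Real.log R) (Real.log R)
      · simp [hT, hu]
      · simp [hT, hu]
    -- at a fixed point the truncation is eventually inactive
    · refine tendsto_const_nhds.congr' ?_
      filter_upwards [Real.tendsto_log_atTop.eventually (eventually_gt_atTop |u|)] with R hR
      have hu : u ∈ Ioc (-Real.log R) (Real.log R) :=
        ⟨by linarith [neg_abs_le u], by linarith [le_abs_self u]⟩
      simp [hT, hu]
  have hlim2 := ENNReal.Tendsto.const_mul (a := ENNReal.ofReal |(-(2 * Real.pi)⁻¹)⁻¹| ^ (1 / 2 : ℝ))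
    hlim (Or.inr (by finiteness))
  rw [mul_zero] at hlim2
  refine hlim2.congr' ?_
  filter_upwards [eventually_ge_atTop 1] with R hR
  rw [← eLpNorm_fourier_sub_eq (hTi R) (hT2 R) hH hq, ← eLpNorm_comp_mul_left ha]
  congr 1
  ext1 t
  rw [truncated_mellin_eq_fourier hfH hR]

end Mellin

end WaveMellin


theorem mainTheorem5 {X : Type*} [NormedAddCommGroup X] [NormedSpace ℂ X] [CompleteSpace X]
    (A : X →ₗ.[ℂ] X) (hA : WaveMellin.IsZeroSectorial A)
    (β : ℝ) (hβ : 1 / 2 < β) (hcalc : WaveMellin.HasSobolevCalculus A β)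
    (φ : ℝ → ℂ) (hφ : WaveMellin.IsDyadicPartition φ)
    (α : ℝ) (m : ℕ) (hα : α - 1 / 2 ∈ Set.Ioo (m : ℝ) (m + 1))
    (x : X) (hx : x ∈ WaveMellin.core A β φ) (x' : X →L[ℂ] ℂ)
    (hL2 : MemLp (fun t : ℝ => (((1 + t ^ 2) ^ (-α / 2) : ℝ) : ℂ) *
          WaveMellin.pairing (WaveMellin.imagPow A t) x x') 2 volume ∨
        MemLp (fun s : ℝ => WaveMellin.pairing (WaveMellin.waveOp A β φ α m s) x x') 2
          WaveMellin.mulHaar) :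
    (∀ s : ℝ, 0 < s → x ∈ (WaveMellin.waveOp A β φ α m s).domain) ∧
    (∀ t : ℝ, x ∈ (WaveMellin.imagPow A t).domain) ∧
    WaveMellin.IsMellinTransform
      (fun s : ℝ => WaveMellin.pairing (WaveMellin.waveOp A β φ α m s) x x')
      (fun t : ℝ => Complex.I ^ (-(α : ℂ) + 1 / 2 + Complex.I * t) *
        Complex.Gamma (-(α : ℂ) + 1 / 2 + Complex.I * t) *
        WaveMellin.pairing (WaveMellin.imagPow A (-t)) x x') := by
  have hβ0 : 0 ≤ β := by linarith
  obtain ⟨N, hN⟩ := WaveMellin.exists_dyadSum_apply_eq hA hβ0 hcalc hφ hx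
  obtain ⟨y, rfl⟩ := WaveMellin.exists_rho_apply_eq hA hβ0 hcalc hφ hN
  have hG := WaveMellin.contDiff_waveExp α m
  have hGi := WaveMellin.integrable_waveExp hα
  set H : ℝ → ℂ := WaveMellin.orbitCoeff hG A β hφ N
    (WaveMellin.cauchyIntegral A (Real.pi / 2) WaveMellin.rho y) x' with hH
  set q : ℝ → ℂ := fun ξ => FourierTransform.fourier (WaveMellin.waveExp α m) ξ *
    x' (WaveMellin.regImagPow A (2 * Real.pi * ξ) y) with hq
  -- `H (log s)` is the pairing with the wave operator, `q (-t / 2π)` the right-hand side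
  have hwave : ∀ s : ℝ, 0 < s → (WaveMellin.cauchyIntegral A (Real.pi / 2) WaveMellin.rho y,
      WaveMellin.schwartzCalc A β (WaveMellin.smoothMul
        (WaveMellin.contDiff_comp_add hG (Real.log s)) (WaveMellin.hasCompactSupport_dyadSum hφ N))
        (WaveMellin.cauchyIntegral A (Real.pi / 2) WaveMellin.rho y)) ∈
      (WaveMellin.waveOp A β φ α m s).graph := fun s hs =>
    WaveMellin.mem_graph_locCalc hA hβ0 hcalc hφ _
      (fun u => WaveMellin.mul_waveFun_eq_waveExp α m hs u) hx hN
  have himag := WaveMellin.mem_graph_imagPow hA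
  have hpair : ∀ t, WaveMellin.pairing (WaveMellin.imagPow A t)
      (WaveMellin.cauchyIntegral A (Real.pi / 2) WaveMellin.rho y) x' =
      x' (WaveMellin.regImagPow A t y) := fun t =>
    WaveMellin.pairing_eq_of_mem_graph (himag t y) x'
  have hpairH : ∀ u, WaveMellin.pairing (WaveMellin.waveOp A β φ α m (Real.exp u))
      (WaveMellin.cauchyIntegral A (Real.pi / 2) WaveMellin.rho y) x' = H u := fun u => by
    rw [WaveMellin.pairing_eq_of_mem_graph (hwave _ (Real.exp_pos u)) x', hH,
      WaveMellin.orbitCoeff]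
    simp only [Real.log_exp]
  refine ⟨fun s hs => LinearPMap.mem_domain_of_mem_graph (hwave s hs),
    fun t => LinearPMap.mem_domain_of_mem_graph (himag t y), ?_⟩
  have hqc : Continuous q :=
    (WaveMellin.continuous_fourier hGi).mul (WaveMellin.continuous_apply_regImagPow hA y x')
  have hqG : ∀ t : ℝ, q (-(2 * Real.pi)⁻¹ * t) =
      Complex.I ^ (-(α : ℂ) + 1 / 2 + Complex.I * t) *
        Complex.Gamma (-(α : ℂ) + 1 / 2 + Complex.I * t) *
        WaveMellin.pairing (WaveMellin.imagPow A (-t))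
          (WaveMellin.cauchyIntegral A (Real.pi / 2) WaveMellin.rho y) x' := fun t => by
    have e : 2 * Real.pi * (-(2 * Real.pi)⁻¹ * t) = -t := by
      have := Real.pi_ne_zero
      field_simp
    rw [hpair, hq]
    simp only
    rw [WaveMellin.fourier_waveExp hα, e, neg_neg]
  obtain ⟨C, hC⟩ := WaveMellin.exists_bound_apply_regImagPow hA hβ0 hcalc y x'
  have hqb : ∀ ξ, ‖q ξ‖ ≤ (∫ u, ‖WaveMellin.waveExp α m u‖) * C * (1 + |ξ|) ^ β := fun ξ => by
    rw [hq, norm_mul, mul_assoc (∫ u, _)]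
    exact mul_le_mul (WaveMellin.norm_fourier_le_of_norm_le hGi (fun _ => le_rfl) ξ) (hC ξ)
      (norm_nonneg _) (integral_nonneg fun _ => norm_nonneg _)
  have hor : MemLp q 2 volume ∨ MemLp H 2 volume := by
    refine hL2.imp (fun h => ?_) (fun h => ?_)
    -- the decay of the Gamma factor is that of the weight in the first alternative
    · obtain ⟨D, hD0, hD⟩ := WaveMellin.exists_norm_I_cpow_mul_Gamma_le hα
      have hpi : (2 * Real.pi) ≠ 0 := by positivity
      -- the hypothesis is about `A^{it}` while the frequency is `ξ = t / 2π`
      refine (WaveMellin.memLp_comp_mul_left hpi h).of_le_mul (c := D) hqc.aestronglyMeasurable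
        (Filter.Eventually.of_forall fun ξ => ?_)
      have h1 := hD (-(2 * Real.pi * ξ))
      rw [hq, hpair, norm_mul, norm_mul, WaveMellin.fourier_waveExp hα, Complex.norm_real,
        Real.norm_of_nonneg (by positivity), ← mul_assoc]
      rw [neg_sq] at h1
      gcongr
    · have h1 := WaveMellin.memLp_mulHaar_iff.1 h
      simpa only [hpairH] using h1
  obtain ⟨hH2, hq2, hFq⟩ := WaveMellin.exists_fourier_toLp_ae_eq hβ0
    (WaveMellin.continuous_orbitCoeff hG hA hβ0 hcalc hφ hN x') hqc hqb
    (fun η hη => WaveMellin.integral_orbitCoeff_mul hG hA hβ0 hcalc hφ hGi hN x' hη) hor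
  have hM := WaveMellin.isMellinTransform_of_fourier
    (f := fun s => WaveMellin.pairing (WaveMellin.waveOp A β φ α m s)
      (WaveMellin.cauchyIntegral A (Real.pi / 2) WaveMellin.rho y) x') hpairH hH2 hq2 hFq
  simpa only [hqG] using hM
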